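/- **Notation.** For $\beta\in[0,1]$ let $f_\beta(x)=\frac1\beta\tanh^{-1}(\beta\tanh x)$ for $\beta>0$ and $f_0=\tanh$. Let $\ell(v,y)=\log(1+e^{-2vy})$ be the logistic loss. For integers $n,D\ge1$ let $\varphi_D(x)=(x^\alpha)_{|\alpha|\le D}$ be the vector of all monomials (with repetition) of total degree at most $D$ in $x\in\mathbb R^n$. For $R\ge0$ and a sample $(x_i,y_i)_{i\le m}$ let $\hat L(u)=\frac1m\sum_{i}\ell(u\cdot\varphi_D(x_i),y_i)$; *$\ell_1$-constrained logistic regression with radius $R$* is the minimization of $\hat L(u)$ over $\|u\|_1\le R$. **Setting.** Let $n,D,m\ge1$. Let $Y$ be a random variable with values in $\{\pm1\}$ and $X$ a random vector in $\mathbb R^n$ with $\|X\|_\infty\le1$ almost surely, such that $$\mathbb E[Y\mid X]=\tanh(v^*(X)),\qquad v^*(x)=b^{(1)}+\sum_j w_j f_{\beta_j}\Big(b^{(2)}_j+\sum_k W_{jk}x_k\Big),$$ where $b^{(1)}\in\mathbb R$, $\beta_j\in[0,1]$, and $w$, $b^{(2)}$ and $W$ are an arbitrary real vector, vector and matrix ($j$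 ranges over a finite set of hidden units). Write $W_j=(W_{jk})_k$, and put $$R:=|b^{(1)}|+\sum_j|w_j|\max\Big\{\sqrt{D+1}\,(4e)^{D+1}(1+\|W_j\|_1)^{D+1},\ 2\,|f_{\beta_j}(b^{(2)}_j)|\Big\}.$$ **Theorem.** 1. $v^*(X)=\tanh^{-1}(\mathbb E[Y\mid X])$ almost surely, $\ell(v^*(X),Y)$ is integrable, and $v^*$ minimizes $\mathbb E[\ell(g(X),Y)]$ over all measurable $g:\mathbb R^n\to\mathbb R$. 2. $\ell_1$-constrained logistic regression with radius $R$ has a solution on every sample. Let $0<\delta<1$. With probability at least $1-\delta$ over $m$ i.i.d. copies of $(X,Y)$, every solution $\hat w$ satisfies $$\mathbb E[\ell(\hat w\cdot\varphi_D(X),Y)]-\mathbb E[\ell(v^*(X),Y)]\le 8\sum_j|w_j|\frac{\|W_j\|_1+2\|W_j\|_1^2}{\left(1+\frac1{2\|W_j\|_1}\right)^D}+4R\sqrt{\frac{2D\log(2n)}m}+2R\sqrt{\frac{2\log(2/\delta)}m},$$ where the $j$-th summand is read as $0$ if $W_j=0$, and the expectations on the left are over $(X,Y)$ with $\hat w$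 fixed. 3. The runtime is $\mathrm{poly}(n^D)$ (and polynomial in the number of samples and in the inverse accuracy). Precisely, there are a single program for the real random-access machine (unit-cost operations $+,-,\times,/,\exp$ and comparison on reals, and $0,+1,+$, truncated $-$ and comparison on integers used for control, addressing and exponents) and a constant $C$ such that the following holds. Given $n,D,m\ge1$, an accuracy parameter $\tau\ge1$, a radius $R\ge0$ and a sample with $\|x_i\|_\infty\le1$ and $y_i\in\{\pm1\}$, the program halts after at most $C\,(m\,\tau\,\max(n,2)^D)^C$ steps and outputs a coefficient vector $\hat w$ (as a list of terms) with $\|\hat w\|_1\le R$ and $\hat L(\hat w)\le\min_{\|u\|_1\le R}\hat L(u)+R/\tau$. In the setting above, with the stated $R$ and any $\tau\ge4m$, the output $\hat w$ satisfies the inequality in 2 with probability at least $1-\delta$. -/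

import Mathlib

open MeasureTheory ProbabilityTheory

noncomputable section

/-! ## Activations, networks, monomial features, logistic loss -/

/-- The activation `f_β(x) = β⁻¹ artanh (β tanh x)`, with its limit `tanh x` at `β = 0`. -/
def fAct (β x : ℝ) : ℝ :=
  if β = 0 then Real.tanh x else Real.artanh (β * Real.tanh x) / β

/-- The `ℓ¹` norm of a finite family of reals. -/
def l1norm {ι : Type*} [Fintype ι] (v : ι → ℝ) : ℝ := ∑ i, |v i|

/-- `v*(x) = b₁ + ∑ⱼ wⱼ f_{βⱼ}(b₂ⱼ + ∑ₖ W_{jk} xₖ)`: the network before the output `tanh`.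
`W j` is the vector of weights entering hidden unit `j`. -/
def netPre {n h : ℕ} (b₁ : ℝ) (w : Fin h → ℝ) (β : Fin h → ℝ) (b₂ : Fin h → ℝ)
    (W : Fin h → Fin n → ℝ) (x : Fin n → ℝ) : ℝ :=
  b₁ + ∑ j, w j * fAct (β j) (b₂ j + ∑ k, W j k * x k)

/-- The logistic loss `ℓ(v, y) = log (1 + exp (-2 v y))`. -/
def logisticLoss (v y : ℝ) : ℝ := Real.log (1 + Real.exp (-2 * v * y))

/-- The monomials of total degree at most `D` in `n` variables, as exponent vectors. -/
abbrev Mono (n D : ℕ) : Type := {α : Fin n → Fin (D + 1) // ∑ i, (α i : ℕ) ≤ D}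

/-- The degree-`D` monomial feature map. -/
def monoFeature (n D : ℕ) (x : Fin n → ℝ) (α : Mono n D) : ℝ :=
  ∏ i, x i ^ (α.1 i : ℕ)

/-- The linear predictor `u · φ_D(x)`. -/
def predict {n D : ℕ} (u : Mono n D → ℝ) (x : Fin n → ℝ) : ℝ :=
  ∑ α, u α * monoFeature n D x α

/-- The empirical logistic loss of `u · φ_D` on the sample `(x₁, y₁), …, (x_m, y_m)`. -/
def empLoss {n D m : ℕ} (x : Fin m → Fin n → ℝ) (y : Fin m → ℝ) (u : Mono n D → ℝ) : ℝ :=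
  (∑ i, logisticLoss (predict u (x i)) (y i)) / m

/-- `u` solves the `ℓ¹`-constrained logistic regression problem: it minimizes the empirical
logistic loss over all coefficient vectors of `ℓ¹` norm at most `R`. -/
def IsL1Regression {n D m : ℕ} (R : ℝ) (x : Fin m → Fin n → ℝ) (y : Fin m → ℝ)
    (u : Mono n D → ℝ) : Prop :=
  l1norm u ≤ R ∧ ∀ u' : Mono n D → ℝ, l1norm u' ≤ R → empLoss x y u ≤ empLoss x y u'

/-- The `ℓ¹` radius. -/
def l1Radius {n h : ℕ} (D : ℕ) (b₁ : ℝ) (w : Fin h → ℝ) (β : Fin h → ℝ) (b₂ : Fin h → ℝ)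
    (W : Fin h → Fin n → ℝ) : ℝ :=
  |b₁| + ∑ j, |w j| * max
    (Real.sqrt (D + 1) * (4 * Real.exp 1) ^ (D + 1) * (1 + l1norm (W j)) ^ (D + 1))
    (2 * |fAct (β j) (b₂ j)|)

/-- The bound on the excess loss. For `W j = 0` the `j`-th summand is `0`. -/
def excessBound {n h : ℕ} (D m : ℕ) (R δ : ℝ) (w : Fin h → ℝ) (W : Fin h → Fin n → ℝ) : ℝ :=
  8 * ∑ j, |w j| * ((l1norm (W j) + 2 * l1norm (W j) ^ 2) / (1 + 1 / (2 * l1norm (W j))) ^ D)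
    + 4 * R * Real.sqrt (2 * D * Real.log (2 * n) / m)
    + 2 * R * Real.sqrt (2 * Real.log (2 / δ) / m)

/-! ## A real random-access machine with unit-cost steps

While-programs over integer registers `ix`, real registers `re`, and two-dimensional integer and
real memories. Memory is addressed indirectly, through integer registers. The primitive operations
are the rational operations and `exp` on reals, comparisons, and `0`, `+1`, `+`, truncated `-` on
integers; there is no rounding of reals and no integer multiplication. -/

namespace RealRAM

/-- A machine state. -/
structure State where
  ix : ℕ → ℕ
  re : ℕ → ℝ
  imem : ℕ → ℕ → ℕ
  rmem : ℕ → ℕ → ℝ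

/-- Primitive instructions; the arguments are register numbers, the target first. -/
inductive Instr : Type
  | izero (a : ℕ)
  | isucc (a : ℕ)
  | iadd (a b c : ℕ)
  | isub (a b c : ℕ)
  | iload (a p q : ℕ)
  | istore (p q a : ℕ)
  | rzero (a : ℕ)
  | rone (a : ℕ)
  | radd (a b c : ℕ)
  | rsub (a b c : ℕ)
  | rmul (a b c : ℕ)
  | rdiv (a b c : ℕ)
  | rexp (a b : ℕ)
  | rload (a p q : ℕ)
  | rstore (p q a : ℕ)

/-- The cell `(p, q)` of a two-dimensional memory is overwritten by `v`. -/
def write {α : Type} (M : ℕ → ℕ → α) (p q : ℕ) (v : α) : ℕ → ℕ → α :=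
  Function.update M p (Function.update (M p) q v)

/-- The effect of a primitive instruction. -/
def Instr.run : Instr → State → State
  | .izero a, s => { s with ix := Function.update s.ix a 0 }
  | .isucc a, s => { s with ix := Function.update s.ix a (s.ix a + 1) }
  | .iadd a b c, s => { s with ix := Function.update s.ix a (s.ix b + s.ix c) }
  | .isub a b c, s => { s with ix := Function.update s.ix a (s.ix b - s.ix c) }
  | .iload a p q, s => { s with ix := Function.update s.ix a (s.imem (s.ix p) (s.ix q)) }
  | .istore p q a, s => { s with imem := write s.imem (s.ix p) (s.ix q) (s.ix a) }
  | .rzero a, s => { s with re := Function.update s.re a 0 }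
  | .rone a, s => { s with re := Function.update s.re a 1 }
  | .radd a b c, s => { s with re := Function.update s.re a (s.re b + s.re c) }
  | .rsub a b c, s => { s with re := Function.update s.re a (s.re b - s.re c) }
  | .rmul a b c, s => { s with re := Function.update s.re a (s.re b * s.re c) }
  | .rdiv a b c, s => { s with re := Function.update s.re a (s.re b / s.re c) }
  | .rexp a b, s => { s with re := Function.update s.re a (Real.exp (s.re b)) }
  | .rload a p q, s => { s with re := Function.update s.re a (s.rmem (s.ix p) (s.ix q)) }
  | .rstore p q a, s => { s with rmem := write s.rmem (s.ix p) (s.ix q) (s.re a) }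

/-- Tests: comparison of two integer registers, or of two real registers. -/
inductive Test : Type
  | ilt (a b : ℕ)
  | rlt (a b : ℕ)

/-- The truth of a test in a state. -/
def Test.Holds : Test → State → Prop
  | .ilt a b, s => s.ix a < s.ix b
  | .rlt a b, s => s.re a < s.re b

/-- Programs. -/
inductive Prog : Type
  | prim (i : Instr)
  | seq (p q : Prog)
  | cond (c : Test) (p q : Prog)
  | loop (c : Test) (p : Prog)

/-- `Exec p s t s'`: started in `s`, the program `p` halts in `s'` after exactly `t` steps.
Each primitive instruction and each evaluation of a test is one step. -/
inductive Exec : Prog → State → ℕ → State → Prop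
  | prim (i : Instr) (s : State) : Exec (.prim i) s 1 (i.run s)
  | seq {p q : Prog} {s s' s'' : State} {t t' : ℕ} :
      Exec p s t s' → Exec q s' t' s'' → Exec (.seq p q) s (t + t') s''
  | condTrue {c : Test} {p q : Prog} {s s' : State} {t : ℕ} :
      c.Holds s → Exec p s t s' → Exec (.cond c p q) s (t + 1) s'
  | condFalse {c : Test} {p q : Prog} {s s' : State} {t : ℕ} :
      ¬ c.Holds s → Exec q s t s' → Exec (.cond c p q) s (t + 1) s'
  | loopStop {c : Test} {p : Prog} {s : State} :
      ¬ c.Holds s → Exec (.loop c p) s 1 s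
  | loopStep {c : Test} {p : Prog} {s s' s'' : State} {t t' : ℕ} :
      c.Holds s → Exec p s t s' → Exec (.loop c p) s' t' s'' →
        Exec (.loop c p) s (t + t' + 1) s''

/-- The initial state for a regression problem: `n, D, m` and the accuracy parameter `τ` are in
integer registers `0, 1, 2, 3`, the radius `R` is in real register `0`, row `i < m` of the real
memory holds `xᵢ` in columns `0, …, n - 1` and `yᵢ` in column `n`; everything else is `0`. -/
def input (n D m τ : ℕ) (R : ℝ) (x : Fin m → Fin n → ℝ) (y : Fin m → ℝ) : State where
  ix := fun a => if a = 0 then n else if a = 1 then D else if a = 2 then m else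
    if a = 3 then τ else 0
  re := fun a => if a = 0 then R else 0
  imem := fun _ _ => 0
  rmem := fun p q => if hp : p < m then
      (if hq : q < n then x ⟨p, hp⟩ ⟨q, hq⟩ else if q = n then y ⟨p, hp⟩ else 0)
    else 0

/-- A final state represents a coefficient vector `u` as a list of terms (equal monomials are
added up): integer register `0` holds the number of terms, and for the `k`-th term, row `k` of the
integer memory holds the exponents in columns `0, …, n - 1`, and cell `(k, n + 1)` of the real
memory holds the coefficient. -/
def Represents {n D : ℕ} (s : State) (u : Mono n D → ℝ) : Prop :=
  (∀ k < s.ix 0, ∑ j : Fin n, s.imem k j ≤ D) ∧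
  ∀ α : Mono n D, u α = ∑ k ∈ Finset.range (s.ix 0),
    if ∀ j : Fin n, s.imem k j = (α.1 j : ℕ) then s.rmem k (n + 1) else 0

/-- On the given problem the program `A` halts after `t` steps, with output `u` (a list of at most
`t` terms). -/
def Outputs {n D m : ℕ} (A : Prog) (τ : ℕ) (R : ℝ) (x : Fin m → Fin n → ℝ) (y : Fin m → ℝ)
    (t : ℕ) (u : Mono n D → ℝ) : Prop :=
  ∃ s : State, Exec A (input n D m τ R x y) t s ∧ s.ix 0 ≤ t ∧ Represents s u

end RealRAM

end

/-! ### Coefficient vectors and polynomials of controlled `ℓ¹` norm -/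

/-- The vector of coefficients of a finite list of terms. -/
noncomputable def collect {ι : Type*} [Fintype ι] {n : ℕ} (D : ℕ) (e : ι → Fin n → ℕ) (c : ι → ℝ) :
    Mono n D → ℝ :=
  fun α => ∑ i, if ∀ j, e i j = (α.1 j : ℕ) then c i else 0

/-- An exponent vector of total degree at most `D`, as an element of `Mono n D`. -/
def toMono {n D : ℕ} (e : Fin n → ℕ) (he : ∑ j, e j ≤ D) : Mono n D :=
  ⟨fun j => ⟨e j, Nat.lt_succ_of_le
    ((Finset.single_le_sum (fun _ _ => Nat.zero_le _) (Finset.mem_univ j)).trans he)⟩, he⟩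

lemma forall_eq_iff_toMono {n D : ℕ} (e : Fin n → ℕ) (he : ∑ j, e j ≤ D) (α : Mono n D) :
    (∀ j, e j = (α.1 j : ℕ)) ↔ toMono e he = α := by
  constructor
  · intro h
    apply Subtype.ext
    funext j
    exact Fin.ext (h j)
  · rintro rfl j
    rfl

section collect
variable {ι : Type*} [Fintype ι] {n D : ℕ} {e : ι → Fin n → ℕ} (c : ι → ℝ)

lemma collect_sum_mul (he : ∀ i, ∑ j, e i j ≤ D) (f : Mono n D → ℝ) :
    ∑ α, collect D e c α * f α = ∑ i, c i * f (toMono (e i) (he i)) := by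
  simp only [collect, Finset.sum_mul]
  rw [Finset.sum_comm]
  refine Finset.sum_congr rfl fun i _ => ?_
  simp_rw [forall_eq_iff_toMono (e i) (he i), ite_mul, zero_mul]
  simp

lemma predict_collect (he : ∀ i, ∑ j, e i j ≤ D) (x : Fin n → ℝ) :
    predict (collect D e c) x = ∑ i, c i * ∏ j, x j ^ e i j := by
  rw [predict, collect_sum_mul c he]
  rfl

/-- The norm is the pairing of the vector with its own signs, hence by `collect_sum_mul` a signed
sum of the coefficients of the terms. Merging equal monomials can only produce cancellation. -/
lemma l1norm_collect_le (he : ∀ i, ∑ j, e i j ≤ D) :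
    l1norm (collect D e c) ≤ ∑ i, |c i| := by
  have h : ∀ α, |collect D e c α| = collect D e c α * SignType.sign (collect D e c α) := by
    intro α
    rw [mul_comm, sign_mul_self]
  rw [l1norm, Finset.sum_congr rfl fun α _ => h α, collect_sum_mul c he]
  refine Finset.sum_le_sum fun i _ => ?_
  refine (le_abs_self _).trans ?_
  rw [abs_mul]
  refine mul_le_of_le_one_right (abs_nonneg _) ?_
  rcases SignType.sign (collect D e c (toMono (e i) (he i))) with _ | _ | _ <;> simp

end collect

lemma abs_monoFeature_le_one {n D : ℕ} {x : Fin n → ℝ} (hx : ∀ k, |x k| ≤ 1) (α : Mono n D) :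
    |monoFeature n D x α| ≤ 1 := by
  rw [monoFeature, Finset.abs_prod]
  refine Finset.prod_le_one (fun _ _ => abs_nonneg _) fun i _ => ?_
  rw [abs_pow]
  exact pow_le_one₀ (abs_nonneg _) (hx i)

lemma l1norm_nonneg {ι : Type*} [Fintype ι] (v : ι → ℝ) : 0 ≤ l1norm v :=
  Finset.sum_nonneg fun _ _ => abs_nonneg _

lemma abs_sum_mul_le_l1norm {ι : Type*} [Fintype ι] (u f : ι → ℝ) {B : ℝ} (hf : ∀ i, |f i| ≤ B) :
    |∑ i, u i * f i| ≤ l1norm u * B := by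
  refine (Finset.abs_sum_le_sum_abs _ _).trans ?_
  rw [l1norm, Finset.sum_mul]
  refine Finset.sum_le_sum fun i _ => ?_
  rw [abs_mul]
  exact mul_le_mul_of_nonneg_left (hf i) (abs_nonneg _)

lemma abs_predict_le {n D : ℕ} {x : Fin n → ℝ} (hx : ∀ k, |x k| ≤ 1) (u : Mono n D → ℝ) :
    |predict u x| ≤ l1norm u := by
  simpa [predict] using abs_sum_mul_le_l1norm u (monoFeature n D x) (abs_monoFeature_le_one hx)

/-- `f` is a polynomial of degree at most `D` with coefficients of `ℓ¹` norm at most `B`. -/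
def IsPolyWith {n : ℕ} (D : ℕ) (B : ℝ) (f : (Fin n → ℝ) → ℝ) : Prop :=
  ∃ u : Mono n D → ℝ, l1norm u ≤ B ∧ ∀ x, predict u x = f x

namespace IsPolyWith
variable {n D : ℕ} {B B' : ℝ} {f g : (Fin n → ℝ) → ℝ}

lemma of_terms {ι : Type*} [Fintype ι] {e : ι → Fin n → ℕ} {c : ι → ℝ}
    (he : ∀ i, ∑ j, e i j ≤ D) (hc : ∑ i, |c i| ≤ B)
    (hf : ∀ x, f x = ∑ i, c i * ∏ j, x j ^ e i j) : IsPolyWith D B f :=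
  ⟨collect D e c, (l1norm_collect_le c he).trans hc, fun x => by rw [predict_collect c he, hf]⟩

lemma mono {D' : ℕ} (h : IsPolyWith D B f) (hD : D ≤ D') (hB : B ≤ B') : IsPolyWith D' B' f := by
  obtain ⟨u, hu, hf⟩ := h
  exact of_terms (e := fun α : Mono n D => fun j => (α.1 j : ℕ)) (c := u)
    (fun α => α.2.trans hD) (hu.trans hB) fun x => (hf x).symm

lemma add (hf : IsPolyWith D B f) (hg : IsPolyWith D B' g) :
    IsPolyWith D (B + B') (fun x => f x + g x) := by
  obtain ⟨u, hu, hf⟩ := hf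
  obtain ⟨v, hv, hg⟩ := hg
  refine ⟨u + v, ?_, fun x => ?_⟩
  · refine le_trans ?_ (add_le_add hu hv)
    rw [l1norm, l1norm, l1norm, ← Finset.sum_add_distrib]
    exact Finset.sum_le_sum fun i _ => abs_add_le _ _
  · simp only [← hf, ← hg]
    simp [predict, add_mul, Finset.sum_add_distrib]

lemma const_mul (hf : IsPolyWith D B f) (c : ℝ) : IsPolyWith D (|c| * B) (fun x => c * f x) := by
  obtain ⟨u, hu, hf⟩ := hf
  refine ⟨fun α => c * u α, ?_, fun x => ?_⟩
  · refine le_trans (le_of_eq ?_) (mul_le_mul_of_nonneg_left hu (abs_nonneg c))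
    simp [l1norm, abs_mul, Finset.mul_sum]
  · simp only [← hf]
    simp [predict, mul_assoc, Finset.mul_sum]

lemma const (c : ℝ) : IsPolyWith D |c| (fun _ : Fin n → ℝ => c) :=
  of_terms (ι := Unit) (e := fun _ _ => 0) (c := fun _ => c) (by simp) (by simp) (by simp)

lemma sum {κ : Type*} (s : Finset κ) {b : κ → ℝ} {F : κ → (Fin n → ℝ) → ℝ}
    (h : ∀ k ∈ s, IsPolyWith D (b k) (F k)) :
    IsPolyWith D (∑ k ∈ s, b k) (fun x => ∑ k ∈ s, F k x) := by
  classical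
  induction s using Finset.induction_on with
  | empty => simpa using const (D := D) (n := n) 0
  | insert a s ha ih =>
    simp_rw [Finset.sum_insert ha]
    exact (h a (by simp)).add (ih fun k hk => h k (by simp [hk]))

/-- One term arises for each pair of a variable and a monomial. This is the multiplication step of
the Chebyshev recursion. -/
lemma linear_mul (hf : IsPolyWith D B f) (W : Fin n → ℝ) :
    IsPolyWith (D + 1) (l1norm W * B) (fun x => (∑ k, W k * x k) * f x) := by
  obtain ⟨u, hu, hf⟩ := hf
  refine of_terms (ι := Fin n × Mono n D) (e := fun p j => (p.2.1 j : ℕ) + if j = p.1 then 1 else 0)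
    (c := fun p => W p.1 * u p.2) (fun p => ?_) ?_ fun x => ?_
  · rw [Finset.sum_add_distrib]
    simpa using p.2.2
  · rw [Fintype.sum_prod_type]
    refine le_trans (le_of_eq ?_) (mul_le_mul_of_nonneg_left hu (l1norm_nonneg W))
    simp [l1norm, abs_mul, Finset.sum_mul_sum]
  · simp only [← hf]
    rw [predict, Fintype.sum_prod_type, Finset.sum_mul_sum]
    refine Finset.sum_congr rfl fun k _ => Finset.sum_congr rfl fun α _ => ?_
    simp only [pow_add, Finset.prod_mul_distrib, pow_ite, pow_one, pow_zero]
    simp [monoFeature]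
    ring

end IsPolyWith

/-! ### The activation on a complex strip -/

/-- The analytic continuation of the activation to the strip `|Im z| < π / 4`. -/
noncomputable def fActC (β : ℝ) (z : ℂ) : ℂ :=
  if β = 0 then Complex.tanh z else
    (Complex.log (1 + β * Complex.tanh z) - Complex.log (1 - β * Complex.tanh z)) / (2 * β)

/-- Since `cosh` and `sinh` commute with conjugation, the left side is `cosh (z̄ - z)`, and `z̄ - z
= -2 i Im z`. On the strip the right side is positive, which gives both `cosh z ≠ 0` and `|tanh z| <
1`. -/
lemma normSq_cosh_sub_normSq_sinh (z : ℂ) :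
    Complex.normSq (Complex.cosh z) - Complex.normSq (Complex.sinh z) = Real.cos (2 * z.im) := by
  apply Complex.ofReal_injective
  push_cast
  rw [Complex.normSq_eq_conj_mul_self, Complex.normSq_eq_conj_mul_self, ← Complex.cosh_conj,
    ← Complex.sinh_conj, ← Complex.cosh_sub]
  have : (starRingEnd ℂ) z - z = -(2 * z.im) * Complex.I := by
    apply Complex.ext <;> simp
    ring
  rw [this, Complex.cosh_mul_I, Complex.cos_neg]

section strip
variable {z : ℂ} (hz : |z.im| < Real.pi / 4)
include hz

lemma cos_two_mul_im_pos : 0 < Real.cos (2 * z.im) := by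
  rw [abs_lt] at hz
  exact Real.cos_pos_of_mem_Ioo ⟨by linarith, by linarith⟩

lemma cosh_ne_zero_of_strip : Complex.cosh z ≠ 0 := by
  intro h
  have h1 := normSq_cosh_sub_normSq_sinh z
  have h2 := cos_two_mul_im_pos hz
  rw [h, map_zero] at h1
  have := Complex.normSq_nonneg (Complex.sinh z)
  linarith

lemma norm_tanh_lt_one : ‖Complex.tanh z‖ < 1 := by
  have h0 := cosh_ne_zero_of_strip hz
  have h1 := normSq_cosh_sub_normSq_sinh z
  have h2 := cos_two_mul_im_pos hz
  rw [Complex.tanh_eq_sinh_div_cosh, norm_div, div_lt_one (norm_pos_iff.2 h0)]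
  rw [Complex.normSq_eq_norm_sq, Complex.normSq_eq_norm_sq] at h1
  exact lt_of_pow_lt_pow_left₀ 2 (norm_nonneg _) (by linarith)

lemma hasDerivAt_ctanh :
    HasDerivAt Complex.tanh (1 / Complex.cosh z ^ 2) z := by
  have h0 := cosh_ne_zero_of_strip hz
  have h := (Complex.hasDerivAt_sinh z).div (Complex.hasDerivAt_cosh z) h0
  have h3 : Complex.sinh / Complex.cosh = Complex.tanh := by
    funext w; simp [Complex.tanh_eq_sinh_div_cosh]
  rw [h3] at h
  refine h.congr_deriv ?_
  rw [← Complex.cosh_sq_sub_sinh_sq z]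
  ring

/-- The denominator equals `(1 - β²) cosh (2 z) / 2 + (1 + β²) / 2`, and `Re cosh (2 z) = cosh (2 Re
z) cos (2 Im z)` is nonnegative on the strip. -/
lemma half_le_re_denominator {β : ℝ} (hβ : β ^ 2 ≤ 1) :
    1 / 2 ≤ (Complex.cosh z ^ 2 - (β : ℂ) ^ 2 * Complex.sinh z ^ 2).re := by
  have h1 : Complex.cosh z ^ 2 - (β : ℂ) ^ 2 * Complex.sinh z ^ 2 =
      ((1 - β ^ 2 : ℝ) : ℂ) * (Complex.cosh (2 * z) / 2) + ((1 + β ^ 2) / 2 : ℝ) := by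
    have := Complex.cosh_sq_sub_sinh_sq z
    rw [Complex.cosh_two_mul]
    push_cast
    linear_combination (1 / 2 + (β : ℂ) ^ 2 / 2) * this
  have h2 : (Complex.cosh (2 * z)).re = Real.cosh (2 * z.re) * Real.cos (2 * z.im) := by
    conv_lhs => rw [← Complex.re_add_im z, mul_add, ← mul_assoc, Complex.cosh_add,
      Complex.cosh_mul_I, Complex.sinh_mul_I]
    have a1 : Complex.cosh (2 * (z.re : ℂ)) = (Real.cosh (2 * z.re) : ℝ) := by push_cast; rfl
    have a2 : Complex.cos (2 * (z.im : ℂ)) = (Real.cos (2 * z.im) : ℝ) := by push_cast; rfl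
    have a3 : Complex.sinh (2 * (z.re : ℂ)) = (Real.sinh (2 * z.re) : ℝ) := by push_cast; rfl
    have a4 : Complex.sin (2 * (z.im : ℂ)) = (Real.sin (2 * z.im) : ℝ) := by push_cast; rfl
    rw [a1, a2, a3, a4]
    simp only [Complex.add_re, Complex.re_ofReal_mul, Complex.ofReal_re, Complex.I_re, mul_zero,
      add_zero]
  have h3 : (Complex.cosh (2 * z) / 2).re = (Complex.cosh (2 * z)).re / 2 := by
    simp
  rw [h1, Complex.add_re, Complex.re_ofReal_mul, Complex.ofReal_re, h3, h2]
  have h4 : 0 ≤ Real.cosh (2 * z.re) * Real.cos (2 * z.im) :=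
    mul_nonneg (Real.cosh_pos _).le (cos_two_mul_im_pos hz).le
  nlinarith [mul_nonneg (sub_nonneg.2 hβ) h4, sq_nonneg β]

/-- As `|β tanh z| < 1`, both `1 ± β tanh z` lie in the disc of radius `1` around `1`, where the
logarithm is analytic. The two logarithmic derivatives combine over the product `(cosh z + β sinh z)
(cosh z - β sinh z)`. -/
lemma hasDerivAt_fActC {β : ℝ} (hβ0 : 0 ≤ β) (hβ : β ≤ 1) :
    HasDerivAt (fActC β) (1 / (Complex.cosh z ^ 2 - (β : ℂ) ^ 2 * Complex.sinh z ^ 2)) z := by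
  have h0 := cosh_ne_zero_of_strip hz
  have ht := hasDerivAt_ctanh hz
  have hn := norm_tanh_lt_one hz
  by_cases hb : β = 0
  · have : fActC β = Complex.tanh := by funext w; simp [fActC, hb]
    rw [this]
    simpa [hb] using ht
  have hbt : ‖(β : ℂ) * Complex.tanh z‖ < 1 := by
    rw [norm_mul, Complex.norm_real, Real.norm_of_nonneg hβ0]
    nlinarith [norm_nonneg (Complex.tanh z)]
  have hs1 : 1 + (β : ℂ) * Complex.tanh z ∈ Complex.slitPlane :=
    Complex.mem_slitPlane_of_norm_lt_one hbt
  have hs2 : 1 - (β : ℂ) * Complex.tanh z ∈ Complex.slitPlane := by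
    rw [sub_eq_add_neg]
    exact Complex.mem_slitPlane_of_norm_lt_one (by rwa [norm_neg])
  have hd1 := ((ht.const_mul (β : ℂ)).const_add 1).clog hs1
  have hd2 := ((ht.const_mul (β : ℂ)).const_sub 1).clog hs2
  have hd := (hd1.sub hd2).div_const (2 * (β : ℂ))
  have he : fActC β = fun z => (Complex.log (1 + β * Complex.tanh z) -
      Complex.log (1 - β * Complex.tanh z)) / (2 * β) := by
    funext w; simp [fActC, hb]
  rw [he]
  refine hd.congr_deriv ?_ |>.congr_of_eventuallyEq (Filter.EventuallyEq.rfl)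
  symm
  have hb' : (β : ℂ) ≠ 0 := by exact_mod_cast hb
  have hn1 := Complex.slitPlane_ne_zero hs1
  have hn2 := Complex.slitPlane_ne_zero hs2
  rw [Complex.tanh_eq_sinh_div_cosh] at hn1 hn2 ⊢
  have hn1' : Complex.cosh z + β * Complex.sinh z ≠ 0 := by
    intro h; apply hn1; field_simp; rw [h, mul_zero]
  have hn2' : Complex.cosh z - β * Complex.sinh z ≠ 0 := by
    intro h; apply hn2; field_simp; rw [h, mul_zero]
  have hn3 : Complex.cosh z ^ 2 - (β : ℂ) ^ 2 * Complex.sinh z ^ 2 ≠ 0 := by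
    have := mul_ne_zero hn1' hn2'
    intro h; apply this; linear_combination h
  have e1 : 1 + (β : ℂ) * (Complex.sinh z / Complex.cosh z) =
      (Complex.cosh z + β * Complex.sinh z) / Complex.cosh z := by field_simp
  have e2 : 1 - (β : ℂ) * (Complex.sinh z / Complex.cosh z) =
      (Complex.cosh z - β * Complex.sinh z) / Complex.cosh z := by field_simp
  rw [e1, e2]
  have e3 : Complex.cosh z ^ 2 - (β : ℂ) ^ 2 * Complex.sinh z ^ 2 =
      (Complex.cosh z + β * Complex.sinh z) * (Complex.cosh z - β * Complex.sinh z) := by ring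
  rw [e3]
  field_simp
  ring

lemma norm_deriv_fActC_le {β : ℝ} (hβ0 : 0 ≤ β) (hβ : β ≤ 1) : ‖deriv (fActC β) z‖ ≤ 2 := by
  rw [(hasDerivAt_fActC hz hβ0 hβ).deriv, norm_div, norm_one]
  have h := (half_le_re_denominator hz (β := β) (by nlinarith)).trans (Complex.re_le_norm _)
  rw [div_le_iff₀ (by linarith)]
  linarith

end strip

lemma convex_strip : Convex ℝ {z : ℂ | |z.im| < Real.pi / 4} := by
  have : {z : ℂ | |z.im| < Real.pi / 4} = Complex.imLm ⁻¹' (Set.Ioo (-(Real.pi / 4)) (Real.pi / 4)) := by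
    ext z; simp [abs_lt]
  rw [this]
  exact (convex_Ioo _ _).linear_preimage _

lemma norm_fActC_sub_le {β : ℝ} (hβ0 : 0 ≤ β) (hβ : β ≤ 1) {z w : ℂ}
    (hz : |z.im| < Real.pi / 4) (hw : |w.im| < Real.pi / 4) :
    ‖fActC β z - fActC β w‖ ≤ 2 * ‖z - w‖ :=
  convex_strip.norm_image_sub_le_of_norm_deriv_le (C := 2)
    (fun _ hx => (hasDerivAt_fActC hx hβ0 hβ).differentiableAt)
    (fun _ hx => norm_deriv_fActC_le hx hβ0 hβ) hw hz

lemma abs_mul_tanh_lt_one {β : ℝ} (hβ0 : 0 ≤ β) (hβ : β ≤ 1) (x : ℝ) :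
    |β * Real.tanh x| < 1 := by
  have h : |Real.tanh x| < 1 := abs_lt.2 ⟨Real.neg_one_lt_tanh x, Real.tanh_lt_one x⟩
  rw [abs_mul, abs_of_nonneg hβ0]
  nlinarith [abs_nonneg (Real.tanh x)]

lemma fActC_ofReal {β : ℝ} (hβ0 : 0 ≤ β) (hβ : β ≤ 1) (x : ℝ) :
    fActC β x = (fAct β x : ℝ) := by
  unfold fActC fAct
  split_ifs with h
  · simp
  have hb := abs_lt.1 (abs_mul_tanh_lt_one hβ0 hβ x)
  rw [Real.artanh_eq_half_log ⟨hb.1.le, hb.2.le⟩, Real.log_div (by linarith) (by linarith)]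
  push_cast
  rw [Complex.ofReal_log (by linarith), Complex.ofReal_log (by linarith)]
  push_cast
  field_simp

lemma abs_fAct_sub_le {β : ℝ} (hβ0 : 0 ≤ β) (hβ : β ≤ 1) (x y : ℝ) :
    |fAct β x - fAct β y| ≤ 2 * |x - y| := by
  have hp : (0 : ℝ) < Real.pi / 4 := by positivity
  have := norm_fActC_sub_le hβ0 hβ (z := x) (w := y) (by simpa using hp) (by simpa using hp)
  rw [fActC_ofReal hβ0 hβ, fActC_ofReal hβ0 hβ] at this
  norm_cast at this

lemma continuous_fAct {β : ℝ} (hβ0 : 0 ≤ β) (hβ : β ≤ 1) : Continuous (fAct β) :=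
  LipschitzWith.continuous (K := 2) <| LipschitzWith.of_dist_le_mul fun x y => by
    simpa [Real.dist_eq] using abs_fAct_sub_le hβ0 hβ x y

/-! ### Chebyshev expansions of functions that are analytic on an annulus -/

section cheb
open Complex

instance factTwoPiPos : Fact ((0 : ℝ) < 2 * Real.pi) := ⟨Real.two_pi_pos⟩

/-- `θ ↦ g (cos θ)` as a continuous function on the circle. -/
noncomputable def cosPullback (g : ℝ → ℝ) (hg : Continuous g) : C(AddCircle (2 * Real.pi), ℂ) where
  toFun t := (g ((AddCircle.toCircle t : ℂ).re) : ℂ)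
  continuous_toFun := Complex.continuous_ofReal.comp <| hg.comp <| Complex.continuous_re.comp <|
    continuous_subtype_val.comp AddCircle.continuous_toCircle

lemma cosPullback_coe (g : ℝ → ℝ) (hg : Continuous g) (θ : ℝ) :
    cosPullback g hg (θ : AddCircle (2 * Real.pi)) = (g (Real.cos θ) : ℂ) := by
  have h : 2 * Real.pi / (2 * Real.pi) * θ = θ := by
    field_simp
  simp only [cosPullback, ContinuousMap.coe_mk, AddCircle.toCircle_apply_mk, h, Circle.coe_exp,
    Complex.exp_ofReal_mul_I_re]

/-- Substituting `z = exp (i θ)` turns the Fourier integral into a contour integral, whose circle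
can be deformed inside the annulus of analyticity of `G`. The factor `(z - 0)⁻¹` is kept apart to
match Cauchy's theorem for annuli. -/
lemma fourierCoeff_cosPullback (g : ℝ → ℝ) (hg : Continuous g) (G : ℂ → ℂ)
    (hG : ∀ θ : ℝ, G (Complex.exp (θ * I)) = g (Real.cos θ)) (k : ℤ) :
    fourierCoeff (cosPullback g hg) k =
      (2 * Real.pi * I : ℂ)⁻¹ • ∮ z in C(0, 1), (z - 0)⁻¹ • (z ^ (-k) * G z) := by
  rw [fourierCoeff_eq_intervalIntegral _ k 0, circleIntegral]
  have h : ∀ θ : ℝ, deriv (circleMap 0 1) θ • ((circleMap 0 1 θ - 0)⁻¹ •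
      (circleMap 0 1 θ ^ (-k) * G (circleMap 0 1 θ))) =
      I * (fourier (-k) (θ : AddCircle (2 * Real.pi)) •
        cosPullback g hg (θ : AddCircle (2 * Real.pi))) := by
    intro θ
    have h1 : circleMap 0 1 θ = Complex.exp (θ * I) := by simp [circleMap]
    have h0 := Complex.exp_ne_zero (θ * I)
    rw [deriv_circleMap, h1, hG, cosPullback_coe, fourier_coe_apply, ← Complex.exp_int_mul]
    have h2 : 2 * (Real.pi : ℂ) * I * ((-k : ℤ) : ℂ) * θ / ((2 * Real.pi : ℝ) : ℂ) =
        ((-k : ℤ) : ℂ) * (θ * I) := by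
      have : (Real.pi : ℂ) ≠ 0 := by exact_mod_cast Real.pi_ne_zero
      push_cast
      field_simp
    rw [h2]
    simp only [smul_eq_mul, sub_zero]
    field_simp
  simp_rw [h]
  rw [intervalIntegral.integral_const_mul, zero_add, smul_eq_mul, Complex.real_smul]
  have hpi : (Real.pi : ℂ) ≠ 0 := by exact_mod_cast Real.pi_ne_zero
  push_cast
  field_simp

variable {g : ℝ → ℝ} {G : ℂ → ℂ} {ρ M : ℝ}

lemma norm_circleIntegral_zpow_le {r : ℝ} (hr0 : 0 < r)
    (hM : ∀ w : ℂ, ‖w‖ = r → ‖G w‖ ≤ M) (k : ℤ) :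
    ‖(2 * Real.pi * I : ℂ)⁻¹ • ∮ z in C(0, r), (z - 0)⁻¹ • (z ^ (-k) * G z)‖ ≤ M * r ^ (-k) := by
  refine (circleIntegral.norm_two_pi_i_inv_smul_integral_le_of_norm_le_const hr0.le
    (C := r⁻¹ * (r ^ (-k) * M)) ?_).trans (le_of_eq ?_)
  · intro z hz
    have hz' : ‖z‖ = r := by simpa using hz
    rw [norm_smul, norm_mul, norm_zpow, sub_zero, norm_inv, hz']
    have := hM z hz'
    gcongr
  · field_simp

/-- The contour moves to the circle of radius `ρ` for `k ≥ 0` and to that of radius `ρ⁻¹` for `k <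
0`. In both cases `z ^ (-k)` has modulus `ρ ^ (-|k|)` there. -/
lemma norm_fourierCoeff_cosPullback_le (hg : Continuous g) (hρ : 1 < ρ)
    (hd : ∀ w : ℂ, ρ⁻¹ ≤ ‖w‖ → ‖w‖ ≤ ρ → DifferentiableAt ℂ G w)
    (hM : ∀ w : ℂ, ρ⁻¹ ≤ ‖w‖ → ‖w‖ ≤ ρ → ‖G w‖ ≤ M)
    (hG : ∀ θ : ℝ, G (Complex.exp (θ * I)) = g (Real.cos θ)) (k : ℤ) :
    ‖fourierCoeff (cosPullback g hg) k‖ ≤ M * ρ⁻¹ ^ k.natAbs := by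
  have hρ0 : 0 < ρ := by linarith
  have hρ1 : ρ⁻¹ < 1 := inv_lt_one_of_one_lt₀ hρ
  have hρi : 0 < ρ⁻¹ := inv_pos.2 hρ0
  have key : ∀ a b : ℝ, 0 < a → a ≤ b → ρ⁻¹ ≤ a → b ≤ ρ →
      (∮ z in C(0, b), (z - 0)⁻¹ • (z ^ (-k) * G z)) =
        ∮ z in C(0, a), (z - 0)⁻¹ • (z ^ (-k) * G z) := by
    intro a b ha hab ha' hb'
    have hdz : ∀ z : ℂ, a ≤ ‖z‖ → ‖z‖ ≤ b → DifferentiableAt ℂ (fun z => z ^ (-k) * G z) z := by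
      intro z h1 h2
      have hz : z ≠ 0 := norm_pos_iff.1 (ha.trans_le h1)
      exact (differentiableAt_zpow.2 (Or.inl hz)).mul (hd z (ha'.trans h1) (h2.trans hb'))
    refine Complex.circleIntegral_sub_center_inv_smul_eq_of_differentiable_on_annulus_off_countable
      ha hab Set.countable_empty ?_ ?_
    · intro z hz
      simp only [Set.mem_sdiff, Metric.mem_closedBall, dist_zero_right, Metric.mem_ball,
        not_lt] at hz
      exact (hdz z hz.2 hz.1).continuousAt.continuousWithinAt
    · intro z hz
      simp only [Set.mem_sdiff, Metric.mem_closedBall, dist_zero_right, Metric.mem_ball,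
        not_le] at hz
      exact hdz z hz.1.2.le hz.1.1.le
  rw [fourierCoeff_cosPullback g hg G hG]
  rcases le_or_gt 0 k with hk | hk
  · rw [← key 1 ρ one_pos hρ.le hρ1.le le_rfl]
    refine (norm_circleIntegral_zpow_le hρ0 (fun w hw => hM w ?_ hw.le) k).trans (le_of_eq ?_)
    · rw [hw]; linarith
    · obtain ⟨j, rfl⟩ := Int.eq_ofNat_of_zero_le hk
      simp
  · rw [key ρ⁻¹ 1 hρi hρ1.le le_rfl hρ.le]
    refine (norm_circleIntegral_zpow_le hρi (fun w hw => hM w hw.ge ?_) k).trans (le_of_eq ?_)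
    · rw [hw]; linarith
    · obtain ⟨j, rfl⟩ : ∃ j : ℕ, k = -j := ⟨k.natAbs, by omega⟩
      simp

lemma hasSum_pow_natAbs {r : ℝ} (hr0 : 0 ≤ r) (hr : r < 1) :
    Summable fun k : ℤ => r ^ k.natAbs := by
  have h := summable_geometric_of_lt_one hr0 hr
  exact Summable.of_nat_of_neg (by simpa using h) (by simpa using h)

/-- The Chebyshev expansion of a function that extends to an annulus. -/
lemma exists_hasSum_cos (hg : Continuous g) (hρ : 1 < ρ)
    (hd : ∀ w : ℂ, ρ⁻¹ ≤ ‖w‖ → ‖w‖ ≤ ρ → DifferentiableAt ℂ G w)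
    (hM : ∀ w : ℂ, ρ⁻¹ ≤ ‖w‖ → ‖w‖ ≤ ρ → ‖G w‖ ≤ M)
    (hG : ∀ θ : ℝ, G (Complex.exp (θ * I)) = g (Real.cos θ)) :
    ∃ a : ℤ → ℝ, (∀ k, |a k| ≤ M * ρ⁻¹ ^ k.natAbs) ∧
      ∀ θ : ℝ, HasSum (fun k : ℤ => a k * Real.cos (k * θ)) (g (Real.cos θ)) := by
  have hb := norm_fourierCoeff_cosPullback_le hg hρ hd hM hG
  have hρ0 : 0 < ρ := by linarith
  refine ⟨fun k => (fourierCoeff (cosPullback g hg) k).re,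
    fun k => (Complex.abs_re_le_norm _).trans (hb k), fun θ => ?_⟩
  have hs : Summable (fourierCoeff (cosPullback g hg)) :=
    Summable.of_norm_bounded ((hasSum_pow_natAbs (inv_pos.2 hρ0).le
      (inv_lt_one_of_one_lt₀ hρ)).mul_left M) hb
  have h1 := has_pointwise_sum_fourier_series_of_summable hs (θ : AddCircle (2 * Real.pi))
  have h2 := has_pointwise_sum_fourier_series_of_summable hs ((-θ : ℝ) : AddCircle (2 * Real.pi))
  -- Averaging the series at `θ` and at `-θ` turns exponentials into cosines and leaves the even
  -- function `g (cos θ)` unchanged.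
  have h3 := Complex.hasSum_re ((h1.add h2).div_const 2)
  convert! h3 using 1
  · funext k
    rw [fourier_coe_apply, fourier_coe_apply]
    have hpi : (Real.pi : ℂ) ≠ 0 := by exact_mod_cast Real.pi_ne_zero
    have e1 : 2 * (Real.pi : ℂ) * I * (k : ℂ) * θ / ((2 * Real.pi : ℝ) : ℂ) = (k * θ : ℝ) * I := by
      push_cast
      field_simp
    have e2 : 2 * (Real.pi : ℂ) * I * (k : ℂ) * (-θ : ℝ) / ((2 * Real.pi : ℝ) : ℂ) =
        -((k * θ : ℝ) * I) := by
      push_cast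
      field_simp
    rw [e1, e2, smul_eq_mul, smul_eq_mul, ← mul_add, mul_div_assoc, ← neg_mul, ← Complex.cos,
      ← Complex.ofReal_cos, Complex.re_mul_ofReal]
  · rw [cosPullback_coe, cosPullback_coe, Real.cos_neg]
    simp

/-- The tail of the two-sided geometric series is exactly `2 r ^ (D + 1) / (1 - r)`. In this
additive form it follows by induction on `D`, moving the indices `±(D + 1)` from the tail to the
sum. -/
lemma tsum_pow_natAbs_compl_le {r : ℝ} (hr0 : 0 ≤ r) (hr : r < 1) (D : ℕ) :
    ∑ k ∈ Finset.Icc (-(D : ℤ)) D, r ^ k.natAbs + 2 * r ^ (D + 1) / (1 - r) =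
      ∑' k : ℤ, r ^ k.natAbs := by
  have h := (hasSum_geometric_of_lt_one hr0 hr)
  have hs : HasSum (fun k : ℤ => r ^ k.natAbs) ((1 - r)⁻¹ + (1 - r)⁻¹ - r ^ (0 : ℤ).natAbs) :=
    HasSum.of_nat_of_neg (f := fun k : ℤ => r ^ k.natAbs) (by simpa using h) (by simpa using h)
  rw [hs.tsum_eq]
  have h1 : 1 - r ≠ 0 := by linarith
  induction D with
  | zero => simp; field_simp; ring
  | succ D ih =>
    rw [← ih]
    have : Finset.Icc (-((D + 1 : ℕ) : ℤ)) ((D + 1 : ℕ) : ℤ) =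
        insert (-((D + 1 : ℕ) : ℤ)) (insert (((D + 1 : ℕ) : ℤ)) (Finset.Icc (-(D : ℤ)) D)) := by
      ext k
      simp only [Finset.mem_Icc, Finset.mem_insert]
      omega
    rw [this, Finset.sum_insert, Finset.sum_insert]
    · simp only [Int.natAbs_neg, Int.natAbs_natCast]
      field_simp
      ring
    · simp
    · simp only [Finset.mem_insert, Finset.mem_Icc]
      omega

end cheb

/-! ### Polynomial approximation of networks -/

/-- The recursion `T_{k+2} = 2 s T_{k+1} - T_k` bounds the norm by `2 · 3 ^ (k+1) + 3 ^ k = 7 · 3 ^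
k ≤ 3 ^ (k+2)`, because multiplication by the linear form `s` does not increase the norm. -/
lemma isPolyWith_chebyshev {n : ℕ} {V : Fin n → ℝ} (hV : l1norm V ≤ 1) (k : ℕ) :
    IsPolyWith k ((3 : ℝ) ^ k)
      (fun x => (Polynomial.Chebyshev.T ℝ (k : ℤ)).eval (∑ j, V j * x j)) := by
  induction k using Nat.twoStepInduction with
  | zero => simpa using IsPolyWith.const (n := n) (D := 0) 1
  | one =>
    have h := (IsPolyWith.const (n := n) (D := 0) 1).linear_mul V
    simp only [abs_one, mul_one, zero_add] at h
    simpa using h.mono le_rfl (hV.trans (by norm_num : (1 : ℝ) ≤ 3))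
  | more k ih0 ih1 =>
    have h1 := (ih1.linear_mul V).const_mul 2
    have h2 := (ih0.mono (Nat.le_add_right k 2) le_rfl).const_mul (-1)
    have h := h1.add h2
    convert! h.mono le_rfl (B' := (3 : ℝ) ^ (k + 2)) ?_ using 2
    · push_cast
      rw [Polynomial.Chebyshev.T_add_two]
      simp
      ring
    · have h3 : (0 : ℝ) < 3 ^ k := by positivity
      simp only [abs_neg, abs_one, one_mul, Nat.abs_ofNat, pow_succ]
      nlinarith [mul_le_mul_of_nonneg_right hV h3.le]

section annulus
variable {ρ : ℝ} {w : ℂ}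

/-- The Joukowski map sends the annulus into the ellipse with semi-axes `(ρ ± ρ⁻¹) / 2`. The minor
one is at most `ρ - 1`, since `ρ + ρ⁻¹ ≥ 2`. -/
lemma joukowski_bounds (hρ : 1 < ρ) (h1 : ρ⁻¹ ≤ ‖w‖) (h2 : ‖w‖ ≤ ρ) :
    ‖(w + w⁻¹) / 2‖ ≤ (ρ + ρ⁻¹) / 2 ∧ |((w + w⁻¹) / 2).im| ≤ ρ - 1 := by
  have hρ0 : 0 < ρ := by linarith
  have hi : ρ * ρ⁻¹ = 1 := mul_inv_cancel₀ hρ0.ne'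
  have hi0 : 0 < ρ⁻¹ := inv_pos.2 hρ0
  set t := ‖w‖ with ht
  have ht0 : 0 < t := hi0.trans_le h1
  have hti : t * t⁻¹ = 1 := mul_inv_cancel₀ ht0.ne'
  have h3 : t⁻¹ ≤ ρ := by
    rw [inv_le_comm₀ ht0 hρ0]; exact h1
  have h4 : ρ⁻¹ ≤ t⁻¹ := inv_anti₀ ht0 h2
  constructor
  · rw [norm_div, Complex.norm_ofNat]
    have h5 : ‖w + w⁻¹‖ ≤ t + t⁻¹ := (norm_add_le _ _).trans (by rw [norm_inv])
    have h6 : t + t⁻¹ ≤ ρ + ρ⁻¹ := by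
      have h7 : 0 ≤ (ρ - t) * (1 - ρ⁻¹ * t⁻¹) := by
        refine mul_nonneg (by linarith) ?_
        have : ρ⁻¹ * t⁻¹ ≤ ρ⁻¹ * ρ := by gcongr
        linarith
      nlinarith
    linarith
  · have h5 : ((w + w⁻¹) / 2).im = w.im * (1 - t⁻¹ ^ 2) / 2 := by
      have : ((w + w⁻¹) / 2).im = (w + w⁻¹).im / 2 := by simp
      rw [this, Complex.add_im, Complex.inv_im, Complex.normSq_eq_norm_sq, ← ht]
      field_simp
      ring
    have h6 : |w.im| ≤ t := Complex.abs_im_le_norm w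
    have h7 : |((w + w⁻¹) / 2).im| ≤ |t - t⁻¹| / 2 := by
      rw [h5, abs_div, abs_mul, abs_two]
      have : t - t⁻¹ = t * (1 - t⁻¹ ^ 2) := by
        field_simp
      rw [this, abs_mul, abs_of_pos ht0]
      gcongr
    have h8 : |t - t⁻¹| ≤ ρ - ρ⁻¹ := by
      rw [abs_le]; constructor <;> linarith
    have h9 : ρ - ρ⁻¹ ≤ 2 * (ρ - 1) := by nlinarith
    linarith

end annulus

lemma sum_three_pow_natAbs_le (D : ℕ) :
    ∑ k ∈ Finset.Icc (-(D : ℤ)) D, (3 : ℝ) ^ k.natAbs ≤ 3 ^ (D + 1) := by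
  have : ∑ k ∈ Finset.Icc (-(D : ℤ)) D, (3 : ℝ) ^ k.natAbs = 3 ^ (D + 1) - 2 := by
    induction D with
    | zero => simp; norm_num
    | succ D ih =>
      have : Finset.Icc (-((D + 1 : ℕ) : ℤ)) ((D + 1 : ℕ) : ℤ) =
          insert (-((D + 1 : ℕ) : ℤ)) (insert (((D + 1 : ℕ) : ℤ)) (Finset.Icc (-(D : ℤ)) D)) := by
        ext k
        simp only [Finset.mem_Icc, Finset.mem_insert]
        omega
      rw [this, Finset.sum_insert, Finset.sum_insert, ih]
      · simp only [Int.natAbs_neg, Int.natAbs_natCast]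
        ring
      · simp
      · simp only [Finset.mem_insert, Finset.mem_Icc]
        omega
  rw [this]
  linarith

lemma abs_linear_le {n : ℕ} {x : Fin n → ℝ} (hx : ∀ k, |x k| ≤ 1) (V : Fin n → ℝ) :
    |∑ k, V k * x k| ≤ l1norm V := by
  simpa using abs_sum_mul_le_l1norm V x hx

/-- A hidden unit is approximated by a polynomial with small coefficients. -/
lemma exists_poly_approx_unit {n D : ℕ} (hD : 1 ≤ D) {β : ℝ} (hβ0 : 0 ≤ β) (hβ : β ≤ 1) (b : ℝ)
    (W : Fin n → ℝ) :
    ∃ p : (Fin n → ℝ) → ℝ,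
      IsPolyWith D (max (Real.sqrt (D + 1) * (4 * Real.exp 1) ^ (D + 1) * (1 + l1norm W) ^ (D + 1))
        (2 * |fAct β b|)) p ∧
      ∀ x : Fin n → ℝ, (∀ k, |x k| ≤ 1) → |p x - fAct β (b + ∑ k, W k * x k)| ≤
        4 * ((l1norm W + 2 * l1norm W ^ 2) / (1 + 1 / (2 * l1norm W)) ^ D) := by
  -- For `W = 0` the unit is the constant `fAct β b` on the cube and is reproduced exactly. The
  -- error bound is then `0`, as its numerator vanishes.
  rcases (l1norm_nonneg W).eq_or_lt with h0 | hpos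
  · refine ⟨fun _ => fAct β b, (IsPolyWith.const _).mono le_rfl (le_max_of_le_right ?_), ?_⟩
    · linarith [abs_nonneg (fAct β b)]
    · intro x hx
      have h1 := abs_linear_le hx W
      rw [← h0] at h1
      have h2 : ∑ k, W k * x k = 0 := abs_eq_zero.1 (le_antisymm h1 (abs_nonneg _))
      simp [h2, ← h0]
  set L := l1norm W with hL
  -- This choice makes `L (ρ - 1) = 1 / 2 < π / 4`, so the scaled ellipse stays in the strip.
  set ρ := 1 + 1 / (2 * L) with hρdef
  have hρ : 1 < ρ := by
    have : 0 < 1 / (2 * L) := by positivity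
    linarith
  have hρ0 : 0 < ρ := by linarith
  have hLρ : L * (ρ - 1) = 1 / 2 := by
    rw [hρdef]; field_simp; ring
  have hri0 : 0 < ρ⁻¹ := inv_pos.2 hρ0
  have hri1 : ρ⁻¹ < 1 := inv_lt_one_of_one_lt₀ hρ
  have hpi : (1 : ℝ) / 2 < Real.pi / 4 := by linarith [Real.pi_gt_three]
  have hpi0 : (0 : ℝ) < Real.pi / 4 := by positivity
  -- Subtracting the value at `b` makes the bound on `G` a Lipschitz bound independent of `b`. The
  -- value itself enters only the constant term of the polynomial.
  set g : ℝ → ℝ := fun s => fAct β (b + L * s) - fAct β b with hg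
  set G : ℂ → ℂ := fun w => fActC β (b + L * ((w + w⁻¹) / 2)) - fActC β b with hGdef
  have hgc : Continuous g :=
    ((continuous_fAct hβ0 hβ).comp (by fun_prop)).sub continuous_const
  have him : ∀ w : ℂ, ρ⁻¹ ≤ ‖w‖ → ‖w‖ ≤ ρ →
      |((b : ℂ) + L * ((w + w⁻¹) / 2)).im| < Real.pi / 4 := by
    intro w h1 h2
    have := (joukowski_bounds hρ h1 h2).2
    rw [Complex.add_im, Complex.ofReal_im, zero_add, Complex.im_ofReal_mul, abs_mul,
      abs_of_pos hpos]
    calc L * |((w + w⁻¹) / 2).im| ≤ L * (ρ - 1) := by gcongr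
      _ < Real.pi / 4 := by rw [hLρ]; exact hpi
  have hd : ∀ w : ℂ, ρ⁻¹ ≤ ‖w‖ → ‖w‖ ≤ ρ → DifferentiableAt ℂ G w := by
    intro w h1 h2
    have hw : w ≠ 0 := norm_pos_iff.1 (hri0.trans_le h1)
    refine DifferentiableAt.sub_const (DifferentiableAt.fun_comp' w
      (hasDerivAt_fActC (him w h1 h2) hβ0 hβ).differentiableAt ?_) _
    exact (differentiableAt_const _).add ((((differentiableAt_id).add
      (differentiableAt_inv hw)).div_const 2).const_mul _)
  -- The Lipschitz bound is `L (ρ + ρ⁻¹) ≤ L (ρ + 1) = 2 L + 1 / 2`.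
  have hM : ∀ w : ℂ, ρ⁻¹ ≤ ‖w‖ → ‖w‖ ≤ ρ → ‖G w‖ ≤ 2 * L + 1 := by
    intro w h1 h2
    refine (norm_fActC_sub_le hβ0 hβ (him w h1 h2) (by simpa using hpi0)).trans ?_
    rw [add_sub_cancel_left, norm_mul, Complex.norm_real, Real.norm_of_nonneg hpos.le]
    have h3 := (joukowski_bounds hρ h1 h2).1
    have h4 : L * ‖(w + w⁻¹) / 2‖ ≤ L * ((ρ + ρ⁻¹) / 2) := by gcongr
    nlinarith
  have hG : ∀ θ : ℝ, G (Complex.exp (θ * Complex.I)) = g (Real.cos θ) := by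
    intro θ
    have h1 : (Complex.exp (θ * Complex.I) + (Complex.exp (θ * Complex.I))⁻¹) / 2 =
        (Real.cos θ : ℝ) := by
      rw [← Complex.exp_neg, ← neg_mul, ← Complex.cos, Complex.ofReal_cos]
    simp only [hGdef, hg, h1]
    rw [Complex.ofReal_sub, ← fActC_ofReal hβ0 hβ, ← fActC_ofReal hβ0 hβ]
    push_cast
    rfl
  obtain ⟨a, ha, hsum⟩ := exists_hasSum_cos hgc hρ hd hM hG
  set V : Fin n → ℝ := fun k => W k / L with hV
  have hV1 : l1norm V ≤ 1 := by
    have : l1norm V = L / L := by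
      simp only [l1norm, hV, abs_div, abs_of_pos hpos]
      rw [← Finset.sum_div]; rfl
    rw [this, div_self hpos.ne']
  set T := fun (k : ℤ) (x : Fin n → ℝ) => (Polynomial.Chebyshev.T ℝ k).eval (∑ j, V j * x j)
    with hT
  have hTk : ∀ k ∈ Finset.Icc (-(D : ℤ)) D,
      IsPolyWith D ((2 * L + 1) * 3 ^ k.natAbs) (fun x => a k * T k x) := by
    intro k hk
    rw [Finset.mem_Icc] at hk
    have h1 := (isPolyWith_chebyshev hV1 k.natAbs).mono (D' := D) (by omega) le_rfl
    rw [Polynomial.Chebyshev.T_natAbs] at h1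
    refine (h1.const_mul (a k)).mono le_rfl ?_
    have h2 : |a k| ≤ 2 * L + 1 := (ha k).trans (mul_le_of_le_one_right (by linarith)
      (pow_le_one₀ hri0.le hri1.le))
    gcongr
  refine ⟨fun x => fAct β b + ∑ k ∈ Finset.Icc (-(D : ℤ)) D, a k * T k x, ?_, ?_⟩
  · refine ((IsPolyWith.const _).add (IsPolyWith.sum _ hTk)).mono le_rfl ?_
    rw [← Finset.mul_sum]
    have h1 := mul_le_mul_of_nonneg_left (sum_three_pow_natAbs_le D)
      (by linarith : 0 ≤ 2 * L + 1)
    -- The factor `2` serves `A + B ≤ max (2 A) (2 B)`, with `B = |fAct β b|` the norm of the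
    -- constant term. Since `D ≥ 1`, one has `4 · 3 ^ (D+1) ≤ 6 ^ (D+1) ≤ (4 e) ^ (D+1)`.
    have h2 : 2 * ((2 * L + 1) * 3 ^ (D + 1)) ≤
        Real.sqrt (D + 1) * (4 * Real.exp 1) ^ (D + 1) * (1 + L) ^ (D + 1) := by
      have e1 : (1 : ℝ) ≤ Real.sqrt (D + 1) := by
        rw [Real.one_le_sqrt]
        linarith [(Nat.cast_nonneg D : (0 : ℝ) ≤ D)]
      have e2 : (4 : ℝ) * 3 ^ (D + 1) ≤ (4 * Real.exp 1) ^ (D + 1) := by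
        have h6 : (6 : ℝ) ≤ 4 * Real.exp 1 := by
          have := Real.add_one_le_exp (1 : ℝ)
          linarith
        calc (4 : ℝ) * 3 ^ (D + 1) = 2 ^ 2 * 3 ^ (D + 1) := by norm_num
          _ ≤ 2 ^ (D + 1) * 3 ^ (D + 1) := by
              gcongr
              · norm_num
              · omega
          _ = 6 ^ (D + 1) := by rw [← mul_pow]; norm_num
          _ ≤ _ := by gcongr
      have e3 : 1 + L ≤ (1 + L) ^ (D + 1) := le_self_pow₀ (by linarith) (by omega)
      have e4 : (0 : ℝ) < 3 ^ (D + 1) := by positivity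
      calc 2 * ((2 * L + 1) * 3 ^ (D + 1)) ≤ 1 * (4 * 3 ^ (D + 1)) * (1 + L) := by nlinarith
        _ ≤ _ := by gcongr
    rcases le_total (2 * ((2 * L + 1) * 3 ^ (D + 1))) (2 * |fAct β b|) with h3 | h3
    · exact le_max_of_le_right (by linarith)
    · exact le_max_of_le_left (by linarith)
  · intro x hx
    have hs := abs_linear_le hx V
    set s := ∑ k, V k * x k with hsdef
    have hs1 := abs_le.1 (hs.trans hV1)
    have hcos : Real.cos (Real.arccos s) = s := Real.cos_arccos hs1.1 hs1.2
    have hLs : ∑ k, W k * x k = L * s := by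
      rw [hsdef, Finset.mul_sum]
      refine Finset.sum_congr rfl fun k _ => ?_
      simp only [hV]
      field_simp
    have hsum' := hsum (Real.arccos s)
    have hTe : ∀ k : ℤ, Real.cos (k * Real.arccos s) = T k x := by
      intro k
      simp only [hT, ← hsdef]
      conv_rhs => rw [← hcos]
      rw [Polynomial.Chebyshev.T_real_cos]
    rw [hcos] at hsum'
    simp_rw [hTe] at hsum'
    have hsb := hasSum_pow_natAbs hri0.le hri1
    have hT1 : ∀ k, ‖a k * T k x‖ ≤ (2 * L + 1) * ρ⁻¹ ^ k.natAbs := by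
      intro k
      rw [Real.norm_eq_abs, abs_mul, ← hTe]
      exact (mul_le_of_le_one_right (abs_nonneg _) (Real.abs_cos_le_one _)).trans (ha k)
    have hsplit := hsum'.summable.sum_add_tsum_compl (s := Finset.Icc (-(D : ℤ)) D)
    rw [hsum'.tsum_eq] at hsplit
    have hsplit2 := hsb.sum_add_tsum_compl (s := Finset.Icc (-(D : ℤ)) D)
    rw [← tsum_pow_natAbs_compl_le hri0.le hri1 D, add_right_inj] at hsplit2
    have hbound := tsum_of_norm_bounded
      (f := fun k : ↑((↑(Finset.Icc (-(D : ℤ)) D) : Set ℤ)ᶜ) => a k * T k x)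
      ((hsb.mul_left (2 * L + 1)).subtype _).hasSum (fun k => hT1 k)
    have e1 : fAct β (b + ∑ k, W k * x k) = fAct β b + g s := by
      rw [hLs]; simp [hg]
    rw [e1, ← hsplit]
    have e2 : ∀ A B C : ℝ, |A + B - (A + (B + C))| = |C| := by
      intro A B C
      rw [← abs_neg]; congr 1; ring
    rw [e2]
    refine hbound.trans (le_of_eq ?_)
    -- Here `1 - ρ⁻¹ = (ρ - 1) / ρ = 1 / (2 L ρ)`, which also removes one power of `ρ⁻¹` from the
    -- tail.
    have e3 : (2 * L + 1) * (2 * ρ⁻¹ ^ (D + 1) / (1 - ρ⁻¹)) =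
        4 * ((L + 2 * L ^ 2) / ρ ^ D) := by
      have h1 : ρ - 1 ≠ 0 := by linarith
      have h2 : 1 - ρ⁻¹ = (ρ - 1) / ρ := by field_simp
      have h3 : ρ - 1 = 1 / (2 * L) := by rw [hρdef]; ring
      rw [h2, h3, inv_pow]
      field_simp
      ring
    rw [← e3, ← hsplit2]
    exact tsum_mul_left

/-- A network is approximated by a polynomial with coefficients of `ℓ¹` norm at most `l1Radius`. -/
lemma exists_predict_approx {n D h : ℕ} (hD : 1 ≤ D) (b₁ : ℝ) (w β b₂ : Fin h → ℝ)
    (W : Fin h → Fin n → ℝ) (hβ : ∀ j, 0 ≤ β j ∧ β j ≤ 1) :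
    ∃ u : Mono n D → ℝ, l1norm u ≤ l1Radius D b₁ w β b₂ W ∧
      ∀ x : Fin n → ℝ, (∀ k, |x k| ≤ 1) → |predict u x - netPre b₁ w β b₂ W x| ≤
        4 * ∑ j, |w j| *
          ((l1norm (W j) + 2 * l1norm (W j) ^ 2) / (1 + 1 / (2 * l1norm (W j))) ^ D) := by
  choose p hp hpe using fun j => exists_poly_approx_unit hD (hβ j).1 (hβ j).2 (b₂ j) (W j)
  obtain ⟨u, hu, huf⟩ := (IsPolyWith.const (n := n) (D := D) b₁).add
    (IsPolyWith.sum Finset.univ fun j _ => (hp j).const_mul (w j))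
  refine ⟨u, hu, fun x hx => ?_⟩
  rw [huf, netPre, add_sub_add_left_eq_sub, ← Finset.sum_sub_distrib, Finset.mul_sum]
  refine (Finset.abs_sum_le_sum_abs _ _).trans (Finset.sum_le_sum fun j _ => ?_)
  rw [← mul_sub, abs_mul, mul_left_comm]
  exact mul_le_mul_of_nonneg_left (hpe j x hx) (abs_nonneg _)

/-! ### The logistic loss -/

/-- The even part of the logistic loss. -/
noncomputable def logCosh (v : ℝ) : ℝ := Real.log (2 * Real.cosh v)

/-- From `1 + exp (-2 t) = 2 cosh t · exp (-t)`. The label enters only the linear term, so the even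
part can be treated without labels. -/
lemma logisticLoss_eq {y : ℝ} (hy : y = 1 ∨ y = -1) (v : ℝ) :
    logisticLoss v y = logCosh v - v * y := by
  have h : ∀ t : ℝ, Real.log (1 + Real.exp (-2 * t)) = Real.log (2 * Real.cosh t) - t := by
    intro t
    have : 1 + Real.exp (-2 * t) = 2 * Real.cosh t * Real.exp (-t) := by
      rw [Real.cosh_eq, mul_div_cancel₀ _ two_ne_zero, add_mul, ← Real.exp_add, ← Real.exp_add]
      simp
      ring
    have hc := Real.cosh_pos t
    rw [this, Real.log_mul (by positivity) (Real.exp_ne_zero _), Real.log_exp]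
    ring
  rcases hy with rfl | rfl
  · simpa [logisticLoss, logCosh] using h v
  · have := h (-v)
    simp only [Real.cosh_neg] at this
    rw [logisticLoss, logCosh, ← sub_neg_eq_add] at *
    convert this using 3 <;> ring_nf

lemma logCosh_le_add_abs_sub (v w : ℝ) : logCosh v ≤ logCosh w + |v - w| := by
  have hv := Real.cosh_pos v
  have hw := Real.cosh_pos w
  rw [logCosh, logCosh, ← Real.log_exp |v - w|, ← Real.log_mul (by positivity)
    (Real.exp_ne_zero _)]
  refine Real.log_le_log (by positivity) ?_
  rw [Real.cosh_eq, Real.cosh_eq, mul_div_cancel₀ _ two_ne_zero, mul_div_cancel₀ _ two_ne_zero,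
    add_mul, ← Real.exp_add, ← Real.exp_add]
  have h1 := le_abs_self (v - w)
  have h2 := neg_abs_le (v - w)
  gcongr <;> linarith

lemma abs_logCosh_sub_le (v w : ℝ) : |logCosh v - logCosh w| ≤ |v - w| := by
  rw [abs_le]
  have h1 := logCosh_le_add_abs_sub v w
  have h2 := logCosh_le_add_abs_sub w v
  rw [abs_sub_comm] at h2
  constructor <;> linarith

lemma abs_logisticLoss_sub_le {y : ℝ} (hy : y = 1 ∨ y = -1) (v w : ℝ) :
    |logisticLoss v y - logisticLoss w y| ≤ 2 * |v - w| := by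
  rw [logisticLoss_eq hy, logisticLoss_eq hy]
  have h1 := abs_logCosh_sub_le v w
  have h2 : |(v - w) * y| = |v - w| := by
    rcases hy with rfl | rfl <;> simp [abs_sub_comm]
  calc |logCosh v - v * y - (logCosh w - w * y)|
      = |(logCosh v - logCosh w) - (v - w) * y| := by congr 1; ring
    _ ≤ |logCosh v - logCosh w| + |(v - w) * y| := abs_sub _ _
    _ ≤ 2 * |v - w| := by rw [h2]; linarith

/-- With the weights `p, q = exp (±v) / (2 cosh v)`, Jensen's inequality for `exp` gives `cosh w /
cosh v = p exp (w - v) + q exp (v - w) ≥ exp ((p - q) (w - v))`. Since `p - q = tanh v`, taking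
logarithms yields the tangent line. -/
lemma logCosh_tangent (v w : ℝ) : logCosh v + Real.tanh v * (w - v) ≤ logCosh w := by
  have hv := Real.cosh_pos v
  have hw := Real.cosh_pos w
  set p := Real.exp v / (2 * Real.cosh v) with hp
  set q := Real.exp (-v) / (2 * Real.cosh v) with hq
  have hp0 : 0 ≤ p := by positivity
  have hq0 : 0 ≤ q := by positivity
  have hpq : p + q = 1 := by
    rw [hp, hq, Real.cosh_eq]; field_simp
  have ht : Real.tanh v = p - q := by
    rw [hp, hq, Real.tanh_eq_sinh_div_cosh, Real.sinh_eq]; field_simp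
  have hj := convexOn_exp.2 (Set.mem_univ (w - v)) (Set.mem_univ (-(w - v))) hp0 hq0 hpq
  simp only [smul_eq_mul] at hj
  have h1 : 2 * Real.cosh v * (p * Real.exp (w - v) + q * Real.exp (-(w - v))) =
      2 * Real.cosh w := by
    have e1 : Real.exp w = Real.exp v * Real.exp (w - v) := by rw [← Real.exp_add]; ring_nf
    have e2 : Real.exp (-w) = Real.exp (-v) * Real.exp (-(w - v)) := by
      rw [← Real.exp_add]; ring_nf
    rw [Real.cosh_eq w, e1, e2, hp, hq]
    field_simp
  have h2 : Real.exp (Real.tanh v * (w - v)) ≤ p * Real.exp (w - v) + q * Real.exp (-(w - v)) := by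
    have e : Real.tanh v * (w - v) = p * (w - v) + q * -(w - v) := by rw [ht]; ring
    rw [e]
    exact hj
  rw [logCosh, logCosh, ← h1, Real.log_mul (by positivity)
    (lt_of_lt_of_le (Real.exp_pos _) h2).ne']
  have := Real.log_le_log (Real.exp_pos _) h2
  rw [Real.log_exp] at this
  linarith

lemma logisticLoss_tangent {y : ℝ} (hy : y = 1 ∨ y = -1) (v w : ℝ) :
    logisticLoss v y - (y - Real.tanh v) * (w - v) ≤ logisticLoss w y := by
  rw [logisticLoss_eq hy, logisticLoss_eq hy]
  linarith [logCosh_tangent v w]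

lemma logisticLoss_nonneg (v y : ℝ) : 0 ≤ logisticLoss v y :=
  Real.log_nonneg (by linarith [Real.exp_pos (-2 * v * y)])

lemma continuous_logisticLoss : Continuous fun p : ℝ × ℝ => logisticLoss p.1 p.2 := by
  unfold logisticLoss
  refine Continuous.log (by fun_prop) fun p => ?_
  positivity

lemma measurable_logisticLoss {α : Type*} [MeasurableSpace α] {f g : α → ℝ} (hf : Measurable f)
    (hg : Measurable g) : Measurable fun a => logisticLoss (f a) (g a) :=
  continuous_logisticLoss.measurable.comp (hf.prodMk hg)

lemma logisticLoss_le_log_two_add {y : ℝ} (hy : y = 1 ∨ y = -1) (v : ℝ) :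
    logisticLoss v y ≤ Real.log 2 + 2 * |v| := by
  have h := abs_le.1 (abs_logisticLoss_sub_le hy v 0)
  have h0 : logisticLoss 0 y = Real.log 2 := by
    simp [logisticLoss]; norm_num
  rw [sub_zero] at h
  linarith

/-! ### The conditional mean minimizes the expected loss -/

section minimizer
variable {n : ℕ} {Ω : Type*} [MeasurableSpace Ω] {μ : Measure Ω} [IsProbabilityMeasure μ]
  {X : Ω → Fin n → ℝ} {Y : Ω → ℝ} {v : (Fin n → ℝ) → ℝ} {B : ℝ}

lemma integrable_logisticLoss (hX : Measurable X) (hY : Measurable Y)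
    (hY1 : ∀ᵐ ω ∂μ, Y ω = 1 ∨ Y ω = -1) (hv : Measurable v) (hB : ∀ᵐ ω ∂μ, |v (X ω)| ≤ B) :
    Integrable (fun ω => logisticLoss (v (X ω)) (Y ω)) μ := by
  refine Integrable.of_bound (measurable_logisticLoss (hv.comp hX) hY).aestronglyMeasurable
    (Real.log 2 + 2 * B) ?_
  filter_upwards [hY1, hB] with ω h1 h2
  rw [Real.norm_of_nonneg (logisticLoss_nonneg _ _)]
  linarith [logisticLoss_le_log_two_add h1 (v (X ω))]

/-- A bounded function of `X` can be pulled out of the conditional expectation, under which the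
residual vanishes. Boundedness supplies the integrability of the products. -/
lemma integral_residual_mul_eq_zero (hX : Measurable X) (hYi : Integrable Y μ)
    (hc : μ[Y | MeasurableSpace.comap X inferInstance] =ᵐ[μ] fun ω => Real.tanh (v (X ω)))
    {g : (Fin n → ℝ) → ℝ} (hg : Measurable g) {C : ℝ} (hC : ∀ᵐ ω ∂μ, |g (X ω)| ≤ C) :
    ∫ ω, (Y ω - Real.tanh (v (X ω))) * g (X ω) ∂μ = 0 := by
  have hm : MeasurableSpace.comap X inferInstance ≤ (inferInstance : MeasurableSpace Ω) :=
    hX.comap_le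
  have hgm : StronglyMeasurable[MeasurableSpace.comap X inferInstance] fun ω => g (X ω) :=
    (hg.comp (comap_measurable X)).stronglyMeasurable
  have hga : AEStronglyMeasurable (fun ω => g (X ω)) μ := (hg.comp hX).aestronglyMeasurable
  have hCn : ∀ᵐ ω ∂μ, ‖g (X ω)‖ ≤ C := hC
  have h1 : Integrable (fun ω => Y ω * g (X ω)) μ := hYi.mul_bdd hga hCn
  have h2 : Integrable (fun ω => Real.tanh (v (X ω)) * g (X ω)) μ := by
    refine Integrable.mul_bdd ?_ hga hCn
    exact integrable_condExp.congr hc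
  have h3 := condExp_mul_of_stronglyMeasurable_right (m := MeasurableSpace.comap X inferInstance)
    (μ := μ) hgm h1 hYi
  simp_rw [sub_mul]
  rw [integral_sub h1 h2, sub_eq_zero]
  rw [← integral_condExp hm]
  refine integral_congr_ae ?_
  filter_upwards [h3, hc] with ω e1 e2
  rw [show (fun ω => Y ω * g (X ω)) = Y * fun ω => g (X ω) from rfl, e1]
  simp [e2]

/-- An arbitrary `g` may have infinite expected loss, hence the integrals in `[0, ∞]`. On the events
`|g(X)| ≤ k`, which exhaust the space, everything is integrable. There the tangent inequality is
integrated and its linear term vanishes by `integral_residual_mul_eq_zero`. -/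
lemma lintegral_logisticLoss_le (hX : Measurable X) (hY : Measurable Y)
    (hY1 : ∀ᵐ ω ∂μ, Y ω = 1 ∨ Y ω = -1) (hv : Measurable v) (hB : ∀ᵐ ω ∂μ, |v (X ω)| ≤ B)
    (hc : μ[Y | MeasurableSpace.comap X inferInstance] =ᵐ[μ] fun ω => Real.tanh (v (X ω)))
    {g : (Fin n → ℝ) → ℝ} (hg : Measurable g) :
    ∫⁻ ω, ENNReal.ofReal (logisticLoss (v (X ω)) (Y ω)) ∂μ ≤
      ∫⁻ ω, ENNReal.ofReal (logisticLoss (g (X ω)) (Y ω)) ∂μ := by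
  have hYi : Integrable Y μ := by
    refine Integrable.of_bound hY.aestronglyMeasurable 1 ?_
    filter_upwards [hY1] with ω h1
    rcases h1 with h1 | h1 <;> simp [h1]
  set E : ℕ → Set (Fin n → ℝ) := fun k => {x | |g x| ≤ k} with hE
  have hEm : ∀ k, MeasurableSet (E k) := fun k => measurableSet_le hg.abs measurable_const
  have hU : ⋃ k, X ⁻¹' E k = Set.univ := by
    rw [Set.eq_univ_iff_forall]
    intro ω
    obtain ⟨k, hk⟩ := exists_nat_ge |g (X ω)|
    exact Set.mem_iUnion.2 ⟨k, hk⟩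
  have hmono : Monotone fun k => X ⁻¹' E k := by
    intro a b hab ω hω
    exact le_trans (b := (a : ℝ)) hω (by exact_mod_cast hab)
  rw [← setLIntegral_univ, ← hU, setLIntegral_iUnion_of_directed _ hmono.directed_le]
  refine iSup_le fun k => (?_ : _ ≤ ∫⁻ ω in X ⁻¹' E k, _ ∂μ).trans (setLIntegral_le_lintegral _ _)
  have hEk : MeasurableSet (X ⁻¹' E k) := hX (hEm k)
  have hi1 := (integrable_logisticLoss hX hY hY1 hv hB).integrableOn (s := X ⁻¹' E k)
  set g' : (Fin n → ℝ) → ℝ := (E k).indicator g with hg'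
  have hg'm : Measurable g' := hg.indicator (hEm k)
  have hg'b : ∀ x, |g' x| ≤ k := by
    intro x
    by_cases hx : x ∈ E k
    · rw [hg', Set.indicator_of_mem hx]
      exact hx
    · rw [hg', Set.indicator_of_notMem hx, abs_zero]
      positivity
  have hi2 : IntegrableOn (fun ω => logisticLoss (g (X ω)) (Y ω)) (X ⁻¹' E k) μ := by
    refine ((integrable_logisticLoss hX hY hY1 hg'm
      (Filter.Eventually.of_forall fun ω => hg'b (X ω))).integrableOn).congr_fun ?_ hEk
    intro ω hω
    simp [hg', Set.indicator_of_mem (show X ω ∈ E k from hω)]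
  rw [← ofReal_integral_eq_lintegral_ofReal hi1 (Filter.Eventually.of_forall fun _ =>
      logisticLoss_nonneg _ _),
    ← ofReal_integral_eq_lintegral_ofReal hi2 (Filter.Eventually.of_forall fun _ =>
      logisticLoss_nonneg _ _)]
  refine ENNReal.ofReal_le_ofReal ?_
  -- The displacement `g - v` cut off to the event is a bounded function of `X`, as orthogonality to
  -- the residual requires. The cut-off changes nothing in an integral over the event.
  set d : (Fin n → ℝ) → ℝ := (E k).indicator (fun x => g x - v x) with hd
  have hdm : Measurable d := (hg.sub hv).indicator (hEm k)
  have hdb : ∀ᵐ ω ∂μ, |d (X ω)| ≤ k + |B| := by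
    filter_upwards [hB] with ω h
    by_cases hx : X ω ∈ E k
    · rw [hd, Set.indicator_of_mem hx]
      have : |g (X ω)| ≤ k := hx
      have := abs_sub (g (X ω)) (v (X ω))
      linarith [le_abs_self B]
    · rw [hd, Set.indicator_of_notMem hx, abs_zero]
      positivity
  have hz := integral_residual_mul_eq_zero hX hYi hc hdm hdb
  have hri : Integrable (fun ω => (Y ω - Real.tanh (v (X ω))) * d (X ω)) μ := by
    refine Integrable.mul_bdd ?_ (hdm.comp hX).aestronglyMeasurable hdb
    exact hYi.sub (integrable_condExp.congr hc)
  have hz' : ∫ ω in X ⁻¹' E k, (Y ω - Real.tanh (v (X ω))) * d (X ω) ∂μ = 0 := by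
    rw [setIntegral_eq_integral_of_forall_compl_eq_zero, hz]
    intro ω hω
    rw [hd, Set.indicator_of_notMem (show X ω ∉ E k from hω), mul_zero]
  calc ∫ ω in X ⁻¹' E k, logisticLoss (v (X ω)) (Y ω) ∂μ
      = ∫ ω in X ⁻¹' E k, (logisticLoss (v (X ω)) (Y ω) -
          (Y ω - Real.tanh (v (X ω))) * d (X ω)) ∂μ := by
        rw [integral_sub hi1 hri.integrableOn, hz', sub_zero]
    _ ≤ _ := by
        refine integral_mono_ae (hi1.sub hri.integrableOn) hi2 ?_
        filter_upwards [ae_restrict_of_ae hY1, ae_restrict_mem hEk] with ω h1 h2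
        simp only [hd, Set.indicator_of_mem (show X ω ∈ E k from h2)]
        exact logisticLoss_tangent h1 _ _

end minimizer

/-! ### Maxima of finite families -/

/-- The maximum of a finite nonempty family of reals. -/
noncomputable def maxOver {κ : Type*} [Fintype κ] [Nonempty κ] (f : κ → ℝ) : ℝ :=
  Finset.univ.sup' Finset.univ_nonempty f

section maxOver
variable {κ : Type*} [Fintype κ] [Nonempty κ]

lemma le_maxOver (f : κ → ℝ) (k : κ) : f k ≤ maxOver f :=
  Finset.le_sup' f (Finset.mem_univ k)

lemma maxOver_le {f : κ → ℝ} {c : ℝ} (h : ∀ k, f k ≤ c) : maxOver f ≤ c :=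
  Finset.sup'_le _ _ fun k _ => h k

lemma exists_maxOver_eq (f : κ → ℝ) : ∃ k, maxOver f = f k := by
  obtain ⟨k, -, hk⟩ := Finset.exists_mem_eq_sup' Finset.univ_nonempty f
  exact ⟨k, hk⟩

lemma maxOver_mono {f g : κ → ℝ} (h : ∀ k, f k ≤ g k) : maxOver f ≤ maxOver g :=
  maxOver_le fun k => (h k).trans (le_maxOver g k)

lemma maxOver_add_le (f g : κ → ℝ) : maxOver (fun k => f k + g k) ≤ maxOver f + maxOver g :=
  maxOver_le fun k => add_le_add (le_maxOver f k) (le_maxOver g k)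

lemma abs_maxOver_le {f : κ → ℝ} {c : ℝ} (h : ∀ k, |f k| ≤ c) : |maxOver f| ≤ c := by
  obtain ⟨k, hk⟩ := exists_maxOver_eq f
  rw [hk]
  exact h k

lemma maxOver_sub_le {f g : κ → ℝ} {c : ℝ} (h : ∀ k, |f k - g k| ≤ c) :
    |maxOver f - maxOver g| ≤ c := by
  rw [abs_le]
  obtain ⟨k, hk⟩ := exists_maxOver_eq f
  obtain ⟨l, hl⟩ := exists_maxOver_eq g
  have h1 := abs_le.1 (h k)
  have h2 := abs_le.1 (h l)
  have h3 := le_maxOver f l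
  have h4 := le_maxOver g k
  constructor <;> linarith

lemma measurable_maxOver {α : Type*} [MeasurableSpace α] {f : α → κ → ℝ}
    (h : ∀ k, Measurable fun a => f a k) : Measurable fun a => maxOver (f a) := by
  unfold maxOver
  have := Finset.measurable_sup' (Finset.univ_nonempty (α := κ)) (f := fun k a => f a k)
    fun k _ => h k
  convert! this using 2
  rw [Finset.sup'_apply]

end maxOver

/-! ### Integration over product measures -/

section pi
variable {Z : Type*} [MeasurableSpace Z] (ν : Measure Z) [IsProbabilityMeasure ν]

/-- The law of `m` independent samples. -/
noncomputable abbrev samples (m : ℕ) : Measure (Fin m → Z) := Measure.pi fun _ => ν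

lemma measurable_fin_cons {m : ℕ} :
    Measurable fun p : Z × (Fin m → Z) => (Fin.cons p.1 p.2 : Fin (m + 1) → Z) := by
  rw [measurable_pi_iff]
  intro i
  refine Fin.cases ?_ (fun j => ?_) i
  · simpa using measurable_fst
  · simp only [Fin.cons_succ]
    exact (measurable_pi_apply j).comp measurable_snd

lemma integral_samples_succ {m : ℕ} (f : (Fin (m + 1) → Z) → ℝ) :
    ∫ z, f z ∂samples ν (m + 1) = ∫ p, f (Fin.cons p.1 p.2) ∂(ν.prod (samples ν m)) := by
  have h := (measurePreserving_piFinSuccAbove (fun _ : Fin (m + 1) => ν) 0).symm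
  rw [← h.integral_comp']
  refine integral_congr_ae (Filter.Eventually.of_forall fun p => ?_)
  simp [MeasurableEquiv.piFinSuccAbove, Fin.consEquiv]

variable {ν}

lemma integrable_of_abs_le {α : Type*} [MeasurableSpace α] {μ : Measure α} [IsFiniteMeasure μ]
    {f : α → ℝ} (hf : Measurable f) {C : ℝ} (hC : ∀ a, |f a| ≤ C) : Integrable f μ :=
  Integrable.of_bound hf.aestronglyMeasurable C (Filter.Eventually.of_forall hC)

lemma abs_integral_le_of_abs_le {α : Type*} [MeasurableSpace α] {μ : Measure α}
    [IsProbabilityMeasure μ] {f : α → ℝ} {C : ℝ} (hC : ∀ a, |f a| ≤ C) : |∫ a, f a ∂μ| ≤ C := by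
  have := norm_integral_le_of_norm_le_const (μ := μ) (f := f) (Filter.Eventually.of_forall hC)
  simpa using this

/-- Hoeffding's lemma, in terms of the oscillation of `f`: the values lie in the interval of length
`c` that starts at the infimum. -/
lemma integral_exp_sub_integral_le {f : Z → ℝ} (hf : Measurable f) {c : ℝ}
    (hc : ∀ a b, f a - f b ≤ c) (t : ℝ) :
    ∫ z, Real.exp (t * (f z - ∫ w, f w ∂ν)) ∂ν ≤ Real.exp (c ^ 2 * t ^ 2 / 8) := by
  obtain ⟨z0⟩ := ν.nonempty_of_neZero
  have hbdd : BddBelow (Set.range f) := ⟨f z0 - c, by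
    rintro _ ⟨a, rfl⟩
    linarith [hc z0 a]⟩
  have : Nonempty Z := ⟨z0⟩
  have h := hasSubgaussianMGF_of_mem_Icc (μ := ν) (X := f) (a := ⨅ z, f z) (b := (⨅ z, f z) + c)
    hf.aemeasurable (Filter.Eventually.of_forall fun z => ⟨ciInf_le hbdd z, by
      have : f z - c ≤ ⨅ z, f z := le_ciInf fun a => by linarith [hc z a]
      linarith⟩)
  refine (h.mgf_le t).trans (le_of_eq ?_)
  congr 1
  simp only [add_sub_cancel_left, NNReal.coe_pow, NNReal.coe_div, coe_nnnorm, Real.norm_eq_abs,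
    NNReal.coe_ofNat, div_pow, sq_abs]
  ring

/-- **McDiarmid's inequality**, in the form of a bound on the moment generating function. -/
lemma integral_exp_bounded_differences_le {m : ℕ} {f : (Fin m → Z) → ℝ} (hf : Measurable f)
    {C : ℝ} (hC : ∀ z, |f z| ≤ C) {c : ℝ}
    (hc : ∀ z i a, |f (Function.update z i a) - f z| ≤ c) (t : ℝ) :
    ∫ z, Real.exp (t * (f z - ∫ w, f w ∂samples ν m)) ∂samples ν m ≤
      Real.exp (m * c ^ 2 * t ^ 2 / 8) := by
  induction m generalizing C with
  | zero =>
    have h0 : ∀ z, f z = f default := fun z => congrArg f (Subsingleton.elim _ _)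
    have h1 : ∫ w, f w ∂samples ν 0 = f default := by
      rw [integral_congr_ae (Filter.Eventually.of_forall h0)]
      simp
    rw [h1]
    simp only [h0, sub_self, mul_zero, Real.exp_zero]
    simp
  | succ m ih =>
    -- Averaging over the first sample gives a function `g` of the others with the same bounded
    -- differences, to which the induction hypothesis applies. For fixed other samples, `f - g` is
    -- centred with oscillation at most `c`, so Hoeffding's lemma bounds the inner integral.
    set g : (Fin m → Z) → ℝ := fun z => ∫ a, f (Fin.cons a z) ∂ν with hg
    have hfc : Measurable fun p : Z × (Fin m → Z) => f (Fin.cons p.1 p.2) :=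
      hf.comp measurable_fin_cons
    have hfz : ∀ z : Fin m → Z, Measurable fun a => f (Fin.cons a z) := fun z =>
      hfc.comp (measurable_id.prodMk measurable_const)
    have hfi : ∀ z : Fin m → Z, Integrable (fun a => f (Fin.cons a z)) ν := fun z =>
      integrable_of_abs_le (hfz z) fun a => hC _
    have hgm : Measurable g := by
      have h : StronglyMeasurable fun p : (Fin m → Z) × Z => f (Fin.cons p.2 p.1) :=
        (hfc.comp measurable_swap).stronglyMeasurable
      exact h.integral_prod_right.measurable
    have hgC : ∀ z, |g z| ≤ C := fun z => abs_integral_le_of_abs_le fun a => hC _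
    have hgc : ∀ z i a, |g (Function.update z i a) - g z| ≤ c := by
      intro z i a
      rw [hg]
      simp only
      rw [← integral_sub (hfi _) (hfi _)]
      refine abs_integral_le_of_abs_le fun b => ?_
      rw [Fin.cons_update]
      exact hc _ _ _
    have hint : ∫ w, f w ∂samples ν (m + 1) = ∫ w, g w ∂samples ν m := by
      rw [integral_samples_succ, integral_prod_symm _ (integrable_of_abs_le hfc fun p => hC _)]
    have ih' := ih hgm hgC hgc
    set J := ∫ w, g w ∂samples ν m with hJ
    have hexp_bdd : ∀ x : ℝ, |x| ≤ C → Real.exp (t * (x - J)) ≤ Real.exp (|t| * (C + |J|)) := by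
      intro x hx
      refine Real.exp_le_exp.2 ((le_abs_self _).trans ?_)
      rw [abs_mul]
      have := abs_sub x J
      gcongr
      linarith
    have hem : Measurable fun p : Z × (Fin m → Z) => Real.exp (t * (f (Fin.cons p.1 p.2) - J)) :=
      ((hfc.sub_const _).const_mul _).exp
    have hei : Integrable (fun p : Z × (Fin m → Z) => Real.exp (t * (f (Fin.cons p.1 p.2) - J)))
        (ν.prod (samples ν m)) :=
      integrable_of_abs_le hem fun p => by
        rw [abs_of_pos (Real.exp_pos _)]
        exact hexp_bdd _ (hC _)
    rw [hint, integral_samples_succ, integral_prod_symm _ hei]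
    have hinner : ∀ z : Fin m → Z, ∫ a, Real.exp (t * (f (Fin.cons a z) - J)) ∂ν ≤
        Real.exp (c ^ 2 * t ^ 2 / 8) * Real.exp (t * (g z - J)) := by
      intro z
      have h1 : ∀ a, Real.exp (t * (f (Fin.cons a z) - J)) =
          Real.exp (t * (f (Fin.cons a z) - g z)) * Real.exp (t * (g z - J)) := by
        intro a
        rw [← Real.exp_add]
        ring_nf
      simp_rw [h1]
      rw [integral_mul_const]
      refine mul_le_mul_of_nonneg_right ?_ (Real.exp_pos _).le
      refine integral_exp_sub_integral_le (hfz z) (fun a b => ?_) t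
      have h2 := hc (Fin.cons b z) 0 a
      rw [Fin.update_cons_zero] at h2
      exact (le_abs_self _).trans h2
    have hgi : Integrable (fun z => Real.exp (t * (g z - J))) (samples ν m) :=
      integrable_of_abs_le ((hgm.sub_const _).const_mul _).exp fun z => by
        rw [abs_of_pos (Real.exp_pos _)]
        exact hexp_bdd _ (hgC _)
    calc ∫ z, ∫ a, Real.exp (t * (f (Fin.cons a z) - J)) ∂ν ∂samples ν m
        ≤ ∫ z, Real.exp (c ^ 2 * t ^ 2 / 8) * Real.exp (t * (g z - J)) ∂samples ν m :=
          integral_mono hei.integral_prod_right (hgi.const_mul _) hinner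
      _ = Real.exp (c ^ 2 * t ^ 2 / 8) * ∫ z, Real.exp (t * (g z - J)) ∂samples ν m :=
          integral_const_mul _ _
      _ ≤ Real.exp (c ^ 2 * t ^ 2 / 8) * Real.exp (m * c ^ 2 * t ^ 2 / 8) := by
          gcongr
      _ = _ := by
          rw [← Real.exp_add]
          push_cast
          ring_nf

/-- **McDiarmid's inequality**. -/
lemma measure_bounded_differences_le {m : ℕ} (hm : 0 < m) {f : (Fin m → Z) → ℝ}
    (hf : Measurable f) {C : ℝ} (hC : ∀ z, |f z| ≤ C) {c : ℝ} (hc0 : 0 < c)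
    (hc : ∀ z i a, |f (Function.update z i a) - f z| ≤ c) {s : ℝ} (hs : 0 ≤ s) :
    (samples ν m) {z | s ≤ f z - ∫ w, f w ∂samples ν m} ≤
      ENNReal.ofReal (Real.exp (-(2 * s ^ 2 / (m * c ^ 2)))) := by
  have hsub : HasSubgaussianMGF (fun z => f z - ∫ w, f w ∂samples ν m)
      (m * c ^ 2 / 4).toNNReal (samples ν m) := by
    refine ⟨fun t => ?_, fun t => ?_⟩
    · refine integrable_of_abs_le (((hf.sub_const _).const_mul t).exp)
        (C := Real.exp (|t| * (C + C))) fun z => ?_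
      rw [abs_of_pos (Real.exp_pos _)]
      refine Real.exp_le_exp.2 ((le_abs_self _).trans ?_)
      rw [abs_mul]
      have h1 := abs_sub (f z) (∫ w, f w ∂samples ν m)
      have h2 : |∫ w, f w ∂samples ν m| ≤ C := abs_integral_le_of_abs_le hC
      have h3 := hC z
      gcongr
      linarith
    · refine (integral_exp_bounded_differences_le hf hC hc t).trans (le_of_eq ?_)
      congr 1
      rw [Real.coe_toNNReal _ (by positivity)]
      ring
  have h := hsub.measure_ge_le hs
  rw [← ofReal_measureReal]
  refine ENNReal.ofReal_le_ofReal (h.trans (le_of_eq ?_))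
  congr 1
  rw [Real.coe_toNNReal _ (by positivity)]
  have : (m : ℝ) ≠ 0 := by positivity
  field_simp
  ring

end pi

/-! ### Maximal inequalities -/

section maximal
variable {Ω : Type*} [MeasurableSpace Ω] {P : Measure Ω} [IsProbabilityMeasure P]
  {ι : Type*} [Fintype ι] [Nonempty ι] {U : Ω → ι → ℝ} {C s : ℝ}

/-- For `a = log (2 N) + s t² / 2`, the maximum `M` satisfies `t M - a + 1 ≤ exp (t M - a)`. The
right side is at most `exp (-a)` times the sum of all `exp (±t U_α)`, whose mean is at most `exp a`.
Hence `t E M ≤ a`, and `t = √(2 log (2 N) / s)` is optimal. -/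
lemma integral_maxOver_abs_le_log (hU : ∀ α, Measurable fun ω => U ω α)
    (hC : ∀ ω α, |U ω α| ≤ C) (hs : 0 < s)
    (hmgf : ∀ α t, ∫ ω, Real.exp (t * U ω α) ∂P ≤ Real.exp (s * t ^ 2 / 2)) :
    ∫ ω, maxOver (fun α => |U ω α|) ∂P ≤
      Real.sqrt s * Real.sqrt (2 * Real.log (2 * Fintype.card ι)) := by
  set N := (Fintype.card ι : ℝ) with hN
  have hN1 : (1 : ℝ) ≤ N := by
    rw [hN]; exact_mod_cast Fintype.card_pos
  set l := Real.log (2 * N) with hl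
  have hl0 : 0 < l := Real.log_pos (by linarith)
  set M : Ω → ℝ := fun ω => maxOver (fun α => |U ω α|) with hM
  have hMm : Measurable M := measurable_maxOver fun α => (hU α).abs
  have hMC : ∀ ω, |M ω| ≤ C := fun ω => abs_maxOver_le fun α => by rw [abs_abs]; exact hC ω α
  have hMi : Integrable M P := integrable_of_abs_le hMm hMC
  have hexpi : ∀ t α, Integrable (fun ω => Real.exp (t * U ω α)) P := fun t α =>
    integrable_of_abs_le ((hU α).const_mul t).exp (C := Real.exp (|t| * C)) fun ω => by
      rw [abs_of_pos (Real.exp_pos _)]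
      refine Real.exp_le_exp.2 ((le_abs_self _).trans ?_)
      rw [abs_mul]
      exact mul_le_mul_of_nonneg_left (hC ω α) (abs_nonneg _)
  have key : ∀ t, 0 < t → t * ∫ ω, M ω ∂P ≤ l + s * t ^ 2 / 2 := by
    intro t ht
    set a := l + s * t ^ 2 / 2 with ha
    have hi2 : ∀ α, Integrable (fun ω => Real.exp (t * U ω α) + Real.exp (-t * U ω α)) P :=
      fun α => (hexpi t α).add (hexpi (-t) α)
    have h1 : ∀ ω, t * M ω - a + 1 ≤
        Real.exp (-a) * ∑ α, (Real.exp (t * U ω α) + Real.exp (-t * U ω α)) := by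
      intro ω
      refine (Real.add_one_le_exp (t * M ω - a)).trans ?_
      rw [sub_eq_add_neg, Real.exp_add, mul_comm]
      refine mul_le_mul_of_nonneg_left ?_ (Real.exp_pos _).le
      obtain ⟨α, hα⟩ := exists_maxOver_eq (fun α => |U ω α|)
      simp only [hM, hα]
      refine le_trans ?_ (Finset.single_le_sum (f := fun α => Real.exp (t * U ω α) +
        Real.exp (-t * U ω α)) (fun _ _ => by positivity) (Finset.mem_univ α))
      rcases abs_cases (U ω α) with ⟨h, -⟩ | ⟨h, -⟩ <;> rw [h]
      · linarith [Real.exp_pos (-t * U ω α)]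
      · rw [mul_neg, ← neg_mul]
        linarith [Real.exp_pos (t * U ω α)]
    have h2 : ∫ ω, (t * M ω - a + 1) ∂P ≤ ∫ ω, Real.exp (-a) *
        ∑ α, (Real.exp (t * U ω α) + Real.exp (-t * U ω α)) ∂P := by
      refine integral_mono (((hMi.const_mul t).sub (integrable_const a)).add
        (integrable_const 1)) ?_ h1
      exact (integrable_finsetSum _ fun α _ => hi2 α).const_mul _
    rw [integral_const_mul, integral_finsetSum _ fun α _ => hi2 α] at h2
    have h3 : ∑ α, ∫ ω, (Real.exp (t * U ω α) + Real.exp (-t * U ω α)) ∂P ≤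
        Real.exp a := by
      have : ∀ α ∈ Finset.univ, ∫ ω, (Real.exp (t * U ω α) + Real.exp (-t * U ω α)) ∂P ≤
          2 * Real.exp (s * t ^ 2 / 2) := by
        intro α _
        rw [integral_add (hexpi t α) (hexpi (-t) α)]
        have e1 := hmgf α t
        have e2 := hmgf α (-t)
        rw [neg_sq] at e2
        linarith
      refine (Finset.sum_le_sum this).trans (le_of_eq ?_)
      rw [Finset.sum_const, Finset.card_univ, nsmul_eq_mul, ha, Real.exp_add, hl,
        Real.exp_log (by positivity)]
      ring
    have h4 : ∫ ω, (t * M ω - a + 1) ∂P = t * ∫ ω, M ω ∂P - a + 1 := by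
      have hi3 : Integrable (fun ω => t * M ω - a) P := (hMi.const_mul t).sub (integrable_const a)
      rw [integral_add hi3 (integrable_const 1),
        integral_sub (hMi.const_mul t) (integrable_const a), integral_const_mul]
      simp
    rw [h4] at h2
    have h5 := mul_le_mul_of_nonneg_left h3 (Real.exp_pos (-a)).le
    rw [← Real.exp_add, neg_add_cancel, Real.exp_zero] at h5
    linarith
  have h := key (Real.sqrt (2 * l / s)) (by positivity)
  set q := Real.sqrt (2 * l / s) with hq
  have hq0 : 0 < q := by positivity
  have hq2 : q ^ 2 = 2 * l / s := Real.sq_sqrt (by positivity)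
  have h6 : Real.sqrt s * Real.sqrt (2 * l) = s * q := by
    rw [hq, Real.sqrt_div (by positivity)]
    have := Real.mul_self_sqrt hs.le
    have h0 : Real.sqrt s ≠ 0 := by positivity
    field_simp
    nlinarith
  rw [h6]
  have h7 : l + s * q ^ 2 / 2 = q * (s * q) := by
    have : q * (s * q) = s * q ^ 2 := by ring
    rw [this, hq2]
    field_simp
    ring
  rw [h7] at h
  exact le_of_mul_le_mul_left h hq0

/-- From `2 + x² ≤ exp x + exp (-x)` at `x = t f`. The value `t² = 1 / (8 s)` gives `t² E f² ≤ 2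
(exp (1/16) - 1) ≤ 17 / 128`; a small fixed `t` avoids the limit `t → 0`, at the price of the factor
`17 / 16`. -/
lemma integral_sq_le_of_mgf {f : Ω → ℝ} (hf : Measurable f) (hC : ∀ ω, |f ω| ≤ C) (hs : 0 < s)
    (hmgf : ∀ t, ∫ ω, Real.exp (t * f ω) ∂P ≤ Real.exp (s * t ^ 2 / 2)) :
    ∫ ω, f ω ^ 2 ∂P ≤ 17 / 16 * s := by
  set t := Real.sqrt (1 / (8 * s)) with ht
  have ht2 : t ^ 2 = 1 / (8 * s) := Real.sq_sqrt (by positivity)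
  have hexpi : ∀ t, Integrable (fun ω => Real.exp (t * f ω)) P := fun t =>
    integrable_of_abs_le (hf.const_mul t).exp (C := Real.exp (|t| * C)) fun ω => by
      rw [abs_of_pos (Real.exp_pos _)]
      refine Real.exp_le_exp.2 ((le_abs_self _).trans ?_)
      rw [abs_mul]
      exact mul_le_mul_of_nonneg_left (hC ω) (abs_nonneg _)
  have hcosh : ∀ x : ℝ, 2 + x ^ 2 ≤ Real.exp x + Real.exp (-x) := by
    intro x
    have h1 : |x / 2| ≤ |Real.sinh (x / 2)| := by
      rw [Real.abs_sinh]
      exact Real.self_le_sinh_iff.2 (abs_nonneg _)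
    have h2 := sq_le_sq.2 h1
    have h3 : Real.exp x + Real.exp (-x) = 2 * Real.cosh (2 * (x / 2)) := by
      rw [Real.cosh_eq]; ring_nf
    rw [h3, Real.cosh_two_mul]
    nlinarith [Real.cosh_sq (x / 2)]
  have h1 : ∀ ω, 2 + t ^ 2 * f ω ^ 2 ≤ Real.exp (t * f ω) + Real.exp (-t * f ω) := by
    intro ω
    have := hcosh (t * f ω)
    rw [mul_pow, ← neg_mul] at this
    exact this
  have hf2 : Integrable (fun ω => f ω ^ 2) P :=
    integrable_of_abs_le (hf.pow_const 2) (C := C ^ 2) fun ω => by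
      rw [abs_pow]
      exact pow_le_pow_left₀ (abs_nonneg _) (hC ω) 2
  have h2 := integral_mono ((integrable_const (2 : ℝ)).add (hf2.const_mul (t ^ 2)))
    ((hexpi t).add (hexpi (-t))) h1
  simp only [Pi.add_apply] at h2
  rw [integral_add (integrable_const _) (hf2.const_mul _), integral_add (hexpi t) (hexpi (-t)),
    integral_const_mul] at h2
  have h3 := hmgf t
  have h4 := hmgf (-t)
  rw [neg_sq] at h4
  have h5 : s * t ^ 2 / 2 = 1 / 16 := by
    rw [ht2]; field_simp; norm_num
  rw [h5] at h3 h4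
  have h6 : Real.exp (1 / 16) ≤ 1 + 1 / 16 + (1 / 16) ^ 2 := by
    have := (abs_le.1 (Real.abs_exp_sub_one_sub_id_le (x := 1 / 16) (by norm_num [abs_le]))).2
    linarith
  simp only [integral_const, probReal_univ, smul_eq_mul, one_mul] at h2
  rw [ht2] at h2
  have h7 : 1 / (8 * s) * ∫ ω, f ω ^ 2 ∂P ≤ 17 / 128 := by linarith
  rw [one_div, inv_mul_le_iff₀ (by positivity)] at h7
  linarith

/-- The squared maximum is at most the sum of squares, and `2 A M ≤ A² + M²` replaces the
Cauchy–Schwarz inequality. For two features this beats the logarithmic bound, which is too weak when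
`n = D = 1`. -/
lemma integral_maxOver_abs_le_sqrt_card (hU : ∀ α, Measurable fun ω => U ω α)
    (hC : ∀ ω α, |U ω α| ≤ C) (hs : 0 < s)
    (hmgf : ∀ α t, ∫ ω, Real.exp (t * U ω α) ∂P ≤ Real.exp (s * t ^ 2 / 2)) :
    ∫ ω, maxOver (fun α => |U ω α|) ∂P ≤
      Real.sqrt s * Real.sqrt (17 / 16 * Fintype.card ι) := by
  set N := (Fintype.card ι : ℝ) with hN
  have hN1 : (1 : ℝ) ≤ N := by
    rw [hN]; exact_mod_cast Fintype.card_pos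
  rw [← Real.sqrt_mul hs.le]
  set A := Real.sqrt (s * (17 / 16 * N)) with hA
  have hA0 : 0 < A := by positivity
  have hA2 : A ^ 2 = s * (17 / 16 * N) := Real.sq_sqrt (by positivity)
  set M : Ω → ℝ := fun ω => maxOver (fun α => |U ω α|) with hM
  have hMm : Measurable M := measurable_maxOver fun α => (hU α).abs
  have hMC : ∀ ω, |M ω| ≤ C := fun ω => abs_maxOver_le fun α => by rw [abs_abs]; exact hC ω α
  have hMi : Integrable M P := integrable_of_abs_le hMm hMC
  have hi : ∀ α, Integrable (fun ω => U ω α ^ 2) P := fun α =>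
    integrable_of_abs_le ((hU α).pow_const 2) (C := C ^ 2) fun ω => by
      rw [abs_pow]
      exact pow_le_pow_left₀ (abs_nonneg _) (hC ω α) 2
  have h1 : ∀ ω, 2 * A * M ω ≤ A ^ 2 + ∑ α, U ω α ^ 2 := by
    intro ω
    obtain ⟨α, hα⟩ := exists_maxOver_eq (fun α => |U ω α|)
    have h2 := Finset.single_le_sum (f := fun α => U ω α ^ 2) (fun _ _ => sq_nonneg _)
      (Finset.mem_univ α)
    simp only [hM, hα]
    rw [← sq_abs (U ω α)] at h2
    nlinarith [sq_nonneg (A - |U ω α|)]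
  have h2 := integral_mono (hMi.const_mul (2 * A))
    ((integrable_const (A ^ 2)).add (integrable_finsetSum Finset.univ fun α _ => hi α)) h1
  simp only [Pi.add_apply] at h2
  rw [integral_const_mul, integral_add (integrable_const _)
    (integrable_finsetSum Finset.univ fun α _ => hi α), integral_finsetSum _ fun α _ => hi α] at h2
  have h3 : ∑ α, ∫ ω, U ω α ^ 2 ∂P ≤ A ^ 2 := by
    refine (Finset.sum_le_sum fun α _ => integral_sq_le_of_mgf (hU α) (fun ω => hC ω α) hs
      (hmgf α)).trans (le_of_eq ?_)
    rw [Finset.sum_const, Finset.card_univ, nsmul_eq_mul, hA2]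
    ring
  simp only [integral_const, probReal_univ, smul_eq_mul, one_mul] at h2
  nlinarith

end maximal

/-! ### Expected maxima of empirical processes -/

section empirical
variable {Z : Type*} [MeasurableSpace Z] {ν : Measure Z} [IsProbabilityMeasure ν]
  {ι : Type*} [Fintype ι] [Nonempty ι]

lemma integral_exp_sum_le {m : ℕ} {f : Z → ℝ} (hf : Measurable f) (hf0 : ∫ z, f z ∂ν = 0)
    (hw : ∀ a b, f a - f b ≤ 2) (t : ℝ) :
    ∫ z, Real.exp (t * ∑ i, f (z i)) ∂samples ν m ≤ Real.exp (m * t ^ 2 / 2) := by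
  have h1 : ∀ z : Fin m → Z, Real.exp (t * ∑ i, f (z i)) = ∏ i, Real.exp (t * f (z i)) := by
    intro z
    rw [Finset.mul_sum, Real.exp_sum]
  simp_rw [h1]
  rw [integral_fintype_prod_eq_prod (fun _ : Fin m => fun z : Z => Real.exp (t * f z))]
  have h2 := integral_exp_sub_integral_le (ν := ν) hf hw t
  simp only [hf0, sub_zero] at h2
  calc ∏ i : Fin m, ∫ z, Real.exp (t * f z) ∂ν
      ≤ ∏ i : Fin m, Real.exp (2 ^ 2 * t ^ 2 / 8) :=
        Finset.prod_le_prod (fun _ _ => integral_nonneg fun _ => (Real.exp_pos _).le)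
          fun _ _ => h2
    _ = _ := by
        rw [Finset.prod_const, Finset.card_univ, Fintype.card_fin, ← Real.exp_nat_mul]
        ring_nf

/-- The constant of the maximal inequality for `N` empirical processes. -/
noncomputable def maximalConst (N : ℕ) : ℝ :=
  min (Real.sqrt (2 * Real.log (2 * N))) (Real.sqrt (17 / 16 * N))

lemma integral_maxOver_abs_sum_le {m : ℕ} (hm : 0 < m) {f : ι → Z → ℝ}
    (hf : ∀ α, Measurable (f α)) {C : ℝ} (hC : ∀ α z, |f α z| ≤ C)
    (hf0 : ∀ α, ∫ z, f α z ∂ν = 0) (hw : ∀ α a b, f α a - f α b ≤ 2) :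
    ∫ z, maxOver (fun α => |∑ i, f α (z i)|) ∂samples ν m ≤
      Real.sqrt m * maximalConst (Fintype.card ι) := by
  have hU : ∀ α, Measurable fun z : Fin m → Z => ∑ i, f α (z i) := fun α =>
    Finset.measurable_sum _ fun i _ => (hf α).comp (measurable_pi_apply i)
  have hUC : ∀ (z : Fin m → Z) α, |∑ i, f α (z i)| ≤ m * C := by
    intro z α
    refine (Finset.abs_sum_le_sum_abs _ _).trans ?_
    refine (Finset.sum_le_sum fun i _ => hC α (z i)).trans ?_
    simp
  have hm' : (0 : ℝ) < m := by exact_mod_cast hm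
  rw [maximalConst, mul_min_of_nonneg _ _ (Real.sqrt_nonneg _)]
  refine le_min ?_ ?_
  · exact integral_maxOver_abs_le_log hU hUC hm' fun α t =>
      integral_exp_sum_le (hf α) (hf0 α) (hw α) t
  · exact integral_maxOver_abs_le_sqrt_card hU hUC hm' fun α t =>
      integral_exp_sum_le (hf α) (hf0 α) (hw α) t

end empirical

/-! ### Symmetrization and contraction -/

section tensorization
variable {Z Z' : Type*} [MeasurableSpace Z] [MeasurableSpace Z'] {ν : Measure Z}
  [IsProbabilityMeasure ν] {ρ : Measure Z'} [IsProbabilityMeasure ρ]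
  {κ : Type*} [Fintype κ] [Nonempty κ]

lemma measurable_maxOver_add_sum {m : ℕ} {d : κ → Z → ℝ} (hd : ∀ u, Measurable (d u))
    (A : κ → ℝ) :
    Measurable fun z : Fin m → Z => maxOver fun u => A u + ∑ i, d u (z i) :=
  measurable_maxOver fun u => (Finset.measurable_sum _ fun i _ =>
    (hd u).comp (measurable_pi_apply i)).const_add _

lemma exists_abs_maxOver_add_sum_le {Z : Type*} {m : ℕ} {d : κ → Z → ℝ} {C : ℝ} (hC : ∀ u z, |d u z| ≤ C)
    (A : κ → ℝ) :
    ∃ B, ∀ z : Fin m → Z, |maxOver fun u => A u + ∑ i, d u (z i)| ≤ B := by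
  refine ⟨maxOver (fun u => |A u|) + m * C, fun z => abs_maxOver_le fun u => ?_⟩
  refine (abs_add_le _ _).trans (add_le_add (le_maxOver (fun u => |A u|) u) ?_)
  refine (Finset.abs_sum_le_sum_abs _ _).trans ?_
  refine (Finset.sum_le_sum fun i _ => hC u (z i)).trans ?_
  simp

/-- A comparison of expected maxima for one summand implies the comparison for sums of
independent copies. -/
lemma integral_maxOver_sum_le {d : κ → Z → ℝ} {e : κ → Z' → ℝ} (hd : ∀ u, Measurable (d u))
    (he : ∀ u, Measurable (e u)) {C : ℝ} (hdC : ∀ u z, |d u z| ≤ C) (heC : ∀ u z, |e u z| ≤ C)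
    (hone : ∀ A : κ → ℝ, ∫ z, maxOver (fun u => A u + d u z) ∂ν ≤
      ∫ z, maxOver (fun u => A u + e u z) ∂ρ) (m : ℕ) (A : κ → ℝ) :
    ∫ z, maxOver (fun u => A u + ∑ i, d u (z i)) ∂samples ν m ≤
      ∫ z, maxOver (fun u => A u + ∑ i, e u (z i)) ∂samples ρ m := by
  induction m generalizing A with
  | zero => simp
  | succ m ih =>
    obtain ⟨B, hB⟩ := exists_abs_maxOver_add_sum_le (m := m + 1) hdC A
    obtain ⟨B', hB'⟩ := exists_abs_maxOver_add_sum_le (m := m + 1) heC A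
    have hi1 : Integrable (fun p : Z × (Fin m → Z) => maxOver (fun u => A u +
        ∑ i, d u ((Fin.cons p.1 p.2 : Fin (m + 1) → Z) i))) (ν.prod (samples ν m)) :=
      integrable_of_abs_le ((measurable_maxOver_add_sum hd A).comp measurable_fin_cons)
        fun p => hB _
    have hi2 : Integrable (fun p : Z' × (Fin m → Z') => maxOver (fun u => A u +
        ∑ i, e u ((Fin.cons p.1 p.2 : Fin (m + 1) → Z') i))) (ρ.prod (samples ρ m)) :=
      integrable_of_abs_le ((measurable_maxOver_add_sum he A).comp measurable_fin_cons)
        fun p => hB' _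
    have hi3 : Integrable (fun p : Z × (Fin m → Z') => maxOver (fun u => A u + d u p.1 +
        ∑ i, e u (p.2 i))) (ν.prod (samples ρ m)) := by
      refine integrable_of_abs_le (C := maxOver (fun u => |A u|) + C + m * C)
        (measurable_maxOver fun u => ?_) fun p => abs_maxOver_le fun u => ?_
      · exact (((hd u).comp measurable_fst).const_add _).add (Finset.measurable_sum _ fun i _ =>
          (he u).comp ((measurable_pi_apply i).comp measurable_snd))
      · refine (abs_add_le _ _).trans (add_le_add ((abs_add_le _ _).trans
          (add_le_add (le_maxOver (fun u => |A u|) u) (hdC u _))) ?_)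
        refine (Finset.abs_sum_le_sum_abs _ _).trans ?_
        refine (Finset.sum_le_sum fun i _ => heC u (p.2 i)).trans ?_
        simp
    rw [integral_samples_succ, integral_samples_succ, integral_prod _ hi1,
      integral_prod_symm _ hi2]
    simp only [Fin.sum_univ_succ, Fin.cons_zero, Fin.cons_succ, ← add_assoc] at hi1 hi2 ⊢
    -- The summands `d` are exchanged for `e` in two steps: first those of the last `m` samples, by
    -- induction with offset `A + d(a)`; then, after Fubini, that of the first sample, with the sum
    -- over the other samples as part of the offset. This is why `hone` must hold for every offset.
    calc ∫ a, ∫ z, maxOver (fun u => A u + d u a + ∑ i, d u (z i)) ∂samples ν m ∂ν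
        ≤ ∫ a, ∫ z, maxOver (fun u => A u + d u a + ∑ i, e u (z i)) ∂samples ρ m ∂ν :=
          integral_mono hi1.integral_prod_left hi3.integral_prod_left
            fun a => ih fun u => A u + d u a
      _ = ∫ z, ∫ a, maxOver (fun u => A u + d u a + ∑ i, e u (z i)) ∂ν ∂samples ρ m :=
          integral_integral_swap hi3
      _ ≤ ∫ z, ∫ a, maxOver (fun u => A u + e u a + ∑ i, e u (z i)) ∂ρ ∂samples ρ m := by
          refine integral_mono hi3.integral_prod_right hi2.integral_prod_right fun z => ?_
          have := hone fun u => A u + ∑ i, e u (z i)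
          simp only [add_right_comm] at this ⊢
          exact this

end tensorization

section rademacher
variable {Z : Type*} [MeasurableSpace Z] {ν : Measure Z} [IsProbabilityMeasure ν]
  {κ : Type*} [Fintype κ] [Nonempty κ]

/-- A uniform sign together with a sample. -/
noncomputable def signed (ν : Measure Z) : Measure (Bool × Z) :=
  (PMF.uniformOfFintype Bool).toMeasure.prod ν

instance : IsProbabilityMeasure (signed ν) := by
  unfold signed; infer_instance

/-- The sign of a Boolean. -/
def boolSign (b : Bool) : ℝ := if b then 1 else -1

lemma integral_signed {f : Bool × Z → ℝ} (hf : Measurable f) {C : ℝ} (hC : ∀ p, |f p| ≤ C) :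
    ∫ p, f p ∂signed ν = (∫ z, f (true, z) ∂ν + ∫ z, f (false, z) ∂ν) / 2 := by
  rw [signed, integral_prod _ (integrable_of_abs_le hf hC), PMF.integral_eq_sum]
  simp
  ring

/-- Let `u` and `u'` attain the two maxima on the left. The gain `2 (p u - p u')` is at most `2 |q u
- q u'|`. Depending on the sign of `q u - q u'`, testing the right side at `(u, u')` or at `(u', u)`
attains this gain with the same offsets. -/
lemma maxOver_contraction {A p q : κ → ℝ} (h : ∀ u u', |p u - p u'| ≤ |q u - q u'|) :
    maxOver (fun u => A u + 2 * p u) + maxOver (fun u => A u - 2 * p u) ≤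
      maxOver (fun u => A u + 2 * q u) + maxOver (fun u => A u - 2 * q u) := by
  obtain ⟨u, hu⟩ := exists_maxOver_eq (fun u => A u + 2 * p u)
  obtain ⟨u', hu'⟩ := exists_maxOver_eq (fun u => A u - 2 * p u)
  rw [hu, hu']
  have h1 := (le_abs_self _).trans (h u u')
  have h2 := le_maxOver (fun u => A u + 2 * q u) u
  have h3 := le_maxOver (fun u => A u - 2 * q u) u'
  have h4 := le_maxOver (fun u => A u + 2 * q u) u'
  have h5 := le_maxOver (fun u => A u - 2 * q u) u
  rcases abs_cases (q u - q u') with ⟨e, -⟩ | ⟨e, -⟩ <;> rw [e] at h1 <;> linarith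

/-- For each `u`, `A + E p - p(z)` is the mean of `A + 2 E p` and `A - 2 p(z)`, so the maximum is at
most the half-sum of two separate maxima. Integrating leaves the two signs `±2 p` at the same point,
where the contraction replaces `p` by `q`. The half-sum is the average over a random sign. -/
lemma integral_maxOver_symmetrize {p q : κ → Z → ℝ} (hp : ∀ u, Measurable (p u))
    (hq : ∀ u, Measurable (q u)) {C : ℝ} (hpC : ∀ u z, |p u z| ≤ C) (hqC : ∀ u z, |q u z| ≤ C)
    (h : ∀ z u u', |p u z - p u' z| ≤ |q u z - q u' z|) (A : κ → ℝ) :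
    ∫ z, maxOver (fun u => A u + (∫ w, p u w ∂ν - p u z)) ∂ν ≤
      ∫ x, maxOver (fun u => A u + 2 * (boolSign x.1 * q u x.2)) ∂signed ν := by
  have hC0 : 0 ≤ C := by
    obtain ⟨z⟩ := ν.nonempty_of_neZero
    exact (abs_nonneg _).trans (hpC (Classical.arbitrary κ) z)
  have hbd : ∀ (c : ℝ), |c| ≤ 2 → ∀ r : κ → Z → ℝ, (∀ u z, |r u z| ≤ C) → ∀ z,
      |maxOver fun u => A u + c * r u z| ≤ maxOver (fun u => |A u|) + 2 * C := by
    intro c hc r hr z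
    refine abs_maxOver_le fun u => (abs_add_le _ _).trans (add_le_add
      (le_maxOver (fun u => |A u|) u) ?_)
    rw [abs_mul]
    exact mul_le_mul hc (hr u z) (abs_nonneg _) (by norm_num)
  have hmeas : ∀ (c : ℝ) (r : κ → Z → ℝ), (∀ u, Measurable (r u)) →
      Measurable fun z => maxOver fun u => A u + c * r u z := fun c r hr =>
    measurable_maxOver fun u => ((hr u).const_mul c).const_add _
  have hint : ∀ (c : ℝ), |c| ≤ 2 → ∀ r : κ → Z → ℝ, (∀ u, Measurable (r u)) →
      (∀ u z, |r u z| ≤ C) → Integrable (fun z => maxOver fun u => A u + c * r u z) ν :=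
    fun c hc r hr hrC => integrable_of_abs_le (hmeas c r hr) (hbd c hc r hrC)
  have h2 : |(2 : ℝ)| ≤ 2 := by norm_num
  have h2' : |(-2 : ℝ)| ≤ 2 := by norm_num
  have hr : ∫ x, maxOver (fun u => A u + 2 * (boolSign x.1 * q u x.2)) ∂signed ν =
      (∫ z, maxOver (fun u => A u + 2 * q u z) ∂ν +
        ∫ z, maxOver (fun u => A u + -2 * q u z) ∂ν) / 2 := by
    rw [integral_signed (C := maxOver (fun u => |A u|) + 2 * C)]
    · simp [boolSign]
    · refine measurable_maxOver fun u => Measurable.const_add (Measurable.const_mul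
        (Measurable.mul ?_ ((hq u).comp measurable_snd)) _) _
      exact (measurable_of_countable boolSign).comp measurable_fst
    · intro x
      have : ∀ u, A u + 2 * (boolSign x.1 * q u x.2) = A u + (2 * boolSign x.1) * q u x.2 := by
        intro u; ring
      simp_rw [this]
      refine hbd _ ?_ q hqC x.2
      rcases x.1 <;> simp [boolSign]
  have hpi : ∀ u, Integrable (p u) ν := fun u => integrable_of_abs_le (hp u) (hpC u)
  have hstep : ∀ z, maxOver (fun u => A u + (∫ w, p u w ∂ν - p u z)) ≤
      (∫ w, maxOver (fun u => A u + 2 * p u w) ∂ν + maxOver (fun u => A u + -2 * p u z)) / 2 := by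
    intro z
    refine maxOver_le fun u => ?_
    have h3 : ∫ w, (A u + 2 * p u w) ∂ν ≤ ∫ w, maxOver (fun u => A u + 2 * p u w) ∂ν :=
      integral_mono ((integrable_const _).add ((hpi u).const_mul 2)) (hint 2 h2 p hp hpC)
        fun w => le_maxOver (fun u => A u + 2 * p u w) u
    rw [integral_add (integrable_const _) ((hpi u).const_mul 2), integral_const_mul] at h3
    have h4 := le_maxOver (fun u => A u + -2 * p u z) u
    simp only [integral_const, probReal_univ, smul_eq_mul, one_mul] at h3 h4
    linarith
  have hcontr : ∫ z, maxOver (fun u => A u + 2 * p u z) ∂ν +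
      ∫ z, maxOver (fun u => A u + -2 * p u z) ∂ν ≤
      ∫ z, maxOver (fun u => A u + 2 * q u z) ∂ν +
        ∫ z, maxOver (fun u => A u + -2 * q u z) ∂ν := by
    rw [← integral_add (hint 2 h2 p hp hpC) (hint (-2) h2' p hp hpC),
      ← integral_add (hint 2 h2 q hq hqC) (hint (-2) h2' q hq hqC)]
    refine integral_mono ((hint 2 h2 p hp hpC).add (hint (-2) h2' p hp hpC))
      ((hint 2 h2 q hq hqC).add (hint (-2) h2' q hq hqC)) fun z => ?_
    have := maxOver_contraction (A := A) (h z)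
    simp only [neg_mul, ← sub_eq_add_neg]
    exact this
  rw [hr]
  have h5 : ∫ z, maxOver (fun u => A u + (∫ w, p u w ∂ν - p u z)) ∂ν ≤
      ∫ z, (∫ w, maxOver (fun u => A u + 2 * p u w) ∂ν +
        maxOver (fun u => A u + -2 * p u z)) / 2 ∂ν := by
    refine integral_mono (integrable_of_abs_le (C := maxOver (fun u => |A u|) + 2 * C)
      (measurable_maxOver fun u => ((hp u).const_sub _).const_add _) fun z => ?_)
      (((integrable_const _).add (hint (-2) h2' p hp hpC)).div_const 2) hstep
    refine abs_maxOver_le fun u => (abs_add_le _ _).trans (add_le_add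
      (le_maxOver (fun u => |A u|) u) ((abs_sub _ _).trans ?_))
    have := abs_integral_le_of_abs_le (μ := ν) (hpC u)
    linarith [hpC u z]
  rw [integral_div, integral_add (integrable_const _) (hint (-2) h2' p hp hpC)] at h5
  simp only [integral_const, probReal_univ, smul_eq_mul, one_mul] at h5
  linarith

end rademacher

/-! ### Uniform deviation of the empirical logistic loss over an `ℓ¹` ball -/

section deviation
variable {Z : Type*} [MeasurableSpace Z] {ν : Measure Z} [IsProbabilityMeasure ν]
  {ι : Type*} [Fintype ι] {κ : Type*} [Fintype κ] [Nonempty κ]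
  {φ : ι → Z → ℝ} {y : Z → ℝ} {R : ℝ}

/-- The linear predictor with features `φ`. -/
def score (φ : ι → Z → ℝ) (u : ι → ℝ) (z : Z) : ℝ := ∑ α, u α * φ α z

lemma measurable_score (hφ : ∀ α, Measurable (φ α)) (u : ι → ℝ) : Measurable (score φ u) :=
  Finset.measurable_sum _ fun α _ => (hφ α).const_mul _

lemma abs_score_le {Z : Type*} {φ : ι → Z → ℝ} (hφ1 : ∀ α z, |φ α z| ≤ 1) {u : ι → ℝ} (hu : l1norm u ≤ R) (z : Z) :
    |score φ u z| ≤ R :=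
  (abs_sum_mul_le_l1norm u (fun α => φ α z) fun α => hφ1 α z).trans (by simpa using hu)

lemma abs_logCosh_le (v : ℝ) : |logCosh v| ≤ Real.log 2 + |v| := by
  have h := abs_logCosh_sub_le v 0
  have h0 : logCosh 0 = Real.log 2 := by simp [logCosh]
  rw [h0, sub_zero] at h
  have h2 : |Real.log 2| = Real.log 2 := abs_of_pos (Real.log_pos (by norm_num))
  calc |logCosh v| = |(logCosh v - Real.log 2) + Real.log 2| := by ring_nf
    _ ≤ |logCosh v - Real.log 2| + |Real.log 2| := abs_add_le _ _
    _ ≤ _ := by rw [h2]; linarith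

lemma continuous_logCosh : Continuous logCosh :=
  LipschitzWith.continuous (K := 1) <| LipschitzWith.of_dist_le_mul fun x y => by
    simpa [Real.dist_eq] using abs_logCosh_sub_le x y

variable [Nonempty ι]

lemma sum_l1_mul_le {u : ι → ℝ} (hu : l1norm u ≤ R) (f : ι → ℝ) :
    ∑ α, u α * f α ≤ R * maxOver fun α => |f α| := by
  have h0 : 0 ≤ maxOver fun α => |f α| :=
    (abs_nonneg _).trans (le_maxOver (fun α => |f α|) (Classical.arbitrary ι))
  exact (le_abs_self _).trans ((abs_sum_mul_le_l1norm u f (le_maxOver fun α => |f α|)).trans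
    (mul_le_mul_of_nonneg_right hu h0))

/-- The centred process is already linear in `u`, so its maximum over the ball is bounded by `R`
times the largest coordinate. No symmetrization is needed, which saves a factor `2`. -/
lemma integral_maxOver_linear_le {m : ℕ} (hm : 0 < m) (hR : 0 ≤ R)
    (hφ : ∀ α, Measurable (φ α)) (hφ1 : ∀ α z, |φ α z| ≤ 1) (hy : Measurable y)
    (hy1 : ∀ z, y z = 1 ∨ y z = -1) {u : κ → ι → ℝ} (hu : ∀ k, l1norm (u k) ≤ R) :
    ∫ z, maxOver (fun k => ∑ i, (score φ (u k) (z i) * y (z i) -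
      ∫ w, score φ (u k) w * y w ∂ν)) ∂samples ν m ≤
      R * (Real.sqrt m * maximalConst (Fintype.card ι)) := by
  have hya : ∀ z, |y z| = 1 := fun z => by rcases hy1 z with h | h <;> simp [h]
  set f : ι → Z → ℝ := fun α z => φ α z * y z - ∫ w, φ α w * y w ∂ν with hf
  have hφy : ∀ α z, |φ α z * y z| ≤ 1 := fun α z => by
    rw [abs_mul, hya, mul_one]; exact hφ1 α z
  have hφyi : ∀ α, Integrable (fun z => φ α z * y z) ν := fun α =>
    integrable_of_abs_le ((hφ α).mul hy) (hφy α)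
  have hfm : ∀ α, Measurable (f α) := fun α => ((hφ α).mul hy).sub_const _
  have hfC : ∀ α z, |f α z| ≤ 2 := fun α z => by
    have h1 := abs_sub (φ α z * y z) (∫ w, φ α w * y w ∂ν)
    have h2 := abs_integral_le_of_abs_le (μ := ν) (hφy α)
    have h3 := hφy α z
    simp only [hf]
    linarith
  have hf0 : ∀ α, ∫ z, f α z ∂ν = 0 := fun α => by
    simp only [hf]
    rw [integral_sub (hφyi α) (integrable_const _)]
    simp
  have hw : ∀ α a b, f α a - f α b ≤ 2 := fun α a b => by
    have h1 := abs_le.1 (hφy α a)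
    have h2 := abs_le.1 (hφy α b)
    simp only [hf]
    linarith
  have key := integral_maxOver_abs_sum_le (ν := ν) hm hfm hfC hf0 hw
  have hrew : ∀ (k : κ) (z : Fin m → Z), ∑ i, (score φ (u k) (z i) * y (z i) -
      ∫ w, score φ (u k) w * y w ∂ν) = ∑ α, u k α * ∑ i, f α (z i) := by
    intro k z
    have h1 : ∫ w, score φ (u k) w * y w ∂ν = ∑ α, u k α * ∫ w, φ α w * y w ∂ν := by
      simp only [score, Finset.sum_mul, mul_assoc]
      rw [integral_finsetSum _ fun α _ => (hφyi α).const_mul _]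
      simp_rw [integral_const_mul]
    simp_rw [h1]
    simp only [Finset.mul_sum, score, Finset.sum_mul]
    rw [Finset.sum_comm]
    refine Finset.sum_congr rfl fun i _ => ?_
    rw [← Finset.sum_sub_distrib]
    refine Finset.sum_congr rfl fun α _ => ?_
    simp only [hf]
    ring
  simp_rw [hrew]
  have hsm : ∀ α, Measurable fun z : Fin m → Z => ∑ i, f α (z i) := fun α =>
    Finset.measurable_sum _ fun i _ => (hfm α).comp (measurable_pi_apply i)
  have hsC : ∀ (z : Fin m → Z) α, |∑ i, f α (z i)| ≤ m * 2 := by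
    intro z α
    refine (Finset.abs_sum_le_sum_abs _ _).trans ?_
    refine (Finset.sum_le_sum fun i _ => hfC α (z i)).trans ?_
    simp
  calc _ ≤ ∫ z, R * maxOver (fun α => |∑ i, f α (z i)|) ∂samples ν m := by
        refine integral_mono (integrable_of_abs_le (C := R * (m * 2))
          (measurable_maxOver fun k => Finset.measurable_sum _ fun α _ =>
            (hsm α).const_mul _) fun z => abs_maxOver_le fun k => ?_)
          ((integrable_of_abs_le (C := m * 2) (measurable_maxOver fun α => (hsm α).abs)
            fun z => abs_maxOver_le fun α => by rw [abs_abs]; exact hsC z α).const_mul R)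
          fun z => maxOver_le fun k => sum_l1_mul_le (hu k) _
        refine (abs_sum_mul_le_l1norm _ _ (hsC z)).trans ?_
        exact mul_le_mul_of_nonneg_right (hu k) (by positivity)
    _ ≤ _ := by
        rw [integral_const_mul]
        exact mul_le_mul_of_nonneg_left key hR

/-- Symmetrization with the `1`-Lipschitz contraction replaces `logCosh` of the score by twice the
signed score, and the rest is linear duality. -/
lemma integral_maxOver_logCosh_le {m : ℕ} (hm : 0 < m) (hR : 0 ≤ R)
    (hφ : ∀ α, Measurable (φ α)) (hφ1 : ∀ α z, |φ α z| ≤ 1)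
    {u : κ → ι → ℝ} (hu : ∀ k, l1norm (u k) ≤ R) :
    ∫ z, maxOver (fun k => ∑ i, (∫ w, logCosh (score φ (u k) w) ∂ν -
      logCosh (score φ (u k) (z i)))) ∂samples ν m ≤
      2 * R * (Real.sqrt m * maximalConst (Fintype.card ι)) := by
  have hq : ∀ k, Measurable (score φ (u k)) := fun k => measurable_score hφ _
  have hqR : ∀ k z, |score φ (u k) z| ≤ R := fun k z => abs_score_le hφ1 (hu k) z
  have hp : ∀ k, Measurable fun z => logCosh (score φ (u k) z) := fun k =>
    continuous_logCosh.measurable.comp (hq k)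
  have hl2 : 0 < Real.log 2 := Real.log_pos (by norm_num)
  have hpR : ∀ k z, |logCosh (score φ (u k) z)| ≤ Real.log 2 + R := fun k z =>
    (abs_logCosh_le _).trans (by linarith [hqR k z])
  have hsign : ∀ b, |boolSign b| = 1 := by intro b; rcases b <;> simp [boolSign]
  have hsm : Measurable fun x : Bool × Z => boolSign x.1 :=
    (measurable_of_countable boolSign).comp measurable_fst
  have hone := integral_maxOver_symmetrize (ν := ν) (p := fun k z => logCosh (score φ (u k) z))
    (q := fun k => score φ (u k)) hp hq hpR (fun k z => (hqR k z).trans (by linarith))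
    fun z k l => abs_logCosh_sub_le _ _
  have h1 := integral_maxOver_sum_le (ν := ν) (ρ := signed ν)
    (d := fun k z => ∫ w, logCosh (score φ (u k) w) ∂ν - logCosh (score φ (u k) z))
    (e := fun k x => 2 * (boolSign x.1 * score φ (u k) x.2)) (C := 2 * (Real.log 2 + R))
    (fun k => (hp k).const_sub _)
    (fun k => (hsm.mul ((hq k).comp measurable_snd)).const_mul 2)
    (fun k z => by
      have h2 := abs_sub (∫ w, logCosh (score φ (u k) w) ∂ν) (logCosh (score φ (u k) z))
      have h3 := abs_integral_le_of_abs_le (μ := ν) (hpR k)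
      have h4 := hpR k z
      linarith)
    (fun k x => by
      rw [abs_mul, abs_mul, hsign, one_mul, abs_two]
      have := hqR k x.2
      linarith) hone m (fun _ => 0)
  simp only [zero_add] at h1
  refine h1.trans ?_
  set f : ι → Bool × Z → ℝ := fun α x => boolSign x.1 * φ α x.2 with hf
  have hfm : ∀ α, Measurable (f α) := fun α => hsm.mul ((hφ α).comp measurable_snd)
  have hfC : ∀ α x, |f α x| ≤ 1 := fun α x => by
    simp only [hf, abs_mul, hsign, one_mul]
    exact hφ1 α x.2
  have hf0 : ∀ α, ∫ x, f α x ∂signed ν = 0 := fun α => by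
    rw [integral_signed (hfm α) (hfC α)]
    simp only [hf, boolSign]
    simp [integral_neg]
  have hw : ∀ α a b, f α a - f α b ≤ 2 := fun α a b => by
    have h1 := abs_le.1 (hfC α a)
    have h2 := abs_le.1 (hfC α b)
    linarith
  have key := integral_maxOver_abs_sum_le (ν := signed ν) hm hfm hfC hf0 hw
  have hrew : ∀ (k : κ) (x : Fin m → Bool × Z),
      ∑ i, 2 * (boolSign (x i).1 * score φ (u k) (x i).2) =
        2 * ∑ α, u k α * ∑ i, f α (x i) := by
    intro k x
    simp only [Finset.mul_sum, score]
    rw [Finset.sum_comm]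
    refine Finset.sum_congr rfl fun i _ => Finset.sum_congr rfl fun α _ => ?_
    simp only [hf]
    ring
  simp_rw [hrew]
  have hsm : ∀ α, Measurable fun x : Fin m → Bool × Z => ∑ i, f α (x i) := fun α =>
    Finset.measurable_sum _ fun i _ => (hfm α).comp (measurable_pi_apply i)
  have hsC : ∀ (x : Fin m → Bool × Z) α, |∑ i, f α (x i)| ≤ m := by
    intro z α
    refine (Finset.abs_sum_le_sum_abs _ _).trans ?_
    refine (Finset.sum_le_sum fun i _ => hfC α (z i)).trans ?_
    simp
  calc _ ≤ ∫ z, 2 * R * maxOver (fun α => |∑ i, f α (z i)|) ∂samples (signed ν) m := by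
        refine integral_mono (integrable_of_abs_le (C := 2 * (R * m))
          (measurable_maxOver fun k => (Finset.measurable_sum _ fun α _ =>
            (hsm α).const_mul _).const_mul 2) fun z => abs_maxOver_le fun k => ?_)
          ((integrable_of_abs_le (C := m) (measurable_maxOver fun α => (hsm α).abs)
            fun z => abs_maxOver_le fun α => by rw [abs_abs]; exact hsC z α).const_mul (2 * R))
          fun z => maxOver_le fun k => ?_
        · rw [abs_mul, abs_two]
          refine mul_le_mul_of_nonneg_left ?_ zero_le_two
          refine (abs_sum_mul_le_l1norm _ _ (hsC z)).trans ?_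
          exact mul_le_mul_of_nonneg_right (hu k) (by positivity)
        · simp only [mul_assoc]
          exact mul_le_mul_of_nonneg_left (sum_l1_mul_le (hu k) _) zero_le_two
    _ ≤ _ := by
        rw [integral_const_mul]
        exact mul_le_mul_of_nonneg_left key (by linarith)

/-- The costs `R` and `2 R` of the two parts add up to `3 R`. Contracting the `2`-Lipschitz loss as
a whole would give `4 R` and leave no slack for the final constants. -/
lemma integral_maxOver_loss_le {m : ℕ} (hm : 0 < m) (hR : 0 ≤ R)
    (hφ : ∀ α, Measurable (φ α)) (hφ1 : ∀ α z, |φ α z| ≤ 1) (hy : Measurable y)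
    (hy1 : ∀ z, y z = 1 ∨ y z = -1) {u : κ → ι → ℝ} (hu : ∀ k, l1norm (u k) ≤ R) :
    ∫ z, maxOver (fun k => ∑ i, (∫ w, logisticLoss (score φ (u k) w) (y w) ∂ν -
      logisticLoss (score φ (u k) (z i)) (y (z i)))) ∂samples ν m ≤
      3 * R * (Real.sqrt m * maximalConst (Fintype.card ι)) := by
  have h1 := integral_maxOver_linear_le (ν := ν) hm hR hφ hφ1 hy hy1 hu
  have h2 := integral_maxOver_logCosh_le (ν := ν) hm hR hφ hφ1 hu
  have hya : ∀ z, |y z| = 1 := fun z => by rcases hy1 z with h | h <;> simp [h]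
  have hqR : ∀ k z, |score φ (u k) z| ≤ R := fun k z => abs_score_le hφ1 (hu k) z
  have hq : ∀ k, Measurable (score φ (u k)) := fun k => measurable_score hφ _
  have hl2 : 0 < Real.log 2 := Real.log_pos (by norm_num)
  have hlm : ∀ k, Measurable fun z => score φ (u k) z * y z := fun k => (hq k).mul hy
  have hlC : ∀ k z, |score φ (u k) z * y z| ≤ Real.log 2 + R := fun k z => by
    rw [abs_mul, hya, mul_one]; linarith [hqR k z]
  have hcm : ∀ k, Measurable fun z => logCosh (score φ (u k) z) := fun k =>
    continuous_logCosh.measurable.comp (hq k)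
  have hcC : ∀ k z, |logCosh (score φ (u k) z)| ≤ Real.log 2 + R := fun k z =>
    (abs_logCosh_le _).trans (by linarith [hqR k z])
  have hsum : ∀ k (z : Fin m → Z), ∑ i, (∫ w, logisticLoss (score φ (u k) w) (y w) ∂ν -
      logisticLoss (score φ (u k) (z i)) (y (z i))) =
      ∑ i, (score φ (u k) (z i) * y (z i) - ∫ w, score φ (u k) w * y w ∂ν) +
      ∑ i, (∫ w, logCosh (score φ (u k) w) ∂ν - logCosh (score φ (u k) (z i))) := by
    intro k z
    have h3 : ∫ w, logisticLoss (score φ (u k) w) (y w) ∂ν =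
        ∫ w, logCosh (score φ (u k) w) ∂ν - ∫ w, score φ (u k) w * y w ∂ν := by
      simp_rw [fun w => logisticLoss_eq (hy1 w) (score φ (u k) w)]
      exact integral_sub (integrable_of_abs_le (hcm k) (hcC k))
        (integrable_of_abs_le (hlm k) (hlC k))
    rw [← Finset.sum_add_distrib]
    refine Finset.sum_congr rfl fun i _ => ?_
    rw [h3, logisticLoss_eq (hy1 _)]
    ring
  simp_rw [hsum]
  have hbd : ∀ (g : κ → Z → ℝ), (∀ k, Measurable (g k)) → ∀ C, (∀ k z, |g k z| ≤ C) →
      Integrable (fun z : Fin m → Z => maxOver fun k => ∑ i, g k (z i)) (samples ν m) := by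
    intro g hg C hC
    obtain ⟨B, hB⟩ := exists_abs_maxOver_add_sum_le (m := m) hC (fun _ => 0)
    have := integrable_of_abs_le (μ := samples ν m) (measurable_maxOver_add_sum hg (fun _ => 0)) hB
    simpa only [zero_add] using this
  have hi1 := hbd (fun k z => score φ (u k) z * y z - ∫ w, score φ (u k) w * y w ∂ν)
    (fun k => (hlm k).sub_const _) (2 * (Real.log 2 + R)) fun k z => by
      have h2 := abs_sub (score φ (u k) z * y z) (∫ w, score φ (u k) w * y w ∂ν)
      have h3 := abs_integral_le_of_abs_le (μ := ν) (hlC k)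
      linarith [hlC k z]
  have hi2 := hbd (fun k z => ∫ w, logCosh (score φ (u k) w) ∂ν - logCosh (score φ (u k) z))
    (fun k => (hcm k).const_sub _) (2 * (Real.log 2 + R)) fun k z => by
      have h2 := abs_sub (∫ w, logCosh (score φ (u k) w) ∂ν) (logCosh (score φ (u k) z))
      have h3 := abs_integral_le_of_abs_le (μ := ν) (hcC k)
      linarith [hcC k z]
  have hi3 := hbd (fun k z => (score φ (u k) z * y z - ∫ w, score φ (u k) w * y w ∂ν) +
    (∫ w, logCosh (score φ (u k) w) ∂ν - logCosh (score φ (u k) z)))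
    (fun k => ((hlm k).sub_const _).add ((hcm k).const_sub _)) (4 * (Real.log 2 + R))
    fun k z => by
      have h0 := abs_add_le (score φ (u k) z * y z - ∫ w, score φ (u k) w * y w ∂ν)
        (∫ w, logCosh (score φ (u k) w) ∂ν - logCosh (score φ (u k) z))
      have h2 := abs_sub (∫ w, logCosh (score φ (u k) w) ∂ν) (logCosh (score φ (u k) z))
      have h3 := abs_integral_le_of_abs_le (μ := ν) (hcC k)
      have h4 := abs_sub (score φ (u k) z * y z) (∫ w, score φ (u k) w * y w ∂ν)
      have h5 := abs_integral_le_of_abs_le (μ := ν) (hlC k)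
      linarith [hcC k z, hlC k z]
  simp only [Finset.sum_add_distrib] at hi3
  have h3 := integral_mono hi3 (hi1.add hi2) fun z => maxOver_add_le _ _
  simp only [Pi.add_apply] at h3
  rw [integral_add hi1 hi2] at h3
  linarith

/-- The loss decreases in the margin `v y`, so its values for `|v| ≤ R` lie between `logisticLoss R
1` and `logisticLoss (-R) 1`, whose difference is exactly `2 R`. The Lipschitz bound would only give
`4 R`. -/
lemma logisticLoss_diff_abs_le {y : ℝ} (hy : y = 1 ∨ y = -1) {v w : ℝ} (hv : |v| ≤ R)
    (hw : |w| ≤ R) : |logisticLoss v y - logisticLoss w y| ≤ 2 * R := by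
  have key : ∀ t, |t| ≤ R → logisticLoss R 1 ≤ logisticLoss t y ∧
      logisticLoss t y ≤ logisticLoss (-R) 1 := by
    intro t ht
    rw [abs_le] at ht
    unfold logisticLoss
    constructor <;> refine Real.log_le_log (by positivity) ?_ <;> gcongr 1 + Real.exp ?_ <;>
      rcases hy with rfl | rfl <;> linarith
  have hR0 : 0 ≤ R := (abs_nonneg _).trans hv
  have h1 := key v hv
  have h2 := key w hw
  have h3 : logisticLoss (-R) 1 - logisticLoss R 1 = 2 * R := by
    rw [logisticLoss_eq (Or.inl rfl), logisticLoss_eq (Or.inl rfl), logCosh, logCosh, Real.cosh_neg]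
    ring
  rw [abs_le]
  constructor <;> linarith

/-- The uniform deviation inequality for finitely many predictors. -/
lemma measure_maxOver_deviation_le {m : ℕ} (hm : 0 < m) (hR : 0 < R)
    (hφ : ∀ α, Measurable (φ α)) (hφ1 : ∀ α z, |φ α z| ≤ 1) (hy : Measurable y)
    (hy1 : ∀ z, y z = 1 ∨ y z = -1) {u : κ → ι → ℝ} (hu : ∀ k, l1norm (u k) ≤ R)
    {u₀ : ι → ℝ} (hu₀ : l1norm u₀ ≤ R) {δ : ℝ} (hδ0 : 0 < δ) (hδ1 : δ < 1) :
    (samples ν m) {z | 3 * R * (Real.sqrt m * maximalConst (Fintype.card ι)) +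
        R * Real.sqrt (8 * m * Real.log (1 / δ)) ≤
      maxOver fun k => ∑ i, ((∫ w, logisticLoss (score φ (u k) w) (y w) ∂ν -
        logisticLoss (score φ (u k) (z i)) (y (z i))) -
        (∫ w, logisticLoss (score φ u₀ w) (y w) ∂ν -
          logisticLoss (score φ u₀ (z i)) (y (z i))))} ≤ ENNReal.ofReal δ := by
  set l : (ι → ℝ) → Z → ℝ := fun u z => logisticLoss (score φ u z) (y z) with hl
  have hlm : ∀ u, Measurable (l u) := fun u => measurable_logisticLoss (measurable_score hφ u) hy
  have hlC : ∀ {u}, l1norm u ≤ R → ∀ z, |l u z| ≤ Real.log 2 + 2 * R := fun {u} hu z => by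
    rw [hl, abs_of_nonneg (logisticLoss_nonneg _ _)]
    linarith [logisticLoss_le_log_two_add (hy1 z) (score φ u z), abs_score_le hφ1 hu z]
  have hd : ∀ {u u'}, l1norm u ≤ R → l1norm u' ≤ R → ∀ z, |l u z - l u' z| ≤ 2 * R :=
    fun {u u'} hu hu' z =>
      logisticLoss_diff_abs_le (hy1 z) (abs_score_le hφ1 hu z) (abs_score_le hφ1 hu' z)
  have hli : ∀ {u}, l1norm u ≤ R → Integrable (l u) ν := fun {u} hu =>
    integrable_of_abs_le (hlm u) (hlC hu)
  set F : (Fin m → Z) → ℝ := fun z => maxOver fun k => ∑ i, ((∫ w, l (u k) w ∂ν - l (u k) (z i)) -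
    (∫ w, l u₀ w ∂ν - l u₀ (z i))) with hF
  have hdm : ∀ k, Measurable fun z => (∫ w, l (u k) w ∂ν - l (u k) z) -
    (∫ w, l u₀ w ∂ν - l u₀ z) := fun k => ((hlm _).const_sub _).sub ((hlm _).const_sub _)
  have hdC : ∀ k z, |(∫ w, l (u k) w ∂ν - l (u k) z) - (∫ w, l u₀ w ∂ν - l u₀ z)| ≤ 4 * R := by
    intro k z
    have h1 := abs_integral_le_of_abs_le (μ := ν) (hd (hu k) hu₀)
    rw [integral_sub (hli (hu k)) (hli hu₀)] at h1
    have h2 := hd (hu k) hu₀ z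
    rw [sub_sub_sub_comm]
    exact (abs_sub _ _).trans (by linarith)
  have hFm : Measurable F := by
    have := measurable_maxOver_add_sum (m := m) hdm (fun _ => 0)
    simpa only [zero_add] using this
  obtain ⟨B, hB⟩ : ∃ B, ∀ z, |F z| ≤ B := by
    have := exists_abs_maxOver_add_sum_le (m := m) hdC (fun _ => 0)
    simpa only [zero_add] using this
  -- Changing one sample changes each sum by the difference of two values of `l u - l u₀`, each at
  -- most `2 R` in modulus.
  have hFc : ∀ z i a, |F (Function.update z i a) - F z| ≤ 4 * R := by
    intro z i a
    refine maxOver_sub_le fun k => ?_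
    have hsplit : ∀ g : Z → ℝ, ∑ j, g (Function.update z i a j) - ∑ j, g (z j) = g a - g (z i) := by
      intro g
      rw [← Finset.sum_sub_distrib, Finset.sum_eq_single i]
      · simp
      · intro j _ hj
        simp [Function.update_of_ne hj]
      · simp
    rw [hsplit fun z => (∫ w, l (u k) w ∂ν - l (u k) z) - (∫ w, l u₀ w ∂ν - l u₀ z)]
    have h1 := hd (hu k) hu₀ a
    have h2 := hd (hu k) hu₀ (z i)
    have h3 : (∫ w, l (u k) w ∂ν - l (u k) a - (∫ w, l u₀ w ∂ν - l u₀ a)) -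
        (∫ w, l (u k) w ∂ν - l (u k) (z i) - (∫ w, l u₀ w ∂ν - l u₀ (z i))) =
        (l (u k) (z i) - l u₀ (z i)) - (l (u k) a - l u₀ a) := by ring
    rw [h3]
    exact (abs_sub _ _).trans (by linarith)
  -- The term with `u₀` does not depend on the index of the maximum and has mean zero, so it does
  -- not affect the expectation. Including it avoids a second concentration bound for `u₀`.
  have hEF : ∫ z, F z ∂samples ν m ≤
      3 * R * (Real.sqrt m * maximalConst (Fintype.card ι)) := by
    refine le_trans (le_of_eq ?_) (integral_maxOver_loss_le (ν := ν) hm hR.le hφ hφ1 hy hy1 hu)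
    have h1 : ∀ z, F z = maxOver (fun k => ∑ i, (∫ w, l (u k) w ∂ν - l (u k) (z i))) -
        ∑ i, (∫ w, l u₀ w ∂ν - l u₀ (z i)) := by
      intro z
      simp only [hF, Finset.sum_sub_distrib (g := fun i => (∫ w, l u₀ w ∂ν - l u₀ (z i)))]
      refine le_antisymm (maxOver_le fun k => ?_) ?_
      · have := le_maxOver (fun k => ∑ i, (∫ w, l (u k) w ∂ν - l (u k) (z i))) k
        linarith
      · obtain ⟨k, hk⟩ := exists_maxOver_eq (fun k => ∑ i, (∫ w, l (u k) w ∂ν - l (u k) (z i)))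
        rw [hk]
        exact le_maxOver (fun k => ∑ i, (∫ w, l (u k) w ∂ν - l (u k) (z i)) -
          ∑ i, (∫ w, l u₀ w ∂ν - l u₀ (z i))) k
    have hi0 : ∀ i : Fin m, Integrable (fun z : Fin m → Z => ∫ w, l u₀ w ∂ν - l u₀ (z i))
        (samples ν m) := fun i => by
      refine integrable_of_abs_le (C := (Real.log 2 + 2 * R) + (Real.log 2 + 2 * R))
        (((hlm u₀).comp (measurable_pi_apply i)).const_sub _) fun z => ?_
      exact (abs_sub _ _).trans (add_le_add (abs_integral_le_of_abs_le (hlC hu₀)) (hlC hu₀ _))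
    have h2 : ∫ z : Fin m → Z, ∑ i, (∫ w, l u₀ w ∂ν - l u₀ (z i)) ∂samples ν m = 0 := by
      rw [integral_finsetSum _ fun i _ => hi0 i]
      refine Finset.sum_eq_zero fun i _ => ?_
      have hev := measurePreserving_eval (fun _ : Fin m => ν) i
      have h3 : ∫ z : Fin m → Z, l u₀ (z i) ∂samples ν m = ∫ w, l u₀ w ∂ν := by
        have h := integral_map (μ := samples ν m) (f := l u₀) hev.measurable.aemeasurable
          (hlm u₀).aestronglyMeasurable
        rw [hev.map_eq] at h
        exact h.symm
      have h4 : Integrable (fun z : Fin m → Z => l u₀ (z i)) (samples ν m) :=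
        integrable_of_abs_le ((hlm u₀).comp (measurable_pi_apply i)) fun z => hlC hu₀ (z i)
      rw [integral_sub (integrable_const _) h4, h3]
      simp
    simp_rw [h1]
    rw [integral_sub _ (integrable_finsetSum _ fun i _ => hi0 i), h2, sub_zero]
    have hC' : ∀ k z, |∫ w, l (u k) w ∂ν - l (u k) z| ≤
        (Real.log 2 + 2 * R) + (Real.log 2 + 2 * R) := fun k z =>
      (abs_sub _ _).trans (add_le_add (abs_integral_le_of_abs_le (hlC (hu k))) (hlC (hu k) _))
    obtain ⟨B', hB'⟩ := exists_abs_maxOver_add_sum_le (m := m) hC' (fun _ => 0)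
    have h5 := integrable_of_abs_le (μ := samples ν m) (measurable_maxOver_add_sum
      (fun k => (hlm (u k)).const_sub _) (fun _ => 0)) hB'
    simpa only [zero_add] using h5
  have hm' : (0 : ℝ) < m := by exact_mod_cast hm
  have hlog : 0 < Real.log (1 / δ) := Real.log_pos (by rw [lt_div_iff₀ hδ0]; linarith)
  have hmain := measure_bounded_differences_le (ν := ν) hm hFm hB (by linarith : 0 < 4 * R) hFc
    (s := R * Real.sqrt (8 * m * Real.log (1 / δ))) (by positivity)
  refine (measure_mono ?_).trans (hmain.trans (le_of_eq ?_))
  · intro z hz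
    simp only [Set.mem_ofPred_eq] at hz ⊢
    linarith
  · congr 1
    rw [mul_pow, Real.sq_sqrt (by positivity)]
    have h1 : 2 * (R ^ 2 * (8 * m * Real.log (1 / δ))) / (m * (4 * R) ^ 2) = Real.log (1 / δ) := by
      field_simp
      ring
    rw [h1, one_div, Real.log_inv, neg_neg, Real.exp_log hδ0]

lemma continuous_l1norm {ι : Type*} [Fintype ι] : Continuous fun u : ι → ℝ => l1norm u :=
  continuous_finsetSum _ fun i _ => (continuous_apply i).abs

lemma continuous_integral_loss {ι : Type*} [Fintype ι] {φ : ι → Z → ℝ} (hφ : ∀ α, Measurable (φ α)) (hφ1 : ∀ α z, |φ α z| ≤ 1)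
    (hy : Measurable y) (hy1 : ∀ z, y z = 1 ∨ y z = -1) :
    Continuous fun u : ι → ℝ => ∫ w, logisticLoss (score φ u w) (y w) ∂ν := by
  have hi : ∀ u, Integrable (fun w => logisticLoss (score φ u w) (y w)) ν := fun u =>
    integrable_of_abs_le (C := Real.log 2 + 2 * l1norm u)
      (measurable_logisticLoss (measurable_score hφ u) hy) fun z => by
        rw [abs_of_nonneg (logisticLoss_nonneg _ _)]
        linarith [logisticLoss_le_log_two_add (hy1 z) (score φ u z),
          abs_score_le hφ1 (le_refl (l1norm u)) z]
  rw [continuous_iff_continuousAt]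
  intro u
  rw [ContinuousAt, tendsto_iff_dist_tendsto_zero]
  have h1 : Filter.Tendsto (fun u' : ι → ℝ => 2 * l1norm (u' - u)) (nhds u) (nhds 0) := by
    have h : Continuous fun u' : ι → ℝ => 2 * l1norm (u' - u) :=
      (continuous_l1norm.comp (continuous_id.sub continuous_const)).const_mul 2
    convert! h.tendsto u
    simp [l1norm]
  refine squeeze_zero (fun _ => dist_nonneg) (fun u' => ?_) h1
  rw [Real.dist_eq, ← integral_sub (hi u') (hi u)]
  refine abs_integral_le_of_abs_le fun z => ?_
  refine (abs_logisticLoss_sub_le (hy1 z) _ _).trans (mul_le_mul_of_nonneg_left ?_ zero_le_two)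
  have h2 : score φ u' z - score φ u z = score φ (u' - u) z := by
    simp [score, sub_mul, Finset.sum_sub_distrib]
  rw [h2]
  exact abs_score_le hφ1 le_rfl z

/-- The uniform deviation inequality over the `ℓ¹` ball of radius `R`. -/
lemma measure_exists_deviation_le {m : ℕ} (hm : 0 < m) (hR : 0 < R)
    (hφ : ∀ α, Measurable (φ α)) (hφ1 : ∀ α z, |φ α z| ≤ 1) (hy : Measurable y)
    (hy1 : ∀ z, y z = 1 ∨ y z = -1)
    {u₀ : ι → ℝ} (hu₀ : l1norm u₀ ≤ R) {δ : ℝ} (hδ0 : 0 < δ) (hδ1 : δ < 1) :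
    (samples ν m) {z | ∃ u, l1norm u ≤ R ∧
        3 * R * (Real.sqrt m * maximalConst (Fintype.card ι)) +
          R * Real.sqrt (8 * m * Real.log (1 / δ)) <
      ∑ i, ((∫ w, logisticLoss (score φ u w) (y w) ∂ν -
        logisticLoss (score φ u (z i)) (y (z i))) -
        (∫ w, logisticLoss (score φ u₀ w) (y w) ∂ν -
          logisticLoss (score φ u₀ (z i)) (y (z i))))} ≤ ENNReal.ofReal δ := by
  set s := 3 * R * (Real.sqrt m * maximalConst (Fintype.card ι)) +
    R * Real.sqrt (8 * m * Real.log (1 / δ))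
  set H : (ι → ℝ) → (Fin m → Z) → ℝ := fun u z =>
    ∑ i, ((∫ w, logisticLoss (score φ u w) (y w) ∂ν -
        logisticLoss (score φ u (z i)) (y (z i))) -
        (∫ w, logisticLoss (score φ u₀ w) (y w) ∂ν -
          logisticLoss (score φ u₀ (z i)) (y (z i)))) with hH
  have hHc : ∀ z, Continuous fun u => H u z := by
    intro z
    refine continuous_finsetSum _ fun i _ => (((continuous_integral_loss hφ hφ1 hy hy1).sub
      ?_).sub continuous_const)
    refine continuous_logisticLoss.comp (Continuous.prodMk ?_ continuous_const)
    exact continuous_finsetSum _ fun α _ => (continuous_apply α).mul continuous_const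
  let b : Type _ := {u : ι → ℝ // l1norm u ≤ R}
  have : Nonempty b := ⟨⟨u₀, hu₀⟩⟩
  -- A strict deviation at some `u` is an open condition on `u`, hence holds at a point of a dense
  -- sequence. The event is covered by an increasing union of events for finite families, each of
  -- probability at most `δ`.
  let q : ℕ → b := TopologicalSpace.denseSeq b
  have hq : DenseRange q := TopologicalSpace.denseRange_denseSeq b
  set E : ℕ → Set (Fin m → Z) := fun k => {z | s ≤ maxOver fun j : Fin (k + 1) => H (q j).1 z}
    with hE
  have hEmono : Monotone E := by
    intro k l hkl z hz
    simp only [hE, Set.mem_ofPred_eq] at hz ⊢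
    refine hz.trans (maxOver_le fun j => ?_)
    exact le_maxOver (fun j : Fin (l + 1) => H (q j).1 z) ⟨j, by omega⟩
  refine (measure_mono (t := ⋃ k, E k) ?_).trans ?_
  · rintro z ⟨u, hu, hz⟩
    have hopen : IsOpen {v : b | s < H v.1 z} :=
      isOpen_lt continuous_const ((hHc z).comp continuous_subtype_val)
    obtain ⟨k, hk⟩ := hq.exists_mem_open hopen ⟨⟨u, hu⟩, hz⟩
    refine Set.mem_iUnion.2 ⟨k, ?_⟩
    simp only [hE, Set.mem_ofPred_eq]
    exact le_trans (le_of_lt hk) (le_maxOver (fun j : Fin (k + 1) => H (q j).1 z) ⟨k, by omega⟩)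
  · rw [hEmono.measure_iUnion]
    refine iSup_le fun k => ?_
    exact measure_maxOver_deviation_le hm hR hφ hφ1 hy hy1 (u := fun j : Fin (k + 1) => (q j).1)
      (fun j => (q j).2) hu₀ hδ0 hδ1

end deviation

/-! ### Enumeration of the monomials along an `n`-ary heap -/

/-- The number of nodes of depth less than `d` in the complete `n`-ary tree. -/
def treeSize (n : ℕ) : ℕ → ℕ
  | 0 => 0
  | d + 1 => n * treeSize n d + 1

/-- The exponent vectors: node `k + 1` has parent `k / n`, and multiplies the monomial of its
parent by the variable with index `k % n`. -/
def expo (n : ℕ) : ℕ → ℕ → ℕ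
  | 0, _ => 0
  | k + 1, j => expo n (k / n) j + if j = k % n then 1 else 0
termination_by k _ => k
decreasing_by exact Nat.lt_succ_of_le (Nat.div_le_self k n)

lemma expo_zero (n j : ℕ) : expo n 0 j = 0 := by rw [expo]

lemma expo_succ (n k j : ℕ) : expo n (k + 1) j = expo n (k / n) j + if j = k % n then 1 else 0 := by
  rw [expo]

/-- The children of node `p` are the nodes `p n + 1, …, p n + n`; the root is `0`. -/
lemma expo_child {n j : ℕ} (hj : j < n) (p l : ℕ) :
    expo n (p * n + j + 1) l = expo n p l + if l = j then 1 else 0 := by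
  have hn : 0 < n := by omega
  rw [expo_succ, show p * n + j = j + p * n by ring, Nat.add_mul_div_right _ _ hn,
    Nat.add_mul_mod_self_right, Nat.div_eq_of_lt hj, Nat.mod_eq_of_lt hj, zero_add]

lemma sum_expo_le {n : ℕ} (hn : 1 ≤ n) (d : ℕ) {k : ℕ} (hk : k < treeSize n (d + 1)) :
    ∑ j : Fin n, expo n k j ≤ d := by
  induction d generalizing k with
  | zero =>
    simp only [treeSize, mul_zero, zero_add, Nat.lt_one_iff] at hk
    simp [hk, expo_zero]
  | succ d ih =>
    rcases k with _ | k
    · simp [expo_zero]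
    · simp_rw [expo_succ, Finset.sum_add_distrib]
      have h1 : k / n < treeSize n (d + 1) := by
        rw [Nat.div_lt_iff_lt_mul (by omega), mul_comm]
        rw [treeSize] at hk
        omega
      have h2 : ∑ j : Fin n, (if (j : ℕ) = k % n then 1 else 0) ≤ 1 := by
        have hlt : k % n < n := Nat.mod_lt _ (by omega)
        rw [Finset.sum_eq_single (⟨k % n, hlt⟩ : Fin n)]
        · simp
        · intro b _ hb
          rw [if_neg]
          intro h
          exact hb (Fin.ext h)
        · simp
      exact add_le_add (ih h1) h2

/-- If some exponent `α i` is positive, lowering it by one gives a monomial at some node `k` one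
level higher, and the `i`-th child of `k` carries `α`. -/
lemma exists_expo_eq {n : ℕ} (d : ℕ) (α : Fin n → ℕ) (hα : ∑ j, α j ≤ d) :
    ∃ k < treeSize n (d + 1), ∀ j : Fin n, expo n k j = α j := by
  induction d generalizing α with
  | zero =>
    refine ⟨0, by simp [treeSize], fun j => ?_⟩
    have := (Finset.single_le_sum (fun _ _ => Nat.zero_le _) (Finset.mem_univ j)).trans hα
    rw [expo_zero]
    omega
  | succ d ih =>
    by_cases h : ∀ j, α j = 0
    · exact ⟨0, by simp [treeSize], fun j => by rw [expo_zero, h j]⟩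
    push Not at h
    obtain ⟨i, hi⟩ := h
    have hsum : ∑ j, α j = ∑ j, (Function.update α i (α i - 1)) j + 1 := by
      rw [← Finset.add_sum_erase _ _ (Finset.mem_univ i),
        ← Finset.add_sum_erase _ (Function.update α i (α i - 1)) (Finset.mem_univ i)]
      have : ∑ x ∈ Finset.univ.erase i, Function.update α i (α i - 1) x =
          ∑ x ∈ Finset.univ.erase i, α x :=
        Finset.sum_congr rfl fun j hj => Function.update_of_ne (Finset.ne_of_mem_erase hj) _ _
      rw [this, Function.update_self]
      omega
    obtain ⟨k, hk, he⟩ := ih (Function.update α i (α i - 1)) (by omega)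
    refine ⟨k * n + i + 1, ?_, fun j => ?_⟩
    · rw [treeSize]
      have h1 : (k + 1) * n ≤ treeSize n (d + 1) * n := Nat.mul_le_mul_right _ hk
      have := i.2
      nlinarith
    · rw [expo_child i.2, he]
      by_cases hj : j = i
      · subst hj
        simp
        omega
      · rw [Function.update_of_ne hj, if_neg (fun h => hj (Fin.ext h)), add_zero]

lemma one_le_treeSize_succ (n d : ℕ) : 1 ≤ treeSize n (d + 1) := by
  rw [treeSize]; omega

lemma treeSize_one (d : ℕ) : treeSize 1 d = d := by
  induction d with
  | zero => rfl
  | succ d ih => rw [treeSize, ih, one_mul]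

lemma treeSize_succ_le_pow (n d : ℕ) : treeSize n (d + 1) ≤ (n + 1) ^ d := by
  induction d with
  | zero => simp [treeSize]
  | succ d ih =>
    rw [treeSize, pow_succ]
    have : 1 ≤ (n + 1) ^ d := Nat.one_le_pow _ _ (by omega)
    nlinarith [Nat.mul_le_mul_left n ih]

/-- The extra `1` on the left makes the induction close. The base `max n 2` covers `n = 1`, where
the size grows linearly in `d`. -/
lemma treeSize_succ_le_two_mul (n d : ℕ) : treeSize n (d + 1) + 1 ≤ 2 * max n 2 ^ d := by
  induction d with
  | zero => simp [treeSize]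
  | succ d ih =>
    rw [treeSize, pow_succ]
    have h1 : n * treeSize n (d + 1) ≤ max n 2 * treeSize n (d + 1) :=
      Nat.mul_le_mul_right _ (le_max_left n 2)
    have h2 : 2 ≤ max n 2 := le_max_right n 2
    nlinarith [Nat.mul_le_mul_left (max n 2) ih]

lemma card_mono_le (n D : ℕ) : Fintype.card (Mono n D) ≤ treeSize n (D + 1) := by
  have h : ∀ α : Mono n D, ∃ k : Fin (treeSize n (D + 1)), ∀ j : Fin n, expo n k j = α.1 j := by
    intro α
    obtain ⟨k, hk, he⟩ := exists_expo_eq D (fun j => (α.1 j : ℕ)) α.2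
    exact ⟨⟨k, hk⟩, he⟩
  choose f hf using h
  have hinj : Function.Injective f := by
    intro α β hαβ
    apply Subtype.ext
    funext j
    apply Fin.ext
    rw [← hf α j, ← hf β j, hαβ]
  simpa using Fintype.card_le_of_injective f hinj

instance (n D : ℕ) : Nonempty (Mono n D) := ⟨toMono (fun _ => 0) (by simp)⟩

/-- The constants are tight: equality holds at `n = 1`, `D = 2`, and at `n = D = 1` the inequality
fails. -/
lemma four_mul_treeSize_le {n D : ℕ} (hn : 1 ≤ n) (hD : 1 ≤ D) (h : ¬(n = 1 ∧ D = 1)) :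
    4 * treeSize n (D + 1) ≤ 3 * (2 * n) ^ D := by
  rcases hn.eq_or_lt with rfl | hn
  · rw [treeSize_one]
    have hD2 : 2 ≤ D := by omega
    clear h hD
    induction D, hD2 using Nat.le_induction with
    | base => norm_num
    | succ D hD ih =>
      rw [pow_succ]
      omega
  · clear h
    refine (Nat.mul_le_mul_left 4 (treeSize_succ_le_pow n D)).trans ?_
    obtain ⟨D, rfl⟩ : ∃ k, D = k + 1 := ⟨D - 1, by omega⟩
    rw [pow_succ, pow_succ]
    have h1 : (n + 1) ^ D ≤ (2 * n) ^ D := Nat.pow_le_pow_left (by omega) D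
    have h2 : 4 * (n + 1) ≤ 3 * (2 * n) := by omega
    calc 4 * ((n + 1) ^ D * (n + 1)) = (n + 1) ^ D * (4 * (n + 1)) := by ring
      _ ≤ (2 * n) ^ D * (3 * (2 * n)) := Nat.mul_le_mul h1 h2
      _ = _ := by ring

/-- Outside `n = D = 1`, let `a = D log (2 n) ≥ 2 log 2`. Then `log (2 N) ≤ log (3/2) + a ≤ (4/3)
a`, so the constant is at most `1.16 r` with `r = √(2 a) ≥ 1`, and `3.48 r + 1/4 ≤ 4 r`. For `n = D
= 1` there are at most two monomials, and the bound `√(17 N / 16)` is used. The summand `1 / 4` pays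
for the error of an approximate solver. -/
lemma maximalConst_le {n D : ℕ} (hn : 1 ≤ n) (hD : 1 ≤ D) :
    3 * maximalConst (Fintype.card (Mono n D)) + 1 / 4 ≤
      4 * Real.sqrt (2 * D * Real.log (2 * n)) := by
  set N := Fintype.card (Mono n D) with hN
  have hNt : N ≤ treeSize n (D + 1) := card_mono_le n D
  have hN1 : 1 ≤ N := Fintype.card_pos
  have hl2 := Real.log_two_gt_d9
  by_cases h : n = 1 ∧ D = 1
  · obtain ⟨rfl, rfl⟩ := h
    rw [treeSize_one] at hNt
    have hN2 : (N : ℝ) ≤ 2 := by exact_mod_cast hNt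
    have h1 : maximalConst N ≤ 146 / 100 := by
      refine (min_le_right _ _).trans ?_
      rw [Real.sqrt_le_left (by norm_num)]
      linarith
    have h2 : (117 / 100 : ℝ) ≤ Real.sqrt (2 * (1 : ℕ) * Real.log (2 * (1 : ℕ))) := by
      refine Real.le_sqrt_of_sq_le ?_
      norm_num
      linarith
    linarith
  · have h4 := four_mul_treeSize_le hn hD h
    have h5 : (2 * N : ℝ) ≤ 3 / 2 * (2 * n) ^ D := by
      have : (4 * N : ℝ) ≤ 3 * (2 * n) ^ D := by
        exact_mod_cast (Nat.mul_le_mul_left 4 hNt).trans h4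
      linarith
    have hn' : (1 : ℝ) ≤ n := by exact_mod_cast hn
    have hN' : (1 : ℝ) ≤ N := by exact_mod_cast hN1
    have hD' : (1 : ℝ) ≤ D := by exact_mod_cast hD
    set a := D * Real.log (2 * n) with ha
    have ha2 : 2 * Real.log 2 ≤ a := by
      have hlog : Real.log 2 ≤ Real.log (2 * n) := Real.log_le_log (by norm_num) (by linarith)
      rcases hn.eq_or_lt with rfl | hn2
      · have hD2 : 2 ≤ D := by omega
        have hD2' : (2 : ℝ) ≤ D := by exact_mod_cast hD2
        rw [ha]
        exact mul_le_mul hD2' hlog (by linarith) (by linarith)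
      · have hn2' : (2 : ℝ) ≤ n := by exact_mod_cast hn2
        have : 2 * Real.log 2 ≤ Real.log (2 * n) := by
          have h6 : 2 * Real.log 2 = Real.log 4 := by
            rw [show (4 : ℝ) = 2 ^ 2 by norm_num, Real.log_pow]; norm_num
          rw [h6]
          exact Real.log_le_log (by norm_num) (by linarith)
        rw [ha]
        nlinarith
    have h6 : Real.log (2 * N) ≤ 4 / 3 * a := by
      have h7 : Real.log (2 * N) ≤ Real.log (3 / 2) + a := by
        refine (Real.log_le_log (by linarith) h5).trans (le_of_eq ?_)
        rw [Real.log_mul (by norm_num) (by positivity), Real.log_pow]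
      have h8 : 3 * Real.log (3 / 2) ≤ 2 * Real.log 2 := by
        have e1 : 3 * Real.log (3 / 2) = Real.log ((3 / 2) ^ 3) := by rw [Real.log_pow]; norm_num
        have e2 : 2 * Real.log 2 = Real.log (2 ^ 2) := by rw [Real.log_pow]; norm_num
        rw [e1, e2]
        exact Real.log_le_log (by norm_num) (by norm_num)
      linarith
    set r := Real.sqrt (2 * a) with hr
    have hr2 : r ^ 2 = 2 * a := Real.sq_sqrt (by linarith)
    have hr0 : 0 ≤ r := Real.sqrt_nonneg _
    have hr1 : 1 ≤ r := Real.le_sqrt_of_sq_le (by linarith)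
    have h9 : maximalConst N ≤ 116 / 100 * r := by
      refine (min_le_left _ _).trans ?_
      rw [Real.sqrt_le_left (by positivity), mul_pow, hr2]
      linarith
    rw [mul_assoc, ← ha, ← hr]
    linarith

/-! ### Generalization bound for approximate solutions -/

/-- The nearest point of the cube `[-1, 1]ⁿ`. -/
def clampCube {n : ℕ} (x : Fin n → ℝ) : Fin n → ℝ := fun k => max (-1) (min 1 (x k))

lemma abs_clampCube_le {n : ℕ} (x : Fin n → ℝ) (k : Fin n) : |clampCube x k| ≤ 1 := by
  rw [abs_le]
  exact ⟨le_max_left _ _, max_le (by norm_num) (min_le_left _ _)⟩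

lemma clampCube_eq {n : ℕ} {x : Fin n → ℝ} (hx : ∀ k, |x k| ≤ 1) : clampCube x = x := by
  funext k
  have h := abs_le.1 (hx k)
  rw [clampCube, min_eq_right h.2, max_eq_right h.1]

lemma measurable_clampCube {n : ℕ} : Measurable (clampCube (n := n)) := by
  rw [measurable_pi_iff]
  intro k
  exact measurable_const.max (measurable_const.min (measurable_pi_apply k))

/-- The label rounded to `±1`. -/
noncomputable def roundLabel (y : ℝ) : ℝ := if y = 1 then 1 else -1

lemma roundLabel_eq {y : ℝ} (hy : y = 1 ∨ y = -1) : roundLabel y = y := by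
  rcases hy with rfl | rfl
  · simp [roundLabel]
  · rw [roundLabel, if_neg (by norm_num)]

lemma roundLabel_mem (y : ℝ) : roundLabel y = 1 ∨ roundLabel y = -1 := by
  unfold roundLabel; split_ifs <;> simp

lemma measurable_roundLabel : Measurable roundLabel :=
  Measurable.ite (measurableSet_singleton 1) measurable_const measurable_const

lemma measurable_monoFeature {n D : ℕ} (α : Mono n D) :
    Measurable fun x : Fin n → ℝ => monoFeature n D x α :=
  Finset.measurable_prod _ fun i _ => (measurable_pi_apply i).pow_const _

lemma eq_zero_of_l1norm_le {ι : Type*} [Fintype ι] {u : ι → ℝ} (hu : l1norm u ≤ 0) : u = 0 := by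
  funext i
  have h : |u i| ≤ l1norm u :=
    Finset.single_le_sum (f := fun i => |u i|) (fun _ _ => abs_nonneg _) (Finset.mem_univ i)
  exact abs_eq_zero.1 (le_antisymm (h.trans hu) (abs_nonneg _))

/-- Exact solutions and outputs of the program are covered together: the vector only has to compete
with the single `u₀`, up to `R / (4 m)`. The bias of `u₀` is not yet involved. -/
lemma measure_exists_excess_le {n D m : ℕ} (hn : 1 ≤ n) (hD : 1 ≤ D) (hm : 1 ≤ m)
    {Ω Ω' : Type*} [MeasurableSpace Ω] [MeasurableSpace Ω'] {μ : Measure Ω}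
    [IsProbabilityMeasure μ] {P : Measure Ω'} [IsProbabilityMeasure P]
    {X : Ω → Fin n → ℝ} {Y : Ω → ℝ} (hX : Measurable X) (hY : Measurable Y)
    (hY1 : ∀ᵐ ω ∂μ, Y ω = 1 ∨ Y ω = -1) (hX1 : ∀ᵐ ω ∂μ, ∀ k, |X ω k| ≤ 1)
    {S : Fin m → Ω' → (Fin n → ℝ) × ℝ} (hS : iIndepFun S P)
    (hid : ∀ i, IdentDistrib (S i) (fun ω => (X ω, Y ω)) P μ)
    {R δ : ℝ} (hδ0 : 0 < δ) (hδ1 : δ < 1)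
    {u₀ : Mono n D → ℝ} (hu₀ : l1norm u₀ ≤ R) :
    P {ω' | (∀ i, (∀ k, |(S i ω').1 k| ≤ 1) ∧ ((S i ω').2 = 1 ∨ (S i ω').2 = -1)) ∧
      ∃ u : Mono n D → ℝ, l1norm u ≤ R ∧
        empLoss (fun i => (S i ω').1) (fun i => (S i ω').2) u ≤
          empLoss (fun i => (S i ω').1) (fun i => (S i ω').2) u₀ + R / (4 * m) ∧
        4 * R * Real.sqrt (2 * D * Real.log (2 * n) / m) +
            2 * R * Real.sqrt (2 * Real.log (2 / δ) / m) <
          (∫ ω, logisticLoss (predict u (X ω)) (Y ω) ∂μ) -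
            ∫ ω, logisticLoss (predict u₀ (X ω)) (Y ω) ∂μ} ≤ ENNReal.ofReal δ := by
  have hR0 : 0 ≤ R := (l1norm_nonneg _).trans hu₀
  rcases hR0.eq_or_lt with rfl | hR
  · refine (measure_mono (t := ∅) ?_).trans (by simp)
    rintro ω' ⟨-, u, hu, -, h⟩
    rw [eq_zero_of_l1norm_le hu, eq_zero_of_l1norm_le hu₀] at h
    simp at h
  -- Clamping the points and rounding the labels makes the bounds hold everywhere rather than almost
  -- surely. On good samples nothing changes.
  set φ : Mono n D → (Fin n → ℝ) × ℝ → ℝ := fun α z => monoFeature n D (clampCube z.1) α with hφ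
  set y : (Fin n → ℝ) × ℝ → ℝ := fun z => roundLabel z.2 with hy
  have hφm : ∀ α, Measurable (φ α) := fun α =>
    (measurable_monoFeature α).comp (measurable_clampCube.comp measurable_fst)
  have hφ1 : ∀ α z, |φ α z| ≤ 1 := fun α z => abs_monoFeature_le_one (abs_clampCube_le z.1) α
  have hym : Measurable y := measurable_roundLabel.comp measurable_snd
  have hy1 : ∀ z, y z = 1 ∨ y z = -1 := fun z => roundLabel_mem z.2
  have hXY : Measurable fun ω => (X ω, Y ω) := hX.prodMk hY
  set ν := μ.map fun ω => (X ω, Y ω) with hν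
  have : IsProbabilityMeasure ν := Measure.isProbabilityMeasure_map hXY.aemeasurable
  have hscore : ∀ (u : Mono n D → ℝ) (z : (Fin n → ℝ) × ℝ), (∀ k, |z.1 k| ≤ 1) →
      score φ u z = predict u z.1 := by
    intro u z hz
    simp only [score, hφ, clampCube_eq hz, predict]
  have hint : ∀ u : Mono n D → ℝ, ∫ z, logisticLoss (score φ u z) (y z) ∂ν =
      ∫ ω, logisticLoss (predict u (X ω)) (Y ω) ∂μ := by
    intro u
    rw [hν, integral_map hXY.aemeasurable
      (measurable_logisticLoss (measurable_score hφm u) hym).aestronglyMeasurable]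
    refine integral_congr_ae ?_
    filter_upwards [hY1, hX1] with ω h1 h2
    simp only [hscore u (X ω, Y ω) h2, hy, roundLabel_eq h1]
  have hlaw : P.map (fun ω' i => S i ω') = samples ν m := by
    have h := hS.map_fun_eq_pi_map fun i => (hid i).aemeasurable_fst
    rw [h]
    simp_rw [(hid _).map_eq]
    rfl
  have hSm : AEMeasurable (fun ω' i => S i ω') P :=
    aemeasurable_pi_lambda _ fun i => (hid i).aemeasurable_fst
  have hdev := measure_exists_deviation_le (ν := ν) hm hR hφm hφ1 hym hy1 hu₀ hδ0 hδ1
  rw [← hlaw] at hdev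
  -- Only the outer-measure inequality for the pushforward is used, so the event need not be
  -- measurable.
  refine le_trans ((measure_mono ?_).trans (Measure.le_map_apply hSm _)) hdev
  rintro ω' ⟨hgood, u, hu, hemp, hexc⟩
  refine ⟨u, hu, ?_⟩
  simp_rw [hint]
  have hloss : ∀ (u : Mono n D → ℝ) (i : Fin m),
      logisticLoss (score φ u (S i ω')) (y (S i ω')) =
        logisticLoss (predict u (S i ω').1) (S i ω').2 := by
    intro u i
    rw [hscore u _ (hgood i).1, hy]
    simp only [roundLabel_eq (hgood i).2]
  simp_rw [hloss]
  set A := ∫ ω, logisticLoss (predict u (X ω)) (Y ω) ∂μ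
  set B := ∫ ω, logisticLoss (predict u₀ (X ω)) (Y ω) ∂μ
  have hm0 : (0 : ℝ) < m := by exact_mod_cast hm
  simp only [empLoss] at hemp
  set a := ∑ i, logisticLoss (predict u (S i ω').1) (S i ω').2 with ha
  set b := ∑ i, logisticLoss (predict u₀ (S i ω').1) (S i ω').2 with hb
  have hsum : ∑ i, (A - logisticLoss (predict u (S i ω').1) (S i ω').2 -
      (B - logisticLoss (predict u₀ (S i ω').1) (S i ω').2)) = m * (A - B) - (a - b) := by
    simp only [Finset.sum_sub_distrib, Finset.sum_const, Finset.card_univ, Fintype.card_fin,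
      nsmul_eq_mul, ← ha, ← hb]
    ring
  rw [hsum]
  have hab : a - b ≤ R / 4 := by
    have h1 : a / m ≤ (b + R / 4) / m := by
      refine hemp.trans (le_of_eq ?_)
      field_simp
    have := (div_le_div_iff_of_pos_right hm0).1 h1
    linarith
  have hK := maximalConst_le hn hD (n := n) (D := D)
  set K := maximalConst (Fintype.card (Mono n D))
  have hs1 : (1 : ℝ) ≤ Real.sqrt m := Real.one_le_sqrt.2 (by exact_mod_cast hm)
  have hmm : (m : ℝ) = Real.sqrt m * Real.sqrt m := (Real.mul_self_sqrt hm0.le).symm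
  have hdiv : ∀ t : ℝ, m * Real.sqrt (t / m) = Real.sqrt m * Real.sqrt t := by
    intro t
    rw [Real.sqrt_div' _ hm0.le]
    have h0 : Real.sqrt m ≠ 0 := by positivity
    field_simp
    rw [Real.sq_sqrt hm0.le, mul_comm]
  have hmul := mul_lt_mul_of_pos_left hexc hm0
  have e1 : (m : ℝ) * (4 * R * Real.sqrt (2 * D * Real.log (2 * n) / m) +
      2 * R * Real.sqrt (2 * Real.log (2 / δ) / m)) =
      R * (Real.sqrt m * (4 * Real.sqrt (2 * D * Real.log (2 * n)))) +
      2 * R * (Real.sqrt m * Real.sqrt (2 * Real.log (2 / δ))) := by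
    rw [← hdiv (2 * Real.log (2 / δ)), mul_left_comm (Real.sqrt m) 4, ← hdiv]
    ring
  rw [e1] at hmul
  have hlog : Real.log (1 / δ) ≤ Real.log (2 / δ) :=
    Real.log_le_log (by positivity) (by gcongr; norm_num)
  have e2 : Real.sqrt (8 * m * Real.log (1 / δ)) ≤
      2 * (Real.sqrt m * Real.sqrt (2 * Real.log (2 / δ))) := by
    rw [← Real.sqrt_mul hm0.le]
    refine Real.sqrt_le_iff.2 ⟨by positivity, ?_⟩
    have hl0 : 0 ≤ Real.log (2 / δ) := Real.log_nonneg (by rw [le_div_iff₀ hδ0]; linarith)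
    rw [mul_pow, Real.sq_sqrt (by positivity)]
    nlinarith
  have e3 : Real.sqrt m * (3 * K + 1 / 4) ≤
      Real.sqrt m * (4 * Real.sqrt (2 * D * Real.log (2 * n))) := by gcongr
  have e4 := mul_le_mul_of_nonneg_left e3 hR.le
  have e5 := mul_le_mul_of_nonneg_left e2 hR.le
  -- Since `√m ≥ 1`, the total tolerance `R / 4` is absorbed by the summand `1 / 4` of
  -- `maximalConst_le`, which is multiplied by `R √m`.
  have e6 : R * (1 / 4) ≤ R * (Real.sqrt m * (1 / 4)) := by
    refine mul_le_mul_of_nonneg_left ?_ hR.le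
    linarith
  nlinarith

/-! ### Exponentiated gradient descent for logistic regression on the `ℓ¹` ball -/

namespace Hedge

/-- The weight of feature `k`, for the cumulative gradient `S` and the inverse step size `a`. -/
noncomputable def weight (a : ℝ) (S : ℕ → ℝ) (k : ℕ) : ℝ := Real.exp (-(S k / a))

/-- The normalization. -/
noncomputable def total (M : ℕ) (a : ℝ) (S : ℕ → ℝ) : ℝ :=
  ∑ k ∈ Finset.range M, (weight a S k + 1 / weight a S k)

/-- The coefficient of feature `k`. -/
noncomputable def coef (M : ℕ) (a R : ℝ) (S : ℕ → ℝ) (k : ℕ) : ℝ :=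
  R * (weight a S k - 1 / weight a S k) / total M a S

/-- The derivative of the logistic loss in the margin. -/
noncomputable def slope (v y : ℝ) : ℝ := -(2 * y) / (1 + Real.exp (2 * v * y))

/-- The prediction on a sample point with features `φ`. -/
noncomputable def margin (M : ℕ) (φ : ℕ → ℝ) (c : ℕ → ℝ) : ℝ :=
  ∑ k ∈ Finset.range M, c k * φ k

/-- The gradient of the total loss on the sample. -/
noncomputable def grad (M m : ℕ) (Φ : ℕ → ℕ → ℝ) (y : ℕ → ℝ) (c : ℕ → ℝ) (k : ℕ) : ℝ :=
  ∑ i ∈ Finset.range m, slope (margin M (Φ i) c) (y i) * Φ i k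

/-- The cumulative gradient after `t` rounds. -/
noncomputable def cumGrad (M m : ℕ) (a R : ℝ) (Φ : ℕ → ℕ → ℝ) (y : ℕ → ℝ) : ℕ → ℕ → ℝ
  | 0 => 0
  | t + 1 => fun k => cumGrad M m a R Φ y t k +
      grad M m Φ y (coef M a R (cumGrad M m a R Φ y t)) k

/-- The average of the coefficients of `T` rounds, the `t`-th of them weighted by `1 / T`. -/
noncomputable def average (M m T : ℕ) (a R : ℝ) (Φ : ℕ → ℕ → ℝ) (y : ℕ → ℝ) (k : ℕ) : ℝ :=
  ∑ t ∈ Finset.range T, coef M a R (cumGrad M m a R Φ y t) k / T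

lemma slope_eq {v y : ℝ} (hy : y = 1 ∨ y = -1) : slope v y = -(y - Real.tanh v) := by
  have hv := Real.exp_pos v
  have hv' := Real.exp_pos (-v)
  have e2 : Real.exp (2 * v) = Real.exp v / Real.exp (-v) := by
    rw [← Real.exp_sub]; ring_nf
  have e2' : Real.exp (-(2 * v)) = Real.exp (-v) / Real.exp v := by
    rw [← Real.exp_sub]; ring_nf
  rw [slope, Real.tanh_eq_sinh_div_cosh, Real.sinh_eq, Real.cosh_eq]
  rcases hy with rfl | rfl
  · rw [mul_one, mul_one, e2]; field_simp; ring
  · simp only [mul_neg_one, e2']; field_simp; ring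

lemma abs_slope_le {v y : ℝ} (hy : y = 1 ∨ y = -1) : |slope v y| ≤ 2 := by
  have hy2 : |y| = 1 := by rcases hy with rfl | rfl <;> simp
  have he := Real.exp_pos (2 * v * y)
  rw [slope, abs_div, abs_neg, abs_mul, hy2, abs_of_pos (by linarith : 0 < 1 + Real.exp (2 * v * y)), div_le_iff₀ (by linarith)]
  norm_num
  linarith

lemma logisticLoss_sub_le {v w y : ℝ} (hy : y = 1 ∨ y = -1) :
    logisticLoss v y - logisticLoss w y ≤ slope v y * (v - w) := by
  have := logisticLoss_tangent hy v w
  rw [slope_eq hy]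
  linarith

lemma weight_pos (a : ℝ) (S : ℕ → ℝ) (k : ℕ) : 0 < weight a S k := Real.exp_pos _

lemma total_pos {M : ℕ} (hM : 1 ≤ M) (a : ℝ) (S : ℕ → ℝ) : 0 < total M a S :=
  Finset.sum_pos (fun k _ => by have := weight_pos a S k; positivity)
    (Finset.nonempty_range_iff.2 (by omega))

lemma sum_abs_coef_le {M : ℕ} (hM : 1 ≤ M) (a : ℝ) {R : ℝ} (hR : 0 ≤ R) (S : ℕ → ℝ) :
    ∑ k ∈ Finset.range M, |coef M a R S k| ≤ R := by
  have hZ := total_pos hM a S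
  calc ∑ k ∈ Finset.range M, |coef M a R S k|
      ≤ ∑ k ∈ Finset.range M, R * (weight a S k + 1 / weight a S k) / total M a S := by
        refine Finset.sum_le_sum fun k _ => ?_
        have hw := weight_pos a S k
        have hw' : 0 < 1 / weight a S k := by positivity
        rw [coef, abs_div, abs_mul, abs_of_nonneg hR, abs_of_pos hZ]
        gcongr
        rw [abs_le]
        constructor <;> linarith
    _ = R := by
        rw [← Finset.sum_div, ← Finset.mul_sum, ← total, mul_div_assoc, div_self hZ.ne', mul_one]

lemma abs_margin_le {M : ℕ} {φ c : ℕ → ℝ} (hφ : ∀ k < M, |φ k| ≤ 1) :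
    |margin M φ c| ≤ ∑ k ∈ Finset.range M, |c k| := by
  refine (Finset.abs_sum_le_sum_abs _ _).trans (Finset.sum_le_sum fun k hk => ?_)
  rw [abs_mul]
  exact mul_le_of_le_one_right (abs_nonneg _) (hφ k (Finset.mem_range.1 hk))

/-! ### Potential argument and regret bound -/

section Regret

variable {M m : ℕ} {Φ : ℕ → ℕ → ℝ} {y : ℕ → ℝ}

lemma abs_grad_le (hΦ : ∀ i < m, ∀ k < M, |Φ i k| ≤ 1) (hy : ∀ i < m, y i = 1 ∨ y i = -1)
    (c : ℕ → ℝ) {k : ℕ} (hk : k < M) : |grad M m Φ y c k| ≤ 2 * m := by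
  calc |grad M m Φ y c k| ≤ ∑ i ∈ Finset.range m, (2 : ℝ) := by
        refine (Finset.abs_sum_le_sum_abs _ _).trans (Finset.sum_le_sum fun i hi => ?_)
        have hi := Finset.mem_range.1 hi
        rw [abs_mul]
        have h1 := abs_slope_le (v := margin M (Φ i) c) (hy i hi)
        have h2 := hΦ i hi k hk
        nlinarith [abs_nonneg (slope (margin M (Φ i) c) (y i)), abs_nonneg (Φ i k)]
    _ = 2 * m := by simp [mul_comm]

lemma exp_le_of_abs_le_one {x : ℝ} (hx : |x| ≤ 1) : Real.exp x ≤ 1 + x + x ^ 2 := by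
  have := (abs_le.1 (Real.abs_exp_sub_one_sub_id_le hx)).2
  linarith

/-- Each weight is multiplied by `exp (∓G / a)` with `|G / a| ≤ 2 m / (8 τ m) = 1 / (4 τ)`. By `exp
x ≤ 1 + x + x²`, the second-order terms contribute at most `1 / (16 τ²)`, and the first-order terms
give the pairing of the gradient with the normalized signed weights. -/
lemma total_step {a τ : ℝ} (hτ : 1 ≤ τ) (hm : 1 ≤ m) (hM : 1 ≤ M) (ha : a = 8 * τ * m)
    (S G : ℕ → ℝ) (hG : ∀ k < M, |G k| ≤ 2 * m) :
    total M a (fun k => S k + G k) ≤ total M a S *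
      Real.exp (1 / (16 * τ ^ 2) - (∑ k ∈ Finset.range M, coef M a 1 S k * G k) / a) := by
  have hm0 : (0 : ℝ) < m := by exact_mod_cast hm
  have ha0 : 0 < a := by rw [ha]; positivity
  have hZ := total_pos hM a S
  have hstep : total M a (fun k => S k + G k) ≤ ∑ k ∈ Finset.range M,
      ((weight a S k + 1 / weight a S k) * (1 + 1 / (16 * τ ^ 2)) -
        (weight a S k - 1 / weight a S k) * G k / a) := by
    refine Finset.sum_le_sum fun k hk => ?_
    have hw := weight_pos a S k
    have hg : |G k / a| ≤ 1 / (4 * τ) := by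
      rw [abs_div, abs_of_pos ha0, div_le_div_iff₀ ha0 (by positivity), ha]
      have := hG k (Finset.mem_range.1 hk)
      nlinarith
    have hg1 : |G k / a| ≤ 1 := hg.trans (by rw [div_le_one (by positivity)]; linarith)
    have hg2 : (G k / a) ^ 2 ≤ 1 / (16 * τ ^ 2) := by
      rw [← sq_abs]
      calc |G k / a| ^ 2 ≤ (1 / (4 * τ)) ^ 2 := by gcongr
        _ = 1 / (16 * τ ^ 2) := by rw [div_pow]; ring
    have h1 := exp_le_of_abs_le_one (x := -(G k / a)) (by rwa [abs_neg])
    have h2 := exp_le_of_abs_le_one hg1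
    have e1 : weight a (fun k => S k + G k) k = weight a S k * Real.exp (-(G k / a)) := by
      rw [weight, weight, ← Real.exp_add]; congr 1; ring
    have e2 : 1 / weight a (fun k => S k + G k) k = 1 / weight a S k * Real.exp (G k / a) := by
      rw [e1, Real.exp_neg]; field_simp
    rw [e2, e1]
    have hw' : 0 < 1 / weight a S k := by positivity
    rw [mul_div_assoc]
    generalize 1 / weight a S k = v at *
    generalize weight a S k = u at *
    nlinarith [mul_le_mul_of_nonneg_left h1 hw.le, mul_le_mul_of_nonneg_left h2 hw'.le,
      mul_le_mul_of_nonneg_left hg2 hw.le, mul_le_mul_of_nonneg_left hg2 hw'.le]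
  refine hstep.trans ?_
  have hcoef : ∑ k ∈ Finset.range M, (weight a S k - 1 / weight a S k) * G k / a =
      total M a S * ((∑ k ∈ Finset.range M, coef M a 1 S k * G k) / a) := by
    rw [Finset.sum_div, Finset.mul_sum]
    refine Finset.sum_congr rfl fun k _ => ?_
    rw [coef]
    field_simp
  rw [Finset.sum_sub_distrib, ← Finset.sum_mul, hcoef, ← total, ← mul_sub]
  refine mul_le_mul_of_nonneg_left ?_ hZ.le
  have := Real.add_one_le_exp
    (1 / (16 * τ ^ 2) - (∑ k ∈ Finset.range M, coef M a 1 S k * G k) / a)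
  linarith

/-- This lets `M` stand in for the usual `log (2 M)`, so that the number of rounds is an arithmetic
expression in `τ` and `M`. The loss is affordable, as the time need only be polynomial in `M`. -/
lemma two_mul_le_exp (M : ℕ) : 2 * (M : ℝ) ≤ Real.exp M := by
  have h1 := Real.add_one_le_exp ((M : ℝ) - 1)
  have h2 := Real.add_one_le_exp (1 : ℝ)
  have h3 : Real.exp M = Real.exp 1 * Real.exp (M - 1) := by rw [← Real.exp_add]; ring_nf
  rw [h3]
  have h4 : (0 : ℝ) ≤ M := Nat.cast_nonneg M
  nlinarith [Real.exp_pos ((M : ℝ) - 1)]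

lemma coef_eq_mul (M : ℕ) (a R : ℝ) (S : ℕ → ℝ) (k : ℕ) :
    coef M a R S k = R * coef M a 1 S k := by
  rw [coef, coef]; ring

/-- The potential starts at `2 M ≤ exp M` and is multiplied in each round as in `total_step`. At the
end it is at least `exp (|S k| / a)`. In the logarithm, the start and the `T = 16 τ² M` second-order
terms contribute `M` each. -/
lemma abs_cumGrad_le {τ : ℕ} {a R : ℝ} (hτ : 1 ≤ τ) (hm : 1 ≤ m) (hM : 1 ≤ M)
    (ha : a = 8 * τ * m)
    (hΦ : ∀ i < m, ∀ k < M, |Φ i k| ≤ 1) (hy : ∀ i < m, y i = 1 ∨ y i = -1)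
    (T : ℕ) (hT : T = 16 * τ ^ 2 * M) {k : ℕ} (hk : k < M) :
    |cumGrad M m a R Φ y T k| + ∑ t ∈ Finset.range T, ∑ l ∈ Finset.range M,
      coef M a 1 (cumGrad M m a R Φ y t) l *
        grad M m Φ y (coef M a R (cumGrad M m a R Φ y t)) l ≤ 2 * M * a := by
  have hm0 : (0 : ℝ) < m := by exact_mod_cast hm
  have hτ1 : (1 : ℝ) ≤ τ := by exact_mod_cast hτ
  have ha0 : 0 < a := by rw [ha]; positivity
  set S := cumGrad M m a R Φ y with hS
  set q : ℕ → ℝ := fun t => ∑ l ∈ Finset.range M, coef M a 1 (S t) l *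
    grad M m Φ y (coef M a R (S t)) l with hq
  have key : ∀ t, total M a (S t) ≤ Real.exp M *
      Real.exp (t * (1 / (16 * (τ : ℝ) ^ 2)) - (∑ s ∈ Finset.range t, q s) / a) := by
    intro t
    induction t with
    | zero =>
      have h0 : total M a (S 0) = 2 * M := by
        simp only [total, weight, hS, cumGrad]
        norm_num [mul_comm]
      rw [h0]
      simpa using two_mul_le_exp M
    | succ t ih =>
      have h1 := total_step hτ1 hm hM ha (S t) (grad M m Φ y (coef M a R (S t)))
        fun k hk => abs_grad_le hΦ hy _ hk
      refine (h1.trans (mul_le_mul_of_nonneg_right ih (Real.exp_pos _).le)).trans (le_of_eq ?_)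
      rw [mul_assoc, ← Real.exp_add, Finset.sum_range_succ]
      congr 2
      push_cast
      rw [add_div]
      ring
  have hlow : Real.exp (|S T k| / a) ≤ total M a (S T) := by
    have hw := weight_pos a (S T) k
    have h1 : weight a (S T) k + 1 / weight a (S T) k ≤ total M a (S T) :=
      Finset.single_le_sum (f := fun k => weight a (S T) k + 1 / weight a (S T) k)
        (fun l _ => by have := weight_pos a (S T) l; positivity) (Finset.mem_range.2 hk)
    refine le_trans ?_ h1
    have e1 : 1 / weight a (S T) k = Real.exp (S T k / a) := by
      rw [weight, Real.exp_neg]; field_simp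
    rw [e1, weight]
    rcases abs_cases (S T k) with h | h
    · rw [h.1]; linarith [Real.exp_pos (-(S T k / a))]
    · rw [h.1, neg_div]; linarith [Real.exp_pos (S T k / a)]
  have h := hlow.trans (key T)
  rw [← Real.exp_add, Real.exp_le_exp] at h
  have hTM : (T : ℝ) * (1 / (16 * (τ : ℝ) ^ 2)) = M := by
    rw [hT]; push_cast; field_simp
  rw [hTM] at h
  have h2 : (|S T k| + ∑ s ∈ Finset.range T, q s) / a ≤ 2 * M := by
    rw [add_div]; linarith
  rwa [div_le_iff₀ ha0] at h2

/-- The average iterate minimizes the total loss up to `m R / τ`. -/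
theorem sum_logisticLoss_average_le {τ : ℕ} {a R : ℝ} (hτ : 1 ≤ τ) (hm : 1 ≤ m) (hM : 1 ≤ M)
    (ha : a = 8 * τ * m)
    (hΦ : ∀ i < m, ∀ k < M, |Φ i k| ≤ 1) (hy : ∀ i < m, y i = 1 ∨ y i = -1)
    (T : ℕ) (hT : T = 16 * τ ^ 2 * M) (c : ℕ → ℝ) (hc : ∑ k ∈ Finset.range M, |c k| ≤ R) :
    ∑ i ∈ Finset.range m, logisticLoss (margin M (Φ i) (average M m T a R Φ y)) (y i) ≤
      ∑ i ∈ Finset.range m, logisticLoss (margin M (Φ i) c) (y i) + m * (R / τ) := by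
  have hm0 : (0 : ℝ) < m := by exact_mod_cast hm
  have hτ0 : (0 : ℝ) < τ := by exact_mod_cast hτ
  have hM0 : (0 : ℝ) < M := by exact_mod_cast hM
  have hT0 : (0 : ℝ) < T := by rw [hT]; push_cast; positivity
  set S := cumGrad M m a R Φ y with hS
  set u : ℕ → ℕ → ℝ := fun t => coef M a R (S t) with hu
  set G : ℕ → ℕ → ℝ := fun t => grad M m Φ y (u t) with hG
  have hmargin : ∀ i, margin M (Φ i) (average M m T a R Φ y) =
      (∑ t ∈ Finset.range T, margin M (Φ i) (u t)) / T := by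
    intro i
    simp only [margin, average, Finset.sum_div, Finset.sum_mul]
    rw [Finset.sum_comm]
    refine Finset.sum_congr rfl fun t _ => Finset.sum_congr rfl fun k _ => ?_
    ring
  -- The tangent inequality is applied at the average margin, where the linear terms sum to zero.
  have hjensen : ∀ i < m, T * logisticLoss (margin M (Φ i) (average M m T a R Φ y)) (y i) ≤
      ∑ t ∈ Finset.range T, logisticLoss (margin M (Φ i) (u t)) (y i) := by
    intro i hi
    set v := margin M (Φ i) (average M m T a R Φ y) with hv
    have h1 := Finset.sum_le_sum fun t (_ : t ∈ Finset.range T) =>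
      logisticLoss_sub_le (v := v) (w := margin M (Φ i) (u t)) (hy i hi)
    have h2 : ∑ t ∈ Finset.range T, margin M (Φ i) (u t) = T * v := by
      rw [hv, hmargin i]; field_simp
    rw [← Finset.mul_sum] at h1
    simp only [Finset.sum_sub_distrib, Finset.sum_const, Finset.card_range, nsmul_eq_mul, h2,
      sub_self, mul_zero] at h1
    linarith
  have hround : ∀ t, ∑ i ∈ Finset.range m, logisticLoss (margin M (Φ i) (u t)) (y i) -
      ∑ i ∈ Finset.range m, logisticLoss (margin M (Φ i) c) (y i) ≤
      ∑ k ∈ Finset.range M, (u t k - c k) * G t k := by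
    intro t
    rw [← Finset.sum_sub_distrib]
    refine (Finset.sum_le_sum fun i hi =>
      logisticLoss_sub_le (hy i (Finset.mem_range.1 hi))).trans (le_of_eq ?_)
    simp only [hG, grad, Finset.mul_sum]
    rw [Finset.sum_comm]
    refine Finset.sum_congr rfl fun i _ => ?_
    have e : margin M (Φ i) (u t) - margin M (Φ i) c =
        ∑ k ∈ Finset.range M, (u t k - c k) * Φ i k := by
      simp only [margin, sub_mul, Finset.sum_sub_distrib]
    rw [e, Finset.mul_sum]
    refine Finset.sum_congr rfl fun k _ => ?_
    ring
  have hSG : ∀ k, S T k = ∑ t ∈ Finset.range T, G t k := by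
    intro k
    generalize T = T'
    induction T' with
    | zero => simp [hS, cumGrad]
    | succ t ih => rw [Finset.sum_range_succ, ← ih]; rfl
  have hregret : ∑ t ∈ Finset.range T, ∑ k ∈ Finset.range M, (u t k - c k) * G t k ≤
      R * (2 * M * a) := by
    set Q := ∑ t ∈ Finset.range T, ∑ l ∈ Finset.range M, coef M a 1 (S t) l * G t l with hQ
    have hb : ∀ k < M, |S T k| ≤ 2 * M * a - Q := fun k hk => by
      have := abs_cumGrad_le (R := R) hτ hm hM ha hΦ hy T hT hk
      simp only [← hS] at this
      linarith
    have hb0 : 0 ≤ 2 * M * a - Q := (abs_nonneg _).trans (hb 0 hM)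
    have e1 : ∑ t ∈ Finset.range T, ∑ k ∈ Finset.range M, (u t k - c k) * G t k =
        R * Q - ∑ k ∈ Finset.range M, c k * S T k := by
      simp only [sub_mul, Finset.sum_sub_distrib, hSG, Finset.mul_sum, hQ]
      congr 1
      · refine Finset.sum_congr rfl fun t _ => Finset.sum_congr rfl fun k _ => ?_
        rw [hu]; dsimp only; rw [coef_eq_mul]; ring
      · rw [Finset.sum_comm]
    -- Duality: a competitor of norm at most `R` gains at most `R` times the largest cumulative
    -- gradient, and the potential argument bounds the latter by `2 M a - Q`.
    have e2 : -∑ k ∈ Finset.range M, c k * S T k ≤ R * (2 * M * a - Q) := by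
      rw [← Finset.sum_neg_distrib]
      calc ∑ k ∈ Finset.range M, -(c k * S T k)
          ≤ ∑ k ∈ Finset.range M, |c k| * (2 * M * a - Q) := by
            refine Finset.sum_le_sum fun k hk => (neg_le_abs _).trans ?_
            rw [abs_mul]
            exact mul_le_mul_of_nonneg_left (hb k (Finset.mem_range.1 hk)) (abs_nonneg _)
        _ ≤ R * (2 * M * a - Q) := by
            rw [← Finset.sum_mul]; exact mul_le_mul_of_nonneg_right hc hb0
    rw [e1]
    linarith
  have h1 := Finset.sum_le_sum fun i hi => hjensen i (Finset.mem_range.1 hi)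
  rw [← Finset.mul_sum, Finset.sum_comm] at h1
  have h2 := (Finset.sum_le_sum fun t (_ : t ∈ Finset.range T) => hround t).trans hregret
  rw [Finset.sum_sub_distrib, Finset.sum_const, Finset.card_range, nsmul_eq_mul] at h2
  -- The choices `a = 8 τ m` and `T = 16 τ² M` make the regret equal to `T m R / τ`.
  have h3 : R * (2 * M * a) = T * (m * (R / τ)) := by
    rw [ha, hT]; push_cast; field_simp; ring
  rw [h3] at h2
  refine le_of_mul_le_mul_left ?_ hT0
  linarith

lemma sum_abs_average_le {a R : ℝ} (hM : 1 ≤ M) (hR : 0 ≤ R) {T : ℕ} (hT : 1 ≤ T) :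
    ∑ k ∈ Finset.range M, |average M m T a R Φ y k| ≤ R := by
  have hT0 : (0 : ℝ) < T := by exact_mod_cast hT
  calc ∑ k ∈ Finset.range M, |average M m T a R Φ y k|
      ≤ ∑ k ∈ Finset.range M, ∑ t ∈ Finset.range T,
          |coef M a R (cumGrad M m a R Φ y t) k| / T := by
        refine Finset.sum_le_sum fun k _ => (Finset.abs_sum_le_sum_abs _ _).trans (le_of_eq ?_)
        simp only [abs_div, abs_of_pos hT0]
    _ ≤ ∑ t ∈ Finset.range T, R / T := by
        rw [Finset.sum_comm]
        refine Finset.sum_le_sum fun t _ => ?_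
        rw [← Finset.sum_div]
        exact div_le_div_of_nonneg_right (sum_abs_coef_le hM a hR _) hT0.le
    _ = R := by simp; field_simp

end Regret

end Hedge

/-! ### Reasoning about programs -/

namespace RealRAM

/-- Started in `s`, the program `p` halts within `T` steps, in a state with the property `Q`. -/
def Runs (p : Prog) (s : State) (T : ℕ) (Q : State → Prop) : Prop :=
  ∃ t s', t ≤ T ∧ Exec p s t s' ∧ Q s'

/-- The nonempty straight-line program with the given instructions. -/
def block : Instr → List Instr → Prog
  | i, [] => .prim i
  | i, j :: l => .seq (.prim i) (block j l)

/-- The effect of a straight-line program. -/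
noncomputable def runAll : List Instr → State → State
  | [], s => s
  | i :: l, s => runAll l (i.run s)

lemma Runs.mono {p : Prog} {s : State} {T T' : ℕ} {Q Q' : State → Prop} (h : Runs p s T Q)
    (hT : T ≤ T') (hQ : ∀ s', Q s' → Q' s') : Runs p s T' Q' := by
  obtain ⟨t, s', ht, he, hq⟩ := h
  exact ⟨t, s', ht.trans hT, he, hQ _ hq⟩

lemma Runs.seq {p q : Prog} {s : State} {T T' : ℕ} {Q Q' : State → Prop} (h : Runs p s T Q)
    (h' : ∀ s', Q s' → Runs q s' T' Q') : Runs (.seq p q) s (T + T') Q' := by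
  obtain ⟨t, s', ht, he, hq⟩ := h
  obtain ⟨t', s'', ht', he', hq'⟩ := h' s' hq
  exact ⟨t + t', s'', add_le_add ht ht', .seq he he', hq'⟩

lemma runs_block (i : Instr) (l : List Instr) {s : State} {Q : State → Prop}
    (h : Q (runAll (i :: l) s)) : Runs (block i l) s (l.length + 1) Q := by
  induction l generalizing i s with
  | nil => exact ⟨1, _, le_refl _, .prim i s, h⟩
  | cons j l ih =>
    obtain ⟨t, s', ht, he, hq⟩ := ih j (s := i.run s) h
    exact ⟨1 + t, s', by simp; omega, .seq (.prim i s) he, hq⟩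

/-- The invariant is indexed by the number of completed rounds and determines the guard. Each round
costs its body and one test, and the last test stops the loop. -/
lemma runs_loop {c : Test} {p : Prog} {b K : ℕ} (I : ℕ → State → Prop)
    (hc : ∀ k s, I k s → (c.Holds s ↔ k < K))
    (hbody : ∀ k < K, ∀ s, I k s → Runs p s b (I (k + 1))) {s : State} (h0 : I 0 s) :
    Runs (.loop c p) s (K * (b + 1) + 1) (I K) := by
  have key : ∀ j k s, k + j = K → I k s → Runs (.loop c p) s (j * (b + 1) + 1) (I K) := by
    intro j
    induction j with
    | zero =>
      intro k s hk hI
      obtain rfl : k = K := by omega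
      exact ⟨1, s, by omega, .loopStop (by rw [hc _ _ hI]; omega), hI⟩
    | succ j ih =>
      intro k s hk hI
      obtain ⟨t, s', ht, he, hI'⟩ := hbody k (by omega) s hI
      obtain ⟨t', s'', ht', he', hI''⟩ := ih (k + 1) s' (by omega) hI'
      refine ⟨t + t' + 1, s'', ?_, .loopStep (by rw [hc _ _ hI]; omega) he he', hI''⟩
      rw [Nat.succ_mul]
      omega
  exact key K 0 s (by omega) h0

/-- Determinism is what transfers the guarantee for some output of the program to every output. -/
lemma Exec.unique {p : Prog} {s s₁ s₂ : State} {t₁ t₂ : ℕ} (h₁ : Exec p s t₁ s₁)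
    (h₂ : Exec p s t₂ s₂) : t₁ = t₂ ∧ s₁ = s₂ := by
  induction h₁ generalizing t₂ s₂ with
  | prim i s => cases h₂; exact ⟨rfl, rfl⟩
  | seq _ _ ih ih' =>
    cases h₂ with
    | seq h h' =>
      obtain ⟨rfl, rfl⟩ := ih h
      obtain ⟨rfl, rfl⟩ := ih' h'
      exact ⟨rfl, rfl⟩
  | condTrue hc _ ih =>
    cases h₂ with
    | condTrue _ h => obtain ⟨rfl, rfl⟩ := ih h; exact ⟨rfl, rfl⟩
    | condFalse hc' _ => exact absurd hc hc'
  | condFalse hc _ ih =>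
    cases h₂ with
    | condTrue hc' _ => exact absurd hc' hc
    | condFalse _ h => obtain ⟨rfl, rfl⟩ := ih h; exact ⟨rfl, rfl⟩
  | loopStop hc =>
    cases h₂ with
    | loopStop _ => exact ⟨rfl, rfl⟩
    | loopStep hc' _ _ => exact absurd hc' hc
  | loopStep hc _ _ ih ih' =>
    cases h₂ with
    | loopStop hc' => exact absurd hc hc'
    | loopStep _ h h' =>
      obtain ⟨rfl, rfl⟩ := ih h
      obtain ⟨rfl, rfl⟩ := ih' h'
      exact ⟨rfl, rfl⟩

lemma Outputs.unique {n D m : ℕ} {A : Prog} {τ : ℕ} {R : ℝ} {x : Fin m → Fin n → ℝ}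
    {y : Fin m → ℝ} {t t' : ℕ} {u u' : Mono n D → ℝ} (h : Outputs A τ R x y t u)
    (h' : Outputs A τ R x y t' u') : u = u' := by
  obtain ⟨s, he, -, -, hu⟩ := h
  obtain ⟨s', he', -, -, hu'⟩ := h'
  obtain ⟨-, rfl⟩ := he.unique he'
  funext α
  rw [hu, hu']

/-! ### Memory updates and preserved registers -/

lemma write_apply {α : Type} (M : ℕ → ℕ → α) (p q : ℕ) (v : α) (p' q' : ℕ) :
    write M p q v p' q' = if p' = p ∧ q' = q then v else M p' q' := by
  unfold write
  by_cases hp : p' = p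
  · subst hp
    by_cases hq : q' = q
    · subst hq; simp
    · simp [hq]
  · simp [hp]

/-- The integer registers below `b` and the real registers below `c` have the same values. -/
def Frame (b c : ℕ) (s s' : State) : Prop :=
  (∀ r < b, s'.ix r = s.ix r) ∧ ∀ r < c, s'.re r = s.re r

lemma Frame.refl (b c : ℕ) (s : State) : Frame b c s s := ⟨fun _ _ => rfl, fun _ _ => rfl⟩

lemma Frame.trans {b c : ℕ} {s s' s'' : State} (h : Frame b c s s') (h' : Frame b c s' s'') :
    Frame b c s s'' :=
  ⟨fun r hr => (h'.1 r hr).trans (h.1 r hr), fun r hr => (h'.2 r hr).trans (h.2 r hr)⟩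

lemma Frame.mono {b c b' c' : ℕ} {s s' : State} (h : Frame b c s s') (hb : b' ≤ b) (hc : c' ≤ c) :
    Frame b' c' s s' :=
  ⟨fun r hr => h.1 r (by omega), fun r hr => h.2 r (by omega)⟩

/-- The instruction does not change the integer registers below `b` and the real registers
below `c`. -/
def Instr.keeps (b c : ℕ) : Instr → Bool
  | .izero a | .isucc a | .iadd a _ _ | .isub a _ _ | .iload a _ _ => decide (b ≤ a)
  | .rzero a | .rone a | .radd a _ _ | .rsub a _ _ | .rmul a _ _ | .rdiv a _ _ | .rexp a _
  | .rload a _ _ => decide (c ≤ a)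
  | .istore _ _ _ | .rstore _ _ _ => true

lemma Frame.run {b c : ℕ} {s s' : State} (h : Frame b c s s') {i : Instr}
    (hi : i.keeps b c = true) : Frame b c s (i.run s') := by
  refine ⟨fun r hr => ?_, fun r hr => ?_⟩
  · rw [← h.1 r hr]
    cases i <;> simp [Instr.keeps] at hi <;> simp [Instr.run] <;>
      rw [Function.update_of_ne (by omega)]
  · rw [← h.2 r hr]
    cases i <;> simp [Instr.keeps] at hi <;> simp [Instr.run] <;>
      rw [Function.update_of_ne (by omega)]

lemma Frame.runAll {b c : ℕ} {s s' : State} (h : Frame b c s s') {l : List Instr}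
    (hl : (l.all fun i => i.keeps b c) = true) : Frame b c s (runAll l s') := by
  induction l generalizing s' with
  | nil => exact h
  | cons i l ih =>
    simp only [List.all_cons, Bool.and_eq_true] at hl
    exact ih (h.run hl.1) hl.2

/-! #### Preliminary computations -/

/-- Sets real register `a` to the value of integer register `r`. Register `30` is scratch. -/
def castProg (a r : ℕ) : Prog :=
  .seq (block (.izero 30) [.rzero a])
    (.loop (.ilt 30 r) (block (.radd a a 1) [.isucc 30]))

lemma runs_castProg {a r : ℕ} (ha : a ≠ 1) (hr : r < 30) {s : State} (h1 : s.re 1 = 1) :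
    Runs (castProg a r) s (s.ix r * 3 + 3) fun s' =>
      (∀ q ≠ 30, s'.ix q = s.ix q) ∧ (∀ q ≠ a, s'.re q = s.re q) ∧ s'.re a = s.ix r ∧
      s'.imem = s.imem ∧ s'.rmem = s.rmem := by
  let I : ℕ → State → Prop := fun k s' => s'.ix 30 = k ∧
      (∀ q ≠ 30, s'.ix q = s.ix q) ∧ (∀ q ≠ a, s'.re q = s.re q) ∧ s'.re a = k ∧
      s'.imem = s.imem ∧ s'.rmem = s.rmem
  have h : Runs (castProg a r) s (2 + (s.ix r * (2 + 1) + 1)) (I (s.ix r)) := by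
    refine Runs.seq (Q := I 0) (runs_block _ _ ?_) fun s' hs' => runs_loop I ?_ ?_ hs'
    · simp +contextual [runAll, Instr.run, I]
    · rintro k s' ⟨hk, hx, -⟩
      simp only [Test.Holds, hk, hx r (by omega)]
    · rintro k - s' ⟨hk, hx, hre, hrea, him, hrm⟩
      refine runs_block _ _ ?_
      have h11 := hre 1 ha.symm
      simp +contextual [runAll, Instr.run, I, hk, hx, hre, hrea, him, hrm,
        h11, h1]
  exact h.mono (by omega) fun s' hs' => ⟨hs'.2.1, hs'.2.2.1, hs'.2.2.2.1, hs'.2.2.2.2⟩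

/-- Sets integer register `5` to `treeSize n D`. -/
def treeSizeProg : Prog :=
  .seq (block (.izero 5) [.izero 6])
    (.loop (.ilt 6 1) (.seq (block (.izero 7) [.isucc 7, .izero 8])
      (.seq (.loop (.ilt 8 0) (block (.iadd 7 7 5) [.isucc 8]))
        (block (.izero 8) [.iadd 5 7 8, .isucc 6]))))

lemma runs_treeSizeProg {n D : ℕ} {s : State} (h0 : s.ix 0 = n) (h1 : s.ix 1 = D) :
    Runs treeSizeProg s (D * (n * 3 + 8) + 3) fun s' =>
      Frame 5 100 s s' ∧ s'.ix 5 = treeSize n D ∧ s'.imem = s.imem ∧ s'.rmem = s.rmem := by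
  let I : ℕ → State → Prop := fun d s' => s'.ix 6 = d ∧ Frame 5 100 s s' ∧
    s'.ix 5 = treeSize n d ∧ s'.imem = s.imem ∧ s'.rmem = s.rmem
  -- Integer multiplication is not primitive: the inner loop forms `n * treeSize n d + 1` in
  -- register `7` by repeated addition.
  let J : ℕ → ℕ → State → Prop := fun d q s' => s'.ix 8 = q ∧
    s'.ix 7 = q * treeSize n d + 1 ∧ I d s'
  have h : Runs treeSizeProg s (2 + (D * ((3 + ((n * (2 + 1) + 1) + 3)) + 1) + 1)) (I D) := by
    refine Runs.seq (Q := I 0) (runs_block _ _ ?_) fun s' hs' => runs_loop I ?_ ?_ hs'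
    · exact ⟨by simp [runAll, Instr.run], (Frame.refl _ _ _).runAll (by decide),
        by simp [runAll, Instr.run, treeSize]⟩
    · rintro k s' ⟨hk, hx, -⟩
      simp only [Test.Holds, hk, hx.1 1 (by omega), h1]
    · rintro d - s' hs'
      refine Runs.seq (Q := J d 0) (runs_block _ _ ?_) fun s' hs' =>
        Runs.seq (Q := J d n) (runs_loop (J d) ?_ ?_ hs') fun s' hs' => runs_block _ _ ?_
      · obtain ⟨hd, hF, h5, him, hrm⟩ := hs'
        exact ⟨by simp [runAll, Instr.run], by simp [runAll, Instr.run],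
          by simp [runAll, Instr.run, hd], hF.runAll (by decide),
          by simp [runAll, Instr.run, h5, him, hrm]⟩
      · rintro k s' ⟨hk, -, -, hF, -⟩
        simp only [Test.Holds, hk, hF.1 0 (by omega), h0]
      · rintro q - s' ⟨hq, h7, hd, hF, h5, him, hrm⟩
        refine runs_block _ _ ⟨by simp [runAll, Instr.run, hq], ?_,
          by simp [runAll, Instr.run, hd], hF.runAll (by decide),
          by simp [runAll, Instr.run, h5, him, hrm]⟩
        simp [runAll, Instr.run, h7, h5]
        ring
      · obtain ⟨hq, h7, hd, hF, h5, him, hrm⟩ := hs'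
        exact ⟨by simp [runAll, Instr.run, hd], hF.runAll (by decide),
          by simp [runAll, Instr.run, h7, treeSize, him, hrm]⟩
  refine h.mono ?_ fun s' hs' => hs'.2
  have : D * ((3 + ((n * (2 + 1) + 1) + 3)) + 1) = D * (n * 3 + 8) := by ring
  omega

end RealRAM

/-! #### Enumeration of the monomials -/

namespace RealRAM

/-- The monomial number `k` in the enumeration by `expo`. -/
noncomputable def feature (n : ℕ) (x : ℕ → ℝ) (k : ℕ) : ℝ :=
  ∏ l ∈ Finset.range n, x l ^ expo n k l

lemma feature_zero (n : ℕ) (x : ℕ → ℝ) : feature n x 0 = 1 := by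
  simp [feature, expo_zero]

lemma feature_child {n j : ℕ} (hj : j < n) (x : ℕ → ℝ) (p : ℕ) :
    feature n x (p * n + j + 1) = feature n x p * x j := by
  simp only [feature, expo_child hj, pow_add, Finset.prod_mul_distrib]
  congr 1
  rw [Finset.prod_eq_single j]
  · simp
  · intro l _ hl; simp [hl]
  · intro h; exact absurd (Finset.mem_range.2 hj) h

/-- The columns of the memories, and the terms number `0, …, K - 1`, have been set up. -/
structure Terms (n m K : ℕ) (x : ℕ → ℕ → ℝ) (y : ℕ → ℝ) (s : State) : Prop where
  expo_eq : ∀ k < K, ∀ l < n, s.imem k l = expo n k l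
  free : ∀ k ≥ K, ∀ l, s.imem k l = 0
  point : ∀ i < m, ∀ l < n, s.rmem i l = x i l
  label : ∀ i < m, s.rmem i n = y i
  -- Column `n + 1` is reserved for the averaged coefficients and column `n + 2` for the cumulative
  -- gradients, one row per term. Column `n + 3` is working space, and the features follow from
  -- column `n + 4`, one row per sample point.
  zero : ∀ k, s.rmem k (n + 1) = 0 ∧ s.rmem k (n + 2) = 0
  feature_eq : ∀ i < m, ∀ k < K, s.rmem i (n + 4 + k) = feature n (x i) k

/-- The constants in the integer registers below `14`. -/
structure Consts (n D m τ : ℕ) (s : State) : Prop where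
  i0 : s.ix 0 = n
  i1 : s.ix 1 = D
  i2 : s.ix 2 = m
  i3 : s.ix 3 = τ
  i5 : s.ix 5 = treeSize n D
  i9 : s.ix 9 = 0
  i10 : s.ix 10 = n + 1
  i11 : s.ix 11 = n + 2
  i12 : s.ix 12 = n + 3
  i13 : s.ix 13 = n + 4
  r1 : s.re 1 = 1

lemma Consts.frame {n D m τ c : ℕ} {s s' : State} (h : Consts n D m τ s)
    (hF : Frame 14 (c + 2) s s') : Consts n D m τ s' where
  i0 := by rw [hF.1 _ (by omega), h.i0]
  i1 := by rw [hF.1 _ (by omega), h.i1]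
  i2 := by rw [hF.1 _ (by omega), h.i2]
  i3 := by rw [hF.1 _ (by omega), h.i3]
  i5 := by rw [hF.1 _ (by omega), h.i5]
  i9 := by rw [hF.1 _ (by omega), h.i9]
  i10 := by rw [hF.1 _ (by omega), h.i10]
  i11 := by rw [hF.1 _ (by omega), h.i11]
  i12 := by rw [hF.1 _ (by omega), h.i12]
  i13 := by rw [hF.1 _ (by omega), h.i13]
  r1 := by rw [hF.2 _ (by omega), h.r1]

/-- Sets the constants, and the number of terms (register `14`) to `1`. -/
def constsProg : Prog :=
  block (.rone 1) [.izero 9, .iadd 10 0 9, .isucc 10, .iadd 11 10 9, .isucc 11,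
    .iadd 12 11 9, .isucc 12, .iadd 13 12 9, .isucc 13, .izero 14, .isucc 14, .izero 20]

/-- The constant feature is `1`. -/
def rootProg : Prog := .loop (.ilt 20 2) (block (.rstore 20 13 1) [.isucc 20])

lemma runs_rootProg {n D m τ : ℕ} {x : ℕ → ℕ → ℝ} {y : ℕ → ℝ} {s : State}
    (hC : Consts n D m τ s) (hT : Terms n m 0 x y s) (h20 : s.ix 20 = 0) :
    Runs rootProg s (m * 3 + 1) fun s' => Frame 20 100 s s' ∧ Terms n m 1 x y s' := by
  let I : ℕ → State → Prop := fun i s' => s'.ix 20 = i ∧ Frame 20 100 s s' ∧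
    Terms n m 0 x y s' ∧ ∀ k < i, s'.rmem k (n + 4) = 1
  have h : Runs rootProg s (m * (2 + 1) + 1) (I m) := by
    refine runs_loop I ?_ ?_ ⟨h20, Frame.refl _ _ _, hT, by simp⟩
    · rintro k s' ⟨hk, hx, -⟩
      simp only [Test.Holds, hk, hx.1 2 (by omega), hC.i2]
    · rintro i - s' ⟨hi, hF, hT', h1⟩
      have e13 := (hF.1 13 (by omega)).trans hC.i13
      have e1 := (hF.2 1 (by omega)).trans hC.r1
      refine runs_block _ _ ⟨by simp [runAll, Instr.run, hi], hF.runAll (by decide),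
        ⟨by simp, ?_, ?_, ?_, ?_, by simp⟩, ?_⟩
      · simpa [runAll, Instr.run] using hT'.free
      · intro i' hi' l hl
        simp [runAll, Instr.run, write_apply, e13, hT'.point i' hi' l hl, show l ≠ n + 4 by omega]
      · intro i' hi'
        simp [runAll, Instr.run, write_apply, e13, hT'.label i' hi']
      · intro k
        simp [runAll, Instr.run, write_apply, e13, hT'.zero k]
      · intro k hk
        rcases eq_or_ne k i with rfl | hki
        · simp [runAll, Instr.run, write_apply, e13, e1, hi]
        · simp [runAll, Instr.run, write_apply, e13, hi, hki, h1 k (by omega)]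
  refine h.mono (by omega) fun s' hs' => ⟨hs'.2.1, ?_⟩
  obtain ⟨-, -, hT', h1⟩ := hs'
  refine ⟨fun k hk l hl => ?_, fun k hk => hT'.free k (by omega), hT'.point, hT'.label, hT'.zero,
    fun i hi k hk => ?_⟩
  · rw [hT'.free k (by omega), show k = 0 by omega, expo_zero]
  · obtain rfl : k = 0 := by omega
    rw [feature_zero, add_zero, h1 i hi]

/-- Copies the exponents of the term in register `15` to the term in register `14`. -/
def copyProg : Prog :=
  .seq (block (.izero 20) []) (.loop (.ilt 20 0)
    (block (.iload 21 15 20) [.istore 14 20 21, .isucc 20]))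

lemma runs_copyProg {s : State} (hne : s.ix 15 ≠ s.ix 14) :
    Runs copyProg s (s.ix 0 * 4 + 2) fun s' => Frame 20 100 s s' ∧ s'.rmem = s.rmem ∧
      ∀ k l, s'.imem k l = if k = s.ix 14 ∧ l < s.ix 0 then s.imem (s.ix 15) l
        else s.imem k l := by
  let I : ℕ → State → Prop := fun i s' => s'.ix 20 = i ∧ Frame 20 100 s s' ∧ s'.rmem = s.rmem ∧
      ∀ k l, s'.imem k l = if k = s.ix 14 ∧ l < i then s.imem (s.ix 15) l else s.imem k l
  have h : Runs copyProg s (1 + (s.ix 0 * (3 + 1) + 1)) (I (s.ix 0)) := by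
    refine Runs.seq (Q := I 0) (runs_block _ _ ?_) fun s' hs' => runs_loop I ?_ ?_ hs'
    · exact ⟨by simp [runAll, Instr.run], (Frame.refl _ _ _).runAll (by decide),
        by simp [runAll, Instr.run]⟩
    · rintro k s' ⟨hk, hx, -⟩
      simp only [Test.Holds, hk, hx.1 0 (by omega)]
    · rintro i - s' ⟨hi, hF, hrm, him⟩
      refine runs_block _ _ ⟨by simp [runAll, Instr.run, hi], hF.runAll (by decide),
        by simp [runAll, Instr.run, hrm], fun k l => ?_⟩
      have e14 := hF.1 14 (by omega)
      have e15 := hF.1 15 (by omega)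
      simp [runAll, Instr.run, write_apply, e14, e15, hi, him, hne]
      grind
  exact h.mono (by omega) fun s' hs' => hs'.2

/-- Computes the feature in column `23` as the product of the column `22` and the coordinate
in register `16`. -/
def featureProg : Prog :=
  .loop (.ilt 20 2) (block (.rload 10 20 22) [.rload 11 20 16, .rmul 10 10 11, .rstore 20 23 10,
    .isucc 20])

lemma runs_featureProg {s : State} (h20 : s.ix 20 = 0) (h22 : s.ix 22 ≠ s.ix 23)
    (h16 : s.ix 16 ≠ s.ix 23) :
    Runs featureProg s (s.ix 2 * 6 + 1) fun s' => Frame 20 10 s s' ∧ s'.imem = s.imem ∧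
      ∀ i c, s'.rmem i c = if i < s.ix 2 ∧ c = s.ix 23 then
        s.rmem i (s.ix 22) * s.rmem i (s.ix 16) else s.rmem i c := by
  let I : ℕ → State → Prop := fun k s' => s'.ix 20 = k ∧ s'.ix 22 = s.ix 22 ∧
      s'.ix 23 = s.ix 23 ∧ Frame 20 10 s s' ∧ s'.imem = s.imem ∧
      ∀ i c, s'.rmem i c = if i < k ∧ c = s.ix 23 then
        s.rmem i (s.ix 22) * s.rmem i (s.ix 16) else s.rmem i c
  have h : Runs featureProg s (s.ix 2 * (5 + 1) + 1) (I (s.ix 2)) := by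
    refine runs_loop I ?_ ?_ ⟨h20, rfl, rfl, Frame.refl _ _ _, rfl, by simp⟩
    · rintro k s' ⟨hk, -, -, hx, -⟩
      simp only [Test.Holds, hk, hx.1 2 (by omega)]
    · rintro i - s' ⟨hi, e22, e23, hF, him, hrm⟩
      refine runs_block _ _ ⟨by simp [runAll, Instr.run, hi], by simp [runAll, Instr.run, e22],
        by simp [runAll, Instr.run, e23], hF.runAll (by decide),
        by simp [runAll, Instr.run, him], fun k c => ?_⟩
      have e16 := hF.1 16 (by omega)
      simp [runAll, Instr.run, write_apply, e16, hi, e22, e23, hrm, h22, h16]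
      grind
  exact h.mono (by omega) fun s' hs' => hs'.2.2.2

/-- Creates the product of the term in register `15` with the coordinate in register `16`. -/
def childProg : Prog :=
  .seq copyProg (.seq (block (.iload 21 14 16) [.isucc 21, .istore 14 16 21, .iadd 22 13 15,
    .iadd 23 13 14, .izero 20]) (.seq featureProg (block (.isucc 14) [.isucc 16])))

/-- The new term copies the exponents of its parent and raises one of them. Its feature needs a
single multiplication per sample point, because the parent precedes the child and its feature is
already stored. -/
lemma runs_childProg {n D m τ p j : ℕ} {x : ℕ → ℕ → ℝ} {y : ℕ → ℝ} {s : State}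
    (hC : Consts n D m τ s) (hj : j < n) (hT : Terms n m (p * n + j + 1) x y s)
    (h14 : s.ix 14 = p * n + j + 1) (h15 : s.ix 15 = p) (h16 : s.ix 16 = j) :
    Runs childProg s (n * 4 + m * 6 + 11) fun s' => Frame 14 10 s s' ∧
      Terms n m (p * n + (j + 1) + 1) x y s' ∧ s'.ix 14 = p * n + (j + 1) + 1 ∧ s'.ix 15 = p ∧
      s'.ix 16 = j + 1 := by
  set k := p * n + j + 1 with hk
  have hpk : p < k := by
    have : p * 1 ≤ p * n := Nat.mul_le_mul_left _ (by omega)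
    omega
  have h := Runs.seq (runs_copyProg (s := s) (by omega)) (q := .seq (block (.iload 21 14 16)
    [.isucc 21, .istore 14 16 21, .iadd 22 13 15, .iadd 23 13 14, .izero 20])
    (.seq featureProg (block (.isucc 14) [.isucc 16]))) (T' := 6 + ((m * 6 + 1) + 2))
    (Q' := fun s' => Frame 14 10 s s' ∧
      Terms n m (k + 1) x y s' ∧ s'.ix 14 = k + 1 ∧ s'.ix 15 = p ∧ s'.ix 16 = j + 1) ?_
  · refine h.mono ?_ fun s' hs' => ?_
    · rw [hC.i0]; omega
    · rw [show p * n + (j + 1) + 1 = k + 1 by omega]; exact hs'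
  rintro s₁ ⟨hF₁, hrm₁, him₁⟩
  rw [hC.i0, h14, h15] at him₁
  have e13 := (hF₁.1 13 (by omega)).trans hC.i13
  have e14 := (hF₁.1 14 (by omega)).trans h14
  have e15 := (hF₁.1 15 (by omega)).trans h15
  have e16 := (hF₁.1 16 (by omega)).trans h16
  have e2 := (hF₁.1 2 (by omega)).trans hC.i2
  refine Runs.seq (Q := fun s' => Frame 20 10 s s' ∧ s'.ix 20 = 0 ∧ s'.ix 22 = n + 4 + p ∧
    s'.ix 23 = n + 4 + k ∧ s'.rmem = s.rmem ∧ ∀ k' l, s'.imem k' l = if k' = k ∧ l < n then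
      expo n k l else s.imem k' l) (runs_block _ _ ?_) ?_
  · refine ⟨(hF₁.mono (by omega) (by omega)).runAll (by decide), by simp [runAll, Instr.run],
      by simp [runAll, Instr.run, e13, e15], by simp [runAll, Instr.run, e13, e14],
      by simp [runAll, Instr.run, hrm₁], fun k' l => ?_⟩
    simp [runAll, Instr.run, write_apply, e14, e16, him₁, hj]
    have hch := fun l => expo_child hj p l
    rw [← hk] at hch
    have hp := hT.expo_eq p hpk
    grind
  rintro s₂ ⟨hF₂, h20, h22, h23, hrm₂, him₂⟩
  have f2 := (hF₂.1 2 (by omega)).trans hC.i2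
  have f14 := (hF₂.1 14 (by omega)).trans h14
  have f15 := (hF₂.1 15 (by omega)).trans h15
  have f16 := (hF₂.1 16 (by omega)).trans h16
  have hfeat := runs_featureProg (s := s₂) h20 (by omega) (by omega)
  rw [f2, h22, h23, f16] at hfeat
  refine Runs.seq hfeat ?_
  rintro s₃ ⟨hF₃, him₃, hrm₃⟩
  have hF := hF₂.trans hF₃
  rw [hrm₂] at hrm₃
  refine runs_block _ _ ⟨(hF.mono (b' := 14) (by omega) le_rfl).runAll (by decide), ⟨?_, ?_, ?_,
    ?_, ?_, ?_⟩, ?_⟩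
  · intro k' hk' l hl
    have := hT.expo_eq k'
    simp only [runAll, Instr.run, him₃, him₂]
    split_ifs with h
    · rw [h.1]
    · exact this (by omega) l hl
  · intro k' hk' l
    simp only [runAll, Instr.run, him₃, him₂]
    rw [if_neg (by omega), hT.free k' (by omega)]
  · intro i hi l hl
    simp only [runAll, Instr.run, hrm₃]
    rw [if_neg (by omega), hT.point i hi l hl]
  · intro i hi
    simp only [runAll, Instr.run, hrm₃]
    rw [if_neg (by omega), hT.label i hi]
  · intro k'
    simp only [runAll, Instr.run, hrm₃]
    rw [if_neg (by omega), if_neg (by omega)]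
    exact hT.zero k'
  · intro i hi k' hk'
    simp only [runAll, Instr.run, hrm₃]
    split_ifs with h
    · rw [hT.feature_eq i hi p hpk, hT.point i hi j hj, show k' = k by omega, hk, feature_child hj]
    · exact hT.feature_eq i hi k' (by omega)
  · have g14 := (hF.1 14 (by omega)).trans h14
    have g15 := (hF.1 15 (by omega)).trans h15
    have g16 := (hF.1 16 (by omega)).trans h16
    simp [runAll, Instr.run, g14, g15, g16]

/-- Creates all terms. -/
def enumProg : Prog :=
  .seq (block (.izero 15) []) (.loop (.ilt 15 5) (.seq (block (.izero 16) [])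
    (.seq (.loop (.ilt 16 0) childProg) (block (.isucc 15) []))))

/-- Every node `p < treeSize n D` receives its `n` children in heap order. Together with the root
this makes `treeSize n D * n + 1 = treeSize n (D + 1)` terms, that is, all nodes of depth at most
`D`. -/
lemma runs_enumProg {n D m τ : ℕ} {x : ℕ → ℕ → ℝ} {y : ℕ → ℝ} {s : State}
    (hC : Consts n D m τ s) (hT : Terms n m 1 x y s) (h14 : s.ix 14 = 1) :
    Runs enumProg s (treeSize n D * (n * (n * 4 + m * 6 + 12) + 4) + 2) fun s' =>
      Frame 14 10 s s' ∧ Terms n m (treeSize n (D + 1)) x y s' ∧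
      s'.ix 14 = treeSize n (D + 1) := by
  let I : ℕ → State → Prop := fun p s' => s'.ix 15 = p ∧ Frame 14 10 s s' ∧
    Terms n m (p * n + 1) x y s' ∧ s'.ix 14 = p * n + 1
  let J : ℕ → ℕ → State → Prop := fun p j s' => s'.ix 16 = j ∧ s'.ix 15 = p ∧ Frame 14 10 s s' ∧
    Terms n m (p * n + j + 1) x y s' ∧ s'.ix 14 = p * n + j + 1
  have h : Runs enumProg s (1 + (treeSize n D * ((1 + ((n * (n * 4 + m * 6 + 11 + 1) + 1) + 1))
      + 1) + 1)) (I (treeSize n D)) := by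
    refine Runs.seq (Q := I 0) (runs_block _ _ ?_) fun s' hs' => runs_loop I ?_ ?_ hs'
    · refine ⟨by simp [runAll, Instr.run], (Frame.refl _ _ _).runAll (by decide), ?_, ?_⟩
      · rw [zero_mul]
        exact ⟨hT.expo_eq, hT.free, hT.point, hT.label, hT.zero, hT.feature_eq⟩
      · simp [runAll, Instr.run, h14]
    · rintro p s' ⟨hp, hx, -⟩
      simp only [Test.Holds, hp, hx.1 5 (by omega), hC.i5]
    · rintro p - s' hs'
      refine Runs.seq (Q := J p 0) (runs_block _ _ ?_) fun s' hs' =>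
        Runs.seq (Q := J p n) (runs_loop (J p) ?_ ?_ hs') fun s' hs' => runs_block _ _ ?_
      · obtain ⟨hp, hF, hT', h14'⟩ := hs'
        refine ⟨by simp [runAll, Instr.run], by simp [runAll, Instr.run, hp],
          hF.runAll (by decide), ?_, by simp [runAll, Instr.run, h14']⟩
        exact ⟨hT'.expo_eq, hT'.free, hT'.point, hT'.label, hT'.zero, hT'.feature_eq⟩
      · rintro j s' ⟨hj, -, hF, -⟩
        simp only [Test.Holds, hj, hF.1 0 (by omega), hC.i0]
      · rintro j hj s' ⟨h16, h15, hF, hT', h14'⟩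
        refine (runs_childProg (hC.frame (c := 8) hF) hj hT' h14' h15 h16).mono le_rfl ?_
        rintro s'' ⟨hF', hT'', g14, g15, g16⟩
        exact ⟨g16, g15, hF.trans hF', hT'', g14⟩
      · obtain ⟨-, h15, hF, hT', h14'⟩ := hs'
        refine ⟨by simp [runAll, Instr.run, h15], hF.runAll (by decide), ?_, ?_⟩
        · rw [show (p + 1) * n + 1 = p * n + n + 1 by ring]
          exact ⟨hT'.expo_eq, hT'.free, hT'.point, hT'.label, hT'.zero, hT'.feature_eq⟩
        · simp [runAll, Instr.run, h14']; ring
  refine h.mono ?_ fun s' hs' => ⟨hs'.2.1, ?_, ?_⟩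
  · have e : treeSize n D * ((1 + ((n * (n * 4 + m * 6 + 11 + 1) + 1) + 1)) + 1) =
      treeSize n D * (n * (n * 4 + m * 6 + 12) + 4) := by ring
    omega
  · rw [treeSize, mul_comm]; exact hs'.2.2.1
  · rw [treeSize, mul_comm]; exact hs'.2.2.2

end RealRAM

/-! #### The descent -/

namespace RealRAM

/-- The real memory `B`, with the columns `n + 1`, `n + 2` and `n + 3` replaced. -/
def mem (n : ℕ) (B : ℕ → ℕ → ℝ) (c S w : ℕ → ℝ) : ℕ → ℕ → ℝ := fun p q =>
  if q = n + 1 then c p else if q = n + 2 then S p else if q = n + 3 then w p else B p q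

section Mem

variable (n : ℕ) (B : ℕ → ℕ → ℝ) (c S w : ℕ → ℝ) (p k : ℕ) (v : ℝ)

lemma mem_coef : mem n B c S w p (n + 1) = c p := by simp [mem]

lemma mem_grad : mem n B c S w p (n + 2) = S p := by simp [mem]

lemma mem_weight : mem n B c S w p (n + 3) = w p := by simp [mem]

lemma mem_label : mem n B c S w p n = B p n := by simp [mem]

lemma mem_feature : mem n B c S w p (n + 4 + k) = B p (n + 4 + k) := by
  simp only [mem]
  rw [if_neg (by omega), if_neg (by omega), if_neg (by omega)]

lemma write_coef :
    write (mem n B c S w) p (n + 1) v = mem n B (Function.update c p v) S w := by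
  funext p' q'
  simp only [write_apply, mem, Function.update_apply]
  grind

lemma write_grad :
    write (mem n B c S w) p (n + 2) v = mem n B c (Function.update S p v) w := by
  funext p' q'
  simp only [write_apply, mem, Function.update_apply]
  grind

lemma write_weight :
    write (mem n B c S w) p (n + 3) v = mem n B c S (Function.update w p v) := by
  funext p' q'
  simp only [write_apply, mem, Function.update_apply]
  grind

end Mem

/-- The data of the descent. -/
structure Data (n m M : ℕ) (a R T : ℝ) (Φ : ℕ → ℕ → ℝ) (y : ℕ → ℝ) (B : ℕ → ℕ → ℝ)
    (s : State) : Prop where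
  i0 : s.ix 0 = n
  i2 : s.ix 2 = m
  i10 : s.ix 10 = n + 1
  i11 : s.ix 11 = n + 2
  i12 : s.ix 12 = n + 3
  i13 : s.ix 13 = n + 4
  i14 : s.ix 14 = M
  r0 : s.re 0 = R
  r1 : s.re 1 = 1
  r2 : s.re 2 = a
  r3 : s.re 3 = T
  r5 : s.re 5 = 0
  label : ∀ i < m, B i n = y i
  feat : ∀ i < m, ∀ k < M, B i (n + 4 + k) = Φ i k

variable {n m M : ℕ} {a R T : ℝ} {Φ : ℕ → ℕ → ℝ} {y : ℕ → ℝ} {B : ℕ → ℕ → ℝ} {s : State}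
  {c S w : ℕ → ℝ}

lemma Data.frame {b b' : ℕ} {s' : State} (h : Data n m M a R T Φ y B s)
    (hF : Frame (b + 15) (b' + 6) s s') : Data n m M a R T Φ y B s' where
  i0 := by rw [hF.1 _ (by omega), h.i0]
  i2 := by rw [hF.1 _ (by omega), h.i2]
  i10 := by rw [hF.1 _ (by omega), h.i10]
  i11 := by rw [hF.1 _ (by omega), h.i11]
  i12 := by rw [hF.1 _ (by omega), h.i12]
  i13 := by rw [hF.1 _ (by omega), h.i13]
  i14 := by rw [hF.1 _ (by omega), h.i14]
  r0 := by rw [hF.2 _ (by omega), h.r0]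
  r1 := by rw [hF.2 _ (by omega), h.r1]
  r2 := by rw [hF.2 _ (by omega), h.r2]
  r3 := by rw [hF.2 _ (by omega), h.r3]
  r5 := by rw [hF.2 _ (by omega), h.r5]
  label := h.label
  feat := h.feat

/-- The weights (column `n + 3`) and their normalization (real register `10`). -/
def weightProg : Prog :=
  .seq (block (.rzero 10) [.izero 20]) (.loop (.ilt 20 14)
    (block (.rload 11 20 11) [.rdiv 11 11 2, .rsub 11 5 11, .rexp 11 11, .rstore 20 12 11,
      .rdiv 12 1 11, .radd 11 11 12, .radd 10 10 11, .isucc 20]))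

lemma runs_weightProg (hd : Data n m M a R T Φ y B s) (hs : s.rmem = mem n B c S w) :
    Runs weightProg s (M * 10 + 3) fun s' => Frame 20 10 s s' ∧ s'.imem = s.imem ∧
      s'.re 10 = Hedge.total M a S ∧
      ∃ w', s'.rmem = mem n B c S w' ∧ ∀ k < M, w' k = Hedge.weight a S k := by
  let I : ℕ → State → Prop := fun k s' => s'.ix 20 = k ∧ Frame 20 10 s s' ∧ s'.imem = s.imem ∧
    s'.re 10 = Hedge.total k a S ∧
    ∃ w', s'.rmem = mem n B c S w' ∧ ∀ l < k, w' l = Hedge.weight a S l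
  have h : Runs weightProg s (2 + (M * (9 + 1) + 1)) (I M) := by
    refine Runs.seq (Q := I 0) (runs_block _ _ ?_) fun s' hs' => runs_loop I ?_ ?_ hs'
    · exact ⟨by simp [runAll, Instr.run], (Frame.refl _ _ _).runAll (by decide),
        by simp [runAll, Instr.run], by simp [runAll, Instr.run, Hedge.total], w,
        by simp [runAll, Instr.run, hs], by simp⟩
    · rintro k s' ⟨hk, hx, -⟩
      simp only [Test.Holds, hk, hx.1 14 (by omega), hd.i14]
    · rintro k - s' ⟨hk, hF, him, hZ, w', hrm, hw⟩
      have hd' := hd.frame (b := 5) (b' := 4) hF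
      refine runs_block _ _ ⟨by simp [runAll, Instr.run, hk], hF.runAll (by decide),
        by simp [runAll, Instr.run, him], ?_, Function.update w' k (Hedge.weight a S k), ?_, ?_⟩
      · simp [runAll, Instr.run, hk, hZ, hrm, hd'.i11, hd'.r2, hd'.r5, hd'.r1, mem_grad,
          Hedge.total, Finset.sum_range_succ, Hedge.weight]
      · simp [runAll, Instr.run, hk, hrm, hd'.i11, hd'.i12, hd'.r2, hd'.r5, mem_grad,
          write_weight, Hedge.weight]
      · intro l hl
        rw [Function.update_apply]
        split_ifs with h
        · rw [h]
        · exact hw l (by omega)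
  exact h.mono (by omega) fun s' hs' => hs'.2

/-- The coefficients (column `n + 3`), which are added, divided by `T`, to column `n + 1`. -/
def coefProg : Prog :=
  .seq (block (.izero 20) []) (.loop (.ilt 20 14)
    (block (.rload 11 20 12) [.rdiv 12 1 11, .rsub 11 11 12, .rmul 11 0 11, .rdiv 11 11 10,
      .rstore 20 12 11, .rdiv 11 11 3, .rload 12 20 10, .radd 12 12 11, .rstore 20 10 12,
      .isucc 20]))

lemma runs_coefProg (hd : Data n m M a R T Φ y B s) (hs : s.rmem = mem n B c S w)
    (hZ : s.re 10 = Hedge.total M a S) (hw : ∀ k < M, w k = Hedge.weight a S k) :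
    Runs coefProg s (M * 12 + 2) fun s' => Frame 20 10 s s' ∧ s'.imem = s.imem ∧
      ∃ c' w', s'.rmem = mem n B c' S w' ∧ ∀ k < M, w' k = Hedge.coef M a R S k ∧
        c' k = c k + Hedge.coef M a R S k / T := by
  -- Column `n + 3` is overwritten in place: it holds coefficients before position `k` and weights
  -- from there on. The frame keeps real register `10`, which holds the normalization.
  let I : ℕ → State → Prop := fun k s' => s'.ix 20 = k ∧ Frame 20 11 s s' ∧ s'.imem = s.imem ∧
    ∃ c' w', s'.rmem = mem n B c' S w' ∧ ∀ l < M,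
      if l < k then w' l = Hedge.coef M a R S l ∧ c' l = c l + Hedge.coef M a R S l / T
      else w' l = Hedge.weight a S l ∧ c' l = c l
  have h : Runs coefProg s (1 + (M * (11 + 1) + 1)) (I M) := by
    refine Runs.seq (Q := I 0) (runs_block _ _ ?_) fun s' hs' => runs_loop I ?_ ?_ hs'
    · exact ⟨by simp [runAll, Instr.run], (Frame.refl _ _ _).runAll (by decide),
        by simp [runAll, Instr.run], c, w,
        by simp [runAll, Instr.run, hs], by simpa using hw⟩
    · rintro k s' ⟨hk, hx, -⟩
      simp only [Test.Holds, hk, hx.1 14 (by omega), hd.i14]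
    · rintro k hkM s' ⟨hk, hF, him, c', w', hrm, hcw⟩
      have hd' := hd.frame (b := 5) (b' := 5) hF
      have hZ' := (hF.2 10 (by omega)).trans hZ
      obtain ⟨hwk, hck⟩ := (if_neg (lt_irrefl k)).mp (hcw k hkM)
      refine runs_block _ _ ⟨by simp [runAll, Instr.run, hk], hF.runAll (by decide),
        by simp [runAll, Instr.run, him],
        Function.update c' k (c k + Hedge.coef M a R S k / T),
        Function.update w' k (Hedge.coef M a R S k), ?_, ?_⟩
      · simp [runAll, Instr.run, hk, hrm, hd'.i10, hd'.i12, hd'.r3, hd'.r0, hd'.r1, mem_coef,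
          mem_weight, write_weight, write_coef, hZ', hwk, hck, Hedge.coef]
      · intro l hl
        have := hcw l hl
        rcases eq_or_ne l k with rfl | hne
        · simp
        · simp only [Function.update_of_ne hne]
          by_cases hlk : l < k
          · rw [if_pos (by omega)]; rwa [if_pos hlk] at this
          · rw [if_neg (by omega)]; rwa [if_neg hlk] at this
  refine h.mono (by omega) fun s' hs' => ?_
  obtain ⟨-, hF, him, c', w', hrm, hcw⟩ := hs'
  exact ⟨hF.mono le_rfl (by omega), him, c', w', hrm, fun k hk => by
    have := hcw k hk
    rwa [if_pos hk] at this⟩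

/-- The prediction on the point in register `21`. -/
def marginProg : Prog :=
  .seq (block (.izero 20) [.iadd 22 13 20, .rzero 10]) (.loop (.ilt 20 14)
    (block (.rload 11 20 12) [.rload 12 21 22, .rmul 11 11 12, .radd 10 10 11, .isucc 20,
      .isucc 22]))

lemma runs_marginProg {i : ℕ} (hd : Data n m M a R T Φ y B s) (hs : s.rmem = mem n B c S w)
    (hi : i < m) (h21 : s.ix 21 = i) :
    Runs marginProg s (M * 7 + 4) fun s' => Frame 20 10 s s' ∧ s'.imem = s.imem ∧
      s'.rmem = s.rmem ∧ s'.ix 21 = i ∧ s'.re 10 = Hedge.margin M (Φ i) w := by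
  let I : ℕ → State → Prop := fun k s' => s'.ix 20 = k ∧ Frame 20 10 s s' ∧ s'.imem = s.imem ∧
    s'.rmem = s.rmem ∧ s'.ix 21 = i ∧ s'.ix 22 = n + 4 + k ∧ s'.re 10 = Hedge.margin k (Φ i) w
  have h : Runs marginProg s (3 + (M * (6 + 1) + 1)) (I M) := by
    refine Runs.seq (Q := I 0) (runs_block _ _ ?_) fun s' hs' => runs_loop I ?_ ?_ hs'
    · exact ⟨by simp [runAll, Instr.run], (Frame.refl _ _ _).runAll (by decide),
        by simp [runAll, Instr.run], by simp [runAll, Instr.run], by simp [runAll, Instr.run, h21],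
        by simp [runAll, Instr.run, hd.i13], by simp [runAll, Instr.run, Hedge.margin]⟩
    · rintro k s' ⟨hk, hx, -⟩
      simp only [Test.Holds, hk, hx.1 14 (by omega), hd.i14]
    · rintro k hkM s' ⟨hk, hF, him, hrm, h21, h22, h10⟩
      have hd' := hd.frame (b := 5) (b' := 4) hF
      refine runs_block _ _ ⟨by simp [runAll, Instr.run, hk], hF.runAll (by decide),
        by simp [runAll, Instr.run, him], by simp [runAll, Instr.run, hrm],
        by simp [runAll, Instr.run, h21], by simp [runAll, Instr.run, h22, add_assoc], ?_⟩
      simp [runAll, Instr.run, hk, hrm, hs, h21, h22, h10, hd'.i12, mem_weight, mem_feature,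
        hd.feat i hi k hkM, Hedge.margin, Finset.sum_range_succ]
  exact h.mono (by omega) fun s' hs' => ⟨hs'.2.1, hs'.2.2.1, hs'.2.2.2.1, hs'.2.2.2.2.1,
    hs'.2.2.2.2.2.2⟩

/-- Replaces the prediction in real register `10` by the derivative of the loss. -/
def slopeProg : Prog :=
  block (.rload 11 21 0) [.radd 12 11 11, .radd 10 10 10, .rmul 10 10 11, .rexp 10 10,
    .radd 10 1 10, .rsub 12 5 12, .rdiv 10 12 10, .izero 20, .iadd 22 13 20]

lemma runs_slopeProg {i : ℕ} {v : ℝ} (hd : Data n m M a R T Φ y B s)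
    (hs : s.rmem = mem n B c S w) (hi : i < m) (h21 : s.ix 21 = i) (h10 : s.re 10 = v) :
    Runs slopeProg s 10 fun s' => Frame 20 10 s s' ∧ s'.imem = s.imem ∧
      s'.rmem = s.rmem ∧ s'.ix 21 = i ∧ s'.ix 20 = 0 ∧ s'.ix 22 = n + 4 ∧
      s'.re 10 = Hedge.slope v (y i) := by
  refine runs_block _ _ ⟨(Frame.refl _ _ _).runAll (by decide), by simp [runAll, Instr.run],
    by simp [runAll, Instr.run], by simp [runAll, Instr.run, h21], by simp [runAll, Instr.run],
    by simp [runAll, Instr.run, hd.i13], ?_⟩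
  simp [runAll, Instr.run, hs, h21, h10, hd.i0, hd.r1, hd.r5, mem_label, hd.label i hi,
    Hedge.slope, two_mul]

/-- Adds the gradient of the loss at the point in register `21` to column `n + 2`. -/
def gradProg : Prog := .loop (.ilt 20 14)
  (block (.rload 11 20 11) [.rload 12 21 22, .rmul 12 10 12, .radd 11 11 12, .rstore 20 11 11,
    .isucc 20, .isucc 22])

lemma runs_gradProg {i : ℕ} {g : ℝ} (hd : Data n m M a R T Φ y B s)
    (hs : s.rmem = mem n B c S w) (hi : i < m) (h21 : s.ix 21 = i) (h20 : s.ix 20 = 0)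
    (h22 : s.ix 22 = n + 4) (h10 : s.re 10 = g) :
    Runs gradProg s (M * 8 + 1) fun s' => Frame 20 10 s s' ∧ s'.imem = s.imem ∧
      s'.ix 21 = i ∧
      ∃ S', s'.rmem = mem n B c S' w ∧ ∀ k < M, S' k = S k + g * Φ i k := by
  let I : ℕ → State → Prop := fun k s' => s'.ix 20 = k ∧ Frame 20 11 s s' ∧ s'.imem = s.imem ∧
    s'.ix 21 = i ∧ s'.ix 22 = n + 4 + k ∧
    ∃ S', s'.rmem = mem n B c S' w ∧ ∀ l < M, S' l = if l < k then S l + g * Φ i l else S l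
  have h : Runs gradProg s (M * (7 + 1) + 1) (I M) := by
    refine runs_loop I ?_ ?_ ⟨h20, Frame.refl _ _ _, rfl, h21, h22, S, hs, by simp⟩
    · rintro k s' ⟨hk, hx, -⟩
      simp only [Test.Holds, hk, hx.1 14 (by omega), hd.i14]
    · rintro k hkM s' ⟨hk, hF, him, h21, h22, S', hrm, hS'⟩
      have hd' := hd.frame (b := 5) (b' := 5) hF
      have h10' := (hF.2 10 (by omega)).trans h10
      have hSk := hS' k hkM
      rw [if_neg (lt_irrefl k)] at hSk
      refine runs_block _ _ ⟨by simp [runAll, Instr.run, hk], hF.runAll (by decide),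
        by simp [runAll, Instr.run, him], by simp [runAll, Instr.run, h21],
        by simp [runAll, Instr.run, h22, add_assoc], Function.update S' k (S k + g * Φ i k), ?_, ?_⟩
      · simp [runAll, Instr.run, hk, hrm, h21, h22, h10', hd'.i11, mem_grad, mem_feature,
          hd.feat i hi k hkM, write_grad, hSk]
      · intro l hl
        have := hS' l hl
        rcases eq_or_ne l k with rfl | hne
        · simp
        · rw [Function.update_of_ne hne, this]
          grind
  refine h.mono (by omega) fun s' hs' => ?_
  obtain ⟨-, hF, him, h21, -, S', hrm, hS'⟩ := hs'
  exact ⟨hF.mono le_rfl (by omega), him, h21, S', hrm, fun k hk => by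
    rw [hS' k hk, if_pos hk]⟩

/-- Adds the gradient of the total loss to column `n + 2`. -/
def sampleProg : Prog :=
  .seq (block (.izero 21) []) (.loop (.ilt 21 2)
    (.seq marginProg (.seq slopeProg (.seq gradProg (block (.isucc 21) [])))))

lemma runs_sampleProg (hd : Data n m M a R T Φ y B s) (hs : s.rmem = mem n B c S w) :
    Runs sampleProg s (m * (M * 15 + 17) + 2) fun s' => Frame 20 10 s s' ∧ s'.imem = s.imem ∧
      ∃ S', s'.rmem = mem n B c S' w ∧ ∀ k < M, S' k = S k + Hedge.grad M m Φ y w k := by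
  let I : ℕ → State → Prop := fun i s' => s'.ix 21 = i ∧ Frame 20 10 s s' ∧ s'.imem = s.imem ∧
      ∃ S', s'.rmem = mem n B c S' w ∧ ∀ k < M, S' k = S k + Hedge.grad M i Φ y w k
  have h : Runs sampleProg s (1 + (m * (((M * 7 + 4) + (10 + ((M * 8 + 1) + 1))) + 1) + 1))
      (I m) := by
    refine Runs.seq (Q := I 0) (runs_block _ _ ?_) fun s' hs' => runs_loop I ?_ ?_ hs'
    · exact ⟨by simp [runAll, Instr.run], (Frame.refl _ _ _).runAll (by decide),
        by simp [runAll, Instr.run], S, by simp [runAll, Instr.run, hs],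
        by simp [Hedge.grad]⟩
    · rintro k s' ⟨hk, hx, -⟩
      simp only [Test.Holds, hk, hx.1 2 (by omega), hd.i2]
    · rintro i hi s' ⟨h21, hF, him, S', hrm, hS'⟩
      have hd' := hd.frame (b := 5) (b' := 4) hF
      refine Runs.seq (runs_marginProg hd' hrm hi h21) ?_
      rintro s₁ ⟨hF₁, him₁, hrm₁, h21₁, h10₁⟩
      have hd₁ := hd'.frame (b := 5) (b' := 4) hF₁
      refine Runs.seq (runs_slopeProg hd₁ (hrm₁.trans hrm) hi h21₁ h10₁) ?_
      rintro s₂ ⟨hF₂, him₂, hrm₂, h21₂, h20₂, h22₂, h10₂⟩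
      have hd₂ := hd₁.frame (b := 5) (b' := 4) hF₂
      refine Runs.seq (runs_gradProg hd₂ (hrm₂.trans (hrm₁.trans hrm)) hi h21₂ h20₂ h22₂ h10₂) ?_
      rintro s₃ ⟨hF₃, him₃, h21₃, S'', hrm₃, hS''⟩
      refine runs_block _ _ ⟨by simp [runAll, Instr.run, h21₃],
        (((hF.trans hF₁).trans hF₂).trans hF₃).runAll (by decide),
        by simp [runAll, Instr.run, him, him₁, him₂, him₃], S'',
        by simp [runAll, Instr.run, hrm₃], fun k hk => ?_⟩
      rw [hS'' k hk, hS' k hk, Hedge.grad, Hedge.grad, Finset.sum_range_succ, add_assoc]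
  refine h.mono ?_ fun s' hs' => hs'.2
  have : m * (((M * 7 + 4) + (10 + ((M * 8 + 1) + 1))) + 1) = m * (M * 15 + 17) := by ring
  omega

/-- The memory agrees with the ideal sequences only at indices below `M`. This and the two following
congruences show that the descent does not depend on the other values. -/
lemma weight_congr {S S' : ℕ → ℝ} {k : ℕ} (h : S k = S' k) :
    Hedge.weight a S k = Hedge.weight a S' k := by
  rw [Hedge.weight, Hedge.weight, h]

lemma coef_congr {S S' : ℕ → ℝ} (h : ∀ k < M, S k = S' k) {k : ℕ} (hk : k < M) :
    Hedge.coef M a R S k = Hedge.coef M a R S' k := by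
  have ht : Hedge.total M a S = Hedge.total M a S' :=
    Finset.sum_congr rfl fun k hk => by rw [weight_congr (h k (Finset.mem_range.1 hk))]
  rw [Hedge.coef, Hedge.coef, ht, weight_congr (h k hk)]

lemma grad_congr {w w' : ℕ → ℝ} (h : ∀ k < M, w k = w' k) (k : ℕ) :
    Hedge.grad M m Φ y w k = Hedge.grad M m Φ y w' k := by
  refine Finset.sum_congr rfl fun i _ => ?_
  have : Hedge.margin M (Φ i) w = Hedge.margin M (Φ i) w' :=
    Finset.sum_congr rfl fun k hk => by rw [h k (Finset.mem_range.1 hk)]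
  rw [this]

/-- All rounds; real register `6` counts them. -/
def descentProg : Prog :=
  .seq (block (.rzero 6) []) (.loop (.rlt 6 3)
    (.seq weightProg (.seq coefProg (.seq sampleProg (block (.radd 6 6 1) [])))))

lemma runs_descentProg {T : ℕ} (hd : Data n m M a R T Φ y B s)
    (hs : s.rmem = mem n B 0 0 w) :
    Runs descentProg s (T * (M * 22 + m * (M * 15 + 17) + 9) + 2) fun s' => Frame 20 6 s s' ∧
      s'.imem = s.imem ∧ ∀ k < M, s'.rmem k (n + 1) = Hedge.average M m T a R Φ y k := by
  let I : ℕ → State → Prop := fun t s' => s'.re 6 = t ∧ Frame 20 6 s s' ∧ s'.imem = s.imem ∧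
      ∃ c S w, s'.rmem = mem n B c S w ∧ ∀ k < M, S k = Hedge.cumGrad M m a R Φ y t k ∧
        c k = ∑ t' ∈ Finset.range t, Hedge.coef M a R (Hedge.cumGrad M m a R Φ y t') k / T
  have h : Runs descentProg s (1 + (T * (((M * 10 + 3) + ((M * 12 + 2) +
      ((m * (M * 15 + 17) + 2) + 1))) + 1) + 1)) (I T) := by
    refine Runs.seq (Q := I 0) (runs_block _ _ ?_) fun s' hs' => runs_loop I ?_ ?_ hs'
    · exact ⟨by simp [runAll, Instr.run], (Frame.refl _ _ _).runAll (by decide),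
        by simp [runAll, Instr.run], 0, 0, w, by simp [runAll, Instr.run, hs],
        by simp [Hedge.cumGrad]⟩
    · rintro k s' ⟨hk, hx, -⟩
      simp only [Test.Holds, hk, hx.2 3 (by omega), hd.r3, Nat.cast_lt]
    · rintro t - s' ⟨h6, hF, him, c, S, w, hrm, hcS⟩
      have hd' := hd.frame (b := 5) (b' := 0) hF
      refine Runs.seq (runs_weightProg hd' hrm) ?_
      rintro s₁ ⟨hF₁, him₁, h10₁, w₁, hrm₁, hw₁⟩
      have hd₁ := hd'.frame (b := 5) (b' := 4) hF₁
      refine Runs.seq (runs_coefProg hd₁ hrm₁ h10₁ hw₁) ?_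
      rintro s₂ ⟨hF₂, him₂, c₂, w₂, hrm₂, hcw₂⟩
      have hd₂ := hd₁.frame (b := 5) (b' := 4) hF₂
      refine Runs.seq (runs_sampleProg hd₂ hrm₂) ?_
      rintro s₃ ⟨hF₃, him₃, S₃, hrm₃, hS₃⟩
      have hd₃ := hd₂.frame (b := 5) (b' := 4) hF₃
      have hF' := (hF₁.trans hF₂).trans hF₃
      have h6' := (hF'.2 6 (by omega)).trans h6
      have hcoef : ∀ k < M, Hedge.coef M a R S k =
          Hedge.coef M a R (Hedge.cumGrad M m a R Φ y t) k :=
        fun k hk => coef_congr (fun k hk => (hcS k hk).1) hk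
      refine runs_block _ _ ⟨by simp [runAll, Instr.run, h6', hd₃.r1],
        (hF.trans (hF'.mono (b' := 20) (c' := 6) le_rfl (by omega))).runAll (by decide),
        by simp [runAll, Instr.run, him, him₁, him₂, him₃], c₂, S₃, w₂,
        by simp [runAll, Instr.run, hrm₃], fun k hk => ⟨?_, ?_⟩⟩
      · rw [hS₃ k hk, (hcS k hk).1, Hedge.cumGrad]
        congr 1
        exact grad_congr (fun k hk => by rw [(hcw₂ k hk).1, hcoef k hk]) k
      · rw [(hcw₂ k hk).2, (hcS k hk).2, Finset.sum_range_succ, hcoef k hk]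
  refine h.mono ?_ fun s' hs' => ?_
  · have : T * (((M * 10 + 3) + ((M * 12 + 2) + ((m * (M * 15 + 17) + 2) + 1))) + 1) =
      T * (M * 22 + m * (M * 15 + 17) + 9) := by ring
    omega
  · obtain ⟨-, hF, him, c, S, w, hrm, hcS⟩ := hs'
    refine ⟨hF, him, fun k hk => ?_⟩
    rw [hrm, mem_coef, (hcS k hk).2, Hedge.average]

end RealRAM

/-! #### The program -/

namespace RealRAM

/-- The inverse step size `8 τ m` (real register `2`) and the number `16 τ² M` of rounds (real
register `3`). -/
def scalarProg : Prog :=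
  .seq (castProg 6 3) (.seq (castProg 7 2) (.seq (castProg 8 14)
    (block (.rmul 2 6 7) [.radd 2 2 2, .radd 2 2 2, .radd 2 2 2, .rmul 3 6 6, .rmul 3 3 8,
      .radd 3 3 3, .radd 3 3 3, .radd 3 3 3, .radd 3 3 3, .rzero 5])))

lemma runs_scalarProg {n D m τ M : ℕ} {R : ℝ} {x : ℕ → ℕ → ℝ} {y : ℕ → ℝ} {s : State}
    (hC : Consts n D m τ s) (hT : Terms n m M x y s) (h14 : s.ix 14 = M) (h0 : s.re 0 = R) :
    Runs scalarProg s (τ * 3 + m * 3 + M * 3 + 20) fun s' =>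
      Data n m M (8 * τ * m) R (16 * τ ^ 2 * M : ℕ) (fun i => feature n (x i)) y s.rmem s' ∧
      s'.imem = s.imem ∧ s'.rmem = s.rmem := by
  have hi3 := hC.i3
  have hi2 := hC.i2
  have h : Runs scalarProg s ((s.ix 3 * 3 + 3) + ((s.ix 2 * 3 + 3) + ((s.ix 14 * 3 + 3) + 11)))
      fun s' => (∀ q ≠ 30, s'.ix q = s.ix q) ∧ s'.re 0 = R ∧ s'.re 1 = 1 ∧
        s'.re 2 = 8 * τ * m ∧ s'.re 3 = (16 * τ ^ 2 * M : ℕ) ∧ s'.re 5 = 0 ∧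
        s'.imem = s.imem ∧ s'.rmem = s.rmem := by
    refine Runs.seq (runs_castProg (by omega) (by omega) hC.r1) ?_
    rintro s₁ ⟨hx₁, hr₁, hv₁, him₁, hrm₁⟩
    rw [← hx₁ 2 (by omega)]
    refine Runs.seq (runs_castProg (by omega) (by omega)
      ((hr₁ 1 (by omega)).trans hC.r1)) ?_
    rintro s₂ ⟨hx₂, hr₂, hv₂, him₂, hrm₂⟩
    have e14 : s₂.ix 14 = s.ix 14 := by rw [hx₂ _ (by omega), hx₁ _ (by omega)]
    have e1 : s₂.re 1 = 1 := by rw [hr₂ _ (by omega), hr₁ _ (by omega), hC.r1]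
    rw [← e14]
    refine Runs.seq (runs_castProg (by omega) (by omega) e1) ?_
    rintro s₃ ⟨hx₃, hr₃, hv₃, him₃, hrm₃⟩
    have f6 : s₃.re 6 = τ := by rw [hr₃ _ (by omega), hr₂ _ (by omega), hv₁, hi3]
    have f7 : s₃.re 7 = m := by rw [hr₃ _ (by omega), hv₂, hx₁ _ (by omega), hi2]
    have f8 : s₃.re 8 = M := by rw [hv₃, e14, h14]
    have f0 : s₃.re 0 = R := by rw [hr₃ _ (by omega), hr₂ _ (by omega), hr₁ _ (by omega), h0]
    have f1 : s₃.re 1 = 1 := by rw [hr₃ _ (by omega), e1]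
    refine runs_block _ _ ⟨fun q hq => ?_, ?_, ?_, ?_, ?_, ?_, ?_, ?_⟩
    · simp [runAll, Instr.run, hx₃ q hq, hx₂ q hq, hx₁ q hq]
    · simp [runAll, Instr.run, f0]
    · simp [runAll, Instr.run, f1]
    · simp [runAll, Instr.run, f6, f7]; ring
    · simp [runAll, Instr.run, f6, f8]; ring
    · simp [runAll, Instr.run]
    · simp [runAll, Instr.run, him₁, him₂, him₃]
    · simp [runAll, Instr.run, hrm₁, hrm₂, hrm₃]
  refine h.mono (by omega) ?_
  rintro s' ⟨hx, r0, r1, r2, r3, r5, him, hrm⟩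
  refine ⟨⟨?_, ?_, ?_, ?_, ?_, ?_, ?_, r0, r1, r2, r3, r5, hT.label, hT.feature_eq⟩, him, hrm⟩ <;>
  rw [hx _ (by omega)]
  exacts [hC.i0, hC.i2, hC.i10, hC.i11, hC.i12, hC.i13, h14]

/-- Outputs the number of terms. -/
def outputProg : Prog :=
  .seq (block (.izero 0) []) (.loop (.ilt 0 14) (block (.isucc 0) []))

/-- The step count is also bounded below, since `Outputs` requires that the number of listed terms
not exceed the running time. `Runs` records only upper bounds, so the execution is followed exactly.
-/
lemma exec_outputProg (s : State) : ∃ t s', s.ix 14 ≤ t ∧ t ≤ s.ix 14 * 2 + 2 ∧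
    Exec outputProg s t s' ∧ s'.ix 0 = s.ix 14 ∧ s'.imem = s.imem ∧ s'.rmem = s.rmem := by
  have key : ∀ j (s : State), s.ix 0 + j = s.ix 14 → ∃ s',
      Exec (.loop (.ilt 0 14) (block (.isucc 0) [])) s (j * 2 + 1) s' ∧
      s'.ix 0 = s.ix 14 ∧ s'.imem = s.imem ∧ s'.rmem = s.rmem := by
    intro j
    induction j with
    | zero =>
      intro s hs
      exact ⟨s, .loopStop (by simp only [Test.Holds]; omega), by omega, rfl, rfl⟩
    | succ j ih =>
      intro s hs
      obtain ⟨s', he, h0, him, hrm⟩ := ih ((Instr.isucc 0).run s)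
        (by simp [Instr.run]; omega)
      refine ⟨s', ?_, ?_, ?_, ?_⟩
      · have := Exec.loopStep (c := .ilt 0 14) (by simp only [Test.Holds]; omega)
          (Exec.prim (.isucc 0) s) he
        rw [show (j + 1) * 2 + 1 = 1 + (j * 2 + 1) + 1 by ring]
        exact this
      · simpa [Instr.run] using h0
      · simpa [Instr.run] using him
      · simpa [Instr.run] using hrm
  obtain ⟨s', he, h0, him, hrm⟩ := key (s.ix 14) ((Instr.izero 0).run s) (by simp [Instr.run])
  refine ⟨1 + (s.ix 14 * 2 + 1), s', by omega, by omega, .seq (.prim (.izero 0) s) he, ?_, ?_, ?_⟩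
  · simpa [Instr.run] using h0
  · simpa [Instr.run] using him
  · simpa [Instr.run] using hrm

/-- Approximate `ℓ¹`-constrained logistic regression. -/
def regressionProg : Prog :=
  .seq treeSizeProg (.seq constsProg (.seq rootProg (.seq enumProg (.seq scalarProg
    (.seq descentProg outputProg)))))

/-- The dominant cost is the descent, with at most `16 Q³` rounds of `O(Q²)` steps each. -/
lemma time_le {n D m τ c M T Q : ℕ} (hQ : 1 ≤ Q) (hn : n ≤ Q) (hD : D ≤ Q) (hm : m ≤ Q)
    (hτ : τ ≤ Q) (hc : c ≤ Q) (hM : M ≤ Q) (hT : T = 16 * τ ^ 2 * M) :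
    (D * (n * 3 + 8) + 3) + (13 + ((m * 3 + 1) + ((c * (n * (n * 4 + m * 6 + 12) + 4) + 2) +
      ((τ * 3 + m * 3 + M * 3 + 20) + ((T * (M * 22 + m * (M * 15 + 17) + 9) + 2) +
        (M * 2 + 2)))))) ≤ 2000 * Q ^ 5 := by
  subst hT
  have h1 : 1 ≤ Q ^ 5 := Nat.one_le_pow _ _ hQ
  have h2 : Q ≤ Q ^ 5 := Nat.le_self_pow (by norm_num) Q
  have h3 : Q ^ 2 ≤ Q ^ 5 := Nat.pow_le_pow_right hQ (by norm_num)
  have h4 : Q ^ 3 ≤ Q ^ 5 := Nat.pow_le_pow_right hQ (by norm_num)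
  have h5 : Q ^ 4 ≤ Q ^ 5 := Nat.pow_le_pow_right hQ (by norm_num)
  calc _ ≤ (Q * (Q * 3 + 8) + 3) + (13 + ((Q * 3 + 1) +
      ((Q * (Q * (Q * 4 + Q * 6 + 12) + 4) + 2) +
      ((Q * 3 + Q * 3 + Q * 3 + 20) +
        ((16 * Q ^ 2 * Q * (Q * 22 + Q * (Q * 15 + 17) + 9) + 2) + (Q * 2 + 2)))))) := by
        gcongr
    _ ≤ 2000 * Q ^ 5 := by
        ring_nf
        omega

lemma runs_regressionProg {n D m τ : ℕ} (hn : 1 ≤ n) (hD : 1 ≤ D) (hm : 1 ≤ m) (hτ : 1 ≤ τ)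
    {R : ℝ} {x : Fin m → Fin n → ℝ} {y : Fin m → ℝ} :
    ∃ t s, Exec regressionProg (input n D m τ R x y) t s ∧
      t ≤ 64000 * (m * τ * max n 2 ^ D) ^ 5 ∧ treeSize n (D + 1) ≤ t ∧
      s.ix 0 = treeSize n (D + 1) ∧
      (∀ k < treeSize n (D + 1), ∀ l < n, s.imem k l = expo n k l) ∧
      ∀ k < treeSize n (D + 1), s.rmem k (n + 1) =
        Hedge.average (treeSize n (D + 1)) m (16 * τ ^ 2 * treeSize n (D + 1)) (8 * τ * m) R
          (fun i => feature n ((input n D m τ R x y).rmem i))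
          (fun i => (input n D m τ R x y).rmem i n) k := by
  set s₀ := input n D m τ R x y with hs₀
  set M := treeSize n (D + 1) with hM
  have hrun : Runs (.seq treeSizeProg (.seq constsProg (.seq rootProg (.seq enumProg
      (.seq scalarProg descentProg))))) s₀ ((D * (n * 3 + 8) + 3) + (13 + ((m * 3 + 1) +
        ((treeSize n D * (n * (n * 4 + m * 6 + 12) + 4) + 2) + ((τ * 3 + m * 3 + M * 3 + 20) +
        (16 * τ ^ 2 * M * (M * 22 + m * (M * 15 + 17) + 9) + 2))))))
      fun s => s.ix 14 = M ∧ (∀ k < M, ∀ l < n, s.imem k l = expo n k l) ∧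
      ∀ k < M, s.rmem k (n + 1) = Hedge.average M m (16 * τ ^ 2 * M) (8 * τ * m) R
          (fun i => feature n (s₀.rmem i)) (fun i => s₀.rmem i n) k := by
    refine Runs.seq (runs_treeSizeProg (n := n) (D := D) (by simp [hs₀, input])
      (by simp [hs₀, input])) ?_
    rintro s₁ ⟨hF₁, h5₁, him₁, hrm₁⟩
    have e0 : s₁.ix 0 = n := by rw [hF₁.1 _ (by omega)]; simp [hs₀, input]
    have e1 : s₁.ix 1 = D := by rw [hF₁.1 _ (by omega)]; simp [hs₀, input]
    have e2 : s₁.ix 2 = m := by rw [hF₁.1 _ (by omega)]; simp [hs₀, input]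
    have e3 : s₁.ix 3 = τ := by rw [hF₁.1 _ (by omega)]; simp [hs₀, input]
    have r0 : s₁.re 0 = R := by rw [hF₁.2 _ (by omega)]; simp [hs₀, input]
    refine Runs.seq (Q := fun s => Consts n D m τ s ∧
      Terms n m 0 s₀.rmem (fun i => s₀.rmem i n) s ∧ s.ix 14 = 1 ∧ s.ix 20 = 0 ∧ s.re 0 = R)
      (runs_block _ _ ?_) ?_
    · refine ⟨⟨?_, ?_, ?_, ?_, ?_, ?_, ?_, ?_, ?_, ?_, ?_⟩, ⟨by simp, ?_, ?_, ?_, ?_, by simp⟩,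
        ?_, ?_, ?_⟩
      · simp [runAll, Instr.run, e0]
      · simp [runAll, Instr.run, e1]
      · simp [runAll, Instr.run, e2]
      · simp [runAll, Instr.run, e3]
      · simp [runAll, Instr.run, h5₁]
      · simp [runAll, Instr.run]
      · simp [runAll, Instr.run, e0]
      · simp [runAll, Instr.run, e0]
      · simp [runAll, Instr.run, e0]
      · simp [runAll, Instr.run, e0]
      · simp [runAll, Instr.run]
      · simp [runAll, Instr.run, him₁, hs₀, input]
      · simp [runAll, Instr.run, hrm₁]
      · simp [runAll, Instr.run, hrm₁]
      · simp [runAll, Instr.run, hrm₁, hs₀, input]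
      · simp [runAll, Instr.run]
      · simp [runAll, Instr.run]
      · simp [runAll, Instr.run, r0]
    rintro s₂ ⟨hC₂, hT₂, h14₂, h20₂, r0₂⟩
    refine Runs.seq (runs_rootProg hC₂ hT₂ h20₂) ?_
    rintro s₃ ⟨hF₃, hT₃⟩
    have hC₃ := hC₂.frame (c := 8) (hF₃.mono (by omega) (by omega))
    have h14₃ := (hF₃.1 14 (by omega)).trans h14₂
    have r0₃ := (hF₃.2 0 (by omega)).trans r0₂
    refine Runs.seq (runs_enumProg hC₃ hT₃ h14₃) ?_
    rintro s₄ ⟨hF₄, hT₄, h14₄⟩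
    have hC₄ := hC₃.frame (c := 8) hF₄
    have r0₄ := (hF₄.2 0 (by omega)).trans r0₃
    refine Runs.seq (runs_scalarProg hC₄ hT₄ h14₄ r0₄) ?_
    rintro s₅ ⟨hd, him₅, hrm₅⟩
    -- The coefficients and cumulative gradients start at `0`. The content of column `n + 3` is
    -- irrelevant, as each round recomputes the weights.
    have hmem : s₅.rmem = mem n s₄.rmem 0 0 (fun k => s₄.rmem k (n + 3)) := by
      rw [hrm₅]
      funext p q
      have := hT₄.zero p
      simp only [mem, Pi.zero_apply]
      grind
    refine (runs_descentProg hd hmem).mono le_rfl ?_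
    rintro s₆ ⟨hF₆, him₆, hc⟩
    refine ⟨(hF₆.1 14 (by omega)).trans hd.i14, ?_, hc⟩
    rw [him₆, him₅]
    exact hT₄.expo_eq
  obtain ⟨t, s, ht, he, h14, him, hc⟩ := hrun
  obtain ⟨t', s', ht1, ht2, he', h0, him', hrm'⟩ := exec_outputProg s
  rw [h14] at ht1 ht2 h0
  -- The output phase was executed separately for its lower bound; the sequence is rebracketed to
  -- include it.
  have hassoc : ∃ t'', t'' = t + t' ∧ Exec regressionProg s₀ t'' s' := by
    cases he with
    | seq h₁ he =>
    cases he with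
    | seq h₂ he =>
    cases he with
    | seq h₃ he =>
    cases he with
    | seq h₄ he =>
    cases he with
    | seq h₅ he =>
    exact ⟨_, by omega, .seq h₁ (.seq h₂ (.seq h₃ (.seq h₄ (.seq h₅ (.seq he he')))))⟩
  obtain ⟨_, rfl, hexec⟩ := hassoc
  refine ⟨t + t', s', hexec, ?_, by omega, h0, by rwa [him'], by rwa [hrm']⟩
  have hb : 1 ≤ max n 2 := by omega
  have hpow : max n 2 ≤ max n 2 ^ D := Nat.le_self_pow (by omega) _
  have hpow2 : D ≤ max n 2 ^ D :=
    (Nat.lt_two_pow_self).le.trans (Nat.pow_le_pow_left (by omega) D)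
  have hmτ : 1 ≤ m * τ := Nat.mul_pos hm hτ
  set B := m * τ * max n 2 ^ D with hB
  have hP : max n 2 ^ D ≤ B := Nat.le_mul_of_pos_left _ hmτ
  have hP1 : 1 ≤ max n 2 ^ D := Nat.one_le_pow _ _ hb
  have hmB : m ≤ B := (Nat.le_mul_of_pos_right m hτ).trans (Nat.le_mul_of_pos_right _ hP1)
  have hτB : τ ≤ B := (Nat.le_mul_of_pos_left τ hm).trans (Nat.le_mul_of_pos_right _ hP1)
  have hMB : M + 1 ≤ 2 * B := (treeSize_succ_le_two_mul n D).trans (by omega)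
  have hcM : treeSize n D ≤ M := by
    rw [hM, treeSize]
    exact (Nat.le_mul_of_pos_left _ hn).trans (Nat.le_succ _)
  -- All parameters are at most `2 B`, where the factor `2` comes from the number of terms. This
  -- gives `2000 · 2 ^ 5 = 64000`.
  have := time_le (n := n) (D := D) (m := m) (τ := τ) (c := treeSize n D) (M := M) (Q := 2 * B)
    (by omega) (by omega) (by omega) (by omega) (by omega) (by omega) (by omega) rfl
  rw [mul_pow] at this
  omega

end RealRAM

/-! #### Correctness of the program -/

namespace RealRAM

lemma input_rmem_point {n D m τ : ℕ} {R : ℝ} {x : Fin m → Fin n → ℝ} {y : Fin m → ℝ}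
    (i : Fin m) (l : Fin n) : (input n D m τ R x y).rmem i l = x i l := by
  simp [input]

lemma input_rmem_label {n D m τ : ℕ} {R : ℝ} {x : Fin m → Fin n → ℝ} {y : Fin m → ℝ}
    (i : Fin m) : (input n D m τ R x y).rmem i n = y i := by
  simp [input]

lemma feature_input {n D m τ : ℕ} {R : ℝ} {x : Fin m → Fin n → ℝ} {y : Fin m → ℝ}
    (i : Fin m) (k : ℕ) : feature n ((input n D m τ R x y).rmem i) k =
      ∏ l : Fin n, x i l ^ expo n k l := by
  rw [feature, Finset.prod_range]
  simp only [input_rmem_point]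

/-- A monomial may occur at several nodes; its whole coefficient is placed at one chosen node. Hence
a competitor on `Mono n D` is also one for the descent over the heap. -/
lemma exists_margin_eq_predict {n D : ℕ} (u : Mono n D → ℝ) : ∃ c : ℕ → ℝ,
    ∑ k ∈ Finset.range (treeSize n (D + 1)), |c k| ≤ l1norm u ∧ ∀ x : Fin n → ℝ,
      Hedge.margin (treeSize n (D + 1)) (fun k => ∏ l : Fin n, x l ^ expo n k l) c =
        predict u x := by
  choose κ hκ hκe using fun α : Mono n D => exists_expo_eq D (fun j => (α.1 j : ℕ)) α.2
  refine ⟨fun k => ∑ α, if κ α = k then u α else 0, ?_, fun x => ?_⟩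
  · calc ∑ k ∈ Finset.range (treeSize n (D + 1)), |∑ α, if κ α = k then u α else 0|
        ≤ ∑ k ∈ Finset.range (treeSize n (D + 1)), ∑ α, if κ α = k then |u α| else 0 := by
          refine Finset.sum_le_sum fun k _ => (Finset.abs_sum_le_sum_abs _ _).trans (le_of_eq ?_)
          exact Finset.sum_congr rfl fun α _ => by split_ifs <;> simp
      _ = l1norm u := by
          rw [Finset.sum_comm, l1norm]
          refine Finset.sum_congr rfl fun α _ => ?_
          rw [Finset.sum_ite_eq, if_pos (Finset.mem_range.2 (hκ α))]
  · simp only [Hedge.margin, Finset.sum_mul]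
    rw [Finset.sum_comm, predict]
    refine Finset.sum_congr rfl fun α _ => ?_
    simp only [ite_mul, zero_mul]
    rw [Finset.sum_ite_eq, if_pos (Finset.mem_range.2 (hκ α)), monoFeature]
    simp only [hκe]

/-- The descent is optimal over the heap up to `R / τ`. Collecting its terms preserves the
predictions and does not increase the norm, and every competitor lifts by
`exists_margin_eq_predict`. -/
theorem exists_outputs_regressionProg {n D m τ : ℕ} (hn : 1 ≤ n) (hD : 1 ≤ D) (hm : 1 ≤ m)
    (hτ : 1 ≤ τ) {R : ℝ} (hR : 0 ≤ R) {x : Fin m → Fin n → ℝ} {y : Fin m → ℝ}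
    (hx : ∀ i k, |x i k| ≤ 1) (hy : ∀ i, y i = 1 ∨ y i = -1) :
    ∃ (t : ℕ) (u : Mono n D → ℝ), Outputs regressionProg τ R x y t u ∧
      t ≤ 64000 * (m * τ * max n 2 ^ D) ^ 5 ∧ l1norm u ≤ R ∧
      ∀ u' : Mono n D → ℝ, l1norm u' ≤ R → empLoss x y u ≤ empLoss x y u' + R / τ := by
  obtain ⟨t, s, he, ht, hMt, h0, him, hrm⟩ :=
    runs_regressionProg hn hD hm hτ (R := R) (x := x) (y := y)
  set M := treeSize n (D + 1) with hM
  set T := 16 * τ ^ 2 * M with hT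
  set Φ : ℕ → ℕ → ℝ := fun i => feature n ((input n D m τ R x y).rmem i) with hΦ
  set y' : ℕ → ℝ := fun i => (input n D m τ R x y).rmem i n with hy'
  set c := Hedge.average M m T (8 * τ * m) R Φ y' with hc
  have hM1 : 1 ≤ M := one_le_treeSize_succ n D
  have hT1 : 1 ≤ T := Nat.mul_pos (Nat.mul_pos (by norm_num) (pow_pos hτ 2)) hM1
  have hdeg : ∀ k : Fin M, ∑ j : Fin n, expo n k j ≤ D := fun k => sum_expo_le hn D k.2
  have hΦx : ∀ i : Fin m, Φ i = fun k => ∏ l : Fin n, x i l ^ expo n k l := fun i => by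
    funext k
    exact feature_input i k
  have hΦ1 : ∀ i < m, ∀ k < M, |Φ i k| ≤ 1 := by
    intro i hi k _
    rw [hΦx ⟨i, hi⟩, Finset.abs_prod]
    refine Finset.prod_le_one (fun _ _ => abs_nonneg _) fun l _ => ?_
    rw [abs_pow]
    exact pow_le_one₀ (abs_nonneg _) (hx _ l)
  have hy1 : ∀ i < m, y' i = 1 ∨ y' i = -1 := by
    intro i hi
    have : y' i = y ⟨i, hi⟩ := input_rmem_label ⟨i, hi⟩
    rw [this]
    exact hy _
  set u : Mono n D → ℝ := collect D (fun (k : Fin M) (j : Fin n) => expo n k j)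
    (fun k => c k) with hu
  have hpred : ∀ i : Fin m, predict u (x i) = Hedge.margin M (Φ i) c := by
    intro i
    rw [hu, predict_collect _ hdeg, Hedge.margin, Finset.sum_range, hΦx i]
  refine ⟨t, u, ⟨s, he, h0.trans_le hMt, fun k hk => ?_, fun α => ?_⟩, ht, ?_, ?_⟩
  · rw [h0] at hk
    calc ∑ j : Fin n, s.imem k j = ∑ j : Fin n, expo n k j :=
          Finset.sum_congr rfl fun j _ => him k hk j j.2
      _ ≤ D := sum_expo_le hn D hk
  · rw [h0, Finset.sum_range, hu, collect]
    refine Finset.sum_congr rfl fun k _ => ?_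
    simp only [hrm k k.2, him k k.2 _ (Fin.is_lt _)]
  · refine (l1norm_collect_le _ hdeg).trans ?_
    have := Hedge.sum_abs_average_le (Φ := Φ) (y := y') (m := m) (a := 8 * τ * m) hM1 hR hT1
    rwa [Finset.sum_range] at this
  · intro u' hu'
    obtain ⟨c', hc', hmar⟩ := exists_margin_eq_predict u'
    have key := Hedge.sum_logisticLoss_average_le hτ hm hM1 rfl hΦ1 hy1 T hT c' (hc'.trans hu')
    rw [Finset.sum_range, Finset.sum_range] at key
    have hy2 : ∀ i : Fin m, y' i = y i := fun i => input_rmem_label i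
    simp only [← hpred, ← hc, hy2] at key
    rw [← hM] at hmar
    simp only [hΦx, hmar] at key
    have hm0 : (0 : ℝ) < m := by exact_mod_cast hm
    rw [empLoss, empLoss, ← sub_le_iff_le_add', ← sub_div, div_le_iff₀ hm0]
    linarith

end RealRAM

/-! ### The main theorem -/

lemma measurable_netPre {n h : ℕ} (b₁ : ℝ) (w β b₂ : Fin h → ℝ) (W : Fin h → Fin n → ℝ)
    (hβ : ∀ j, 0 ≤ β j ∧ β j ≤ 1) : Measurable (netPre b₁ w β b₂ W) := by
  have : Continuous (netPre b₁ w β b₂ W) := by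
    refine continuous_const.add (continuous_finsetSum _ fun j _ => continuous_const.mul
      ((continuous_fAct (hβ j).1 (hβ j).2).comp ?_))
    fun_prop
  exact this.measurable

lemma exists_isL1Regression {n D m : ℕ} {R : ℝ} (hR : 0 ≤ R) (x : Fin m → Fin n → ℝ)
    (y : Fin m → ℝ) : ∃ u : Mono n D → ℝ, IsL1Regression R x y u := by
  have hcl : IsClosed {u : Mono n D → ℝ | l1norm u ≤ R} :=
    isClosed_le continuous_l1norm continuous_const
  have hbd : Bornology.IsBounded {u : Mono n D → ℝ | l1norm u ≤ R} := by
    refine (Metric.isBounded_closedBall (x := (0 : Mono n D → ℝ)) (r := R)).subset fun u hu => ?_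
    rw [mem_closedBall_zero_iff, pi_norm_le_iff_of_nonneg hR]
    exact fun α => (Finset.single_le_sum (f := fun α => |u α|) (fun _ _ => abs_nonneg _)
      (Finset.mem_univ α)).trans hu
  have hne : {u : Mono n D → ℝ | l1norm u ≤ R}.Nonempty := ⟨0, by simpa [l1norm] using hR⟩
  have hcont : Continuous fun u : Mono n D → ℝ => empLoss x y u := by
    refine Continuous.div_const (continuous_finsetSum _ fun i _ => ?_) _
    refine continuous_logisticLoss.comp (Continuous.prodMk ?_ continuous_const)
    exact continuous_finsetSum _ fun α _ => (continuous_apply α).mul continuous_const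
  obtain ⟨u, hu, hmin⟩ := (Metric.isCompact_of_isClosed_isBounded hcl hbd).exists_isMinOn hne
    hcont.continuousOn
  exact ⟨u, hu, fun u' hu' => hmin hu'⟩

theorem mainTheorem2 :
    -- one program and one polynomial, for all problems
    ∃ (A : RealRAM.Prog) (C : ℕ),
      -- on every sample the program solves the regression problem up to `R / τ`, in time
      -- polynomial in `m`, `τ` and `n ^ D`
      (∀ (n D m τ : ℕ), 1 ≤ n → 1 ≤ D → 1 ≤ m → 1 ≤ τ →
        ∀ (R : ℝ), 0 ≤ R → ∀ (x : Fin m → Fin n → ℝ) (y : Fin m → ℝ),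
          (∀ i k, |x i k| ≤ 1) → (∀ i, y i = 1 ∨ y i = -1) →
          ∃ (t : ℕ) (u : Mono n D → ℝ), RealRAM.Outputs A τ R x y t u ∧
            t ≤ C * (m * τ * (max n 2) ^ D) ^ C ∧
            l1norm u ≤ R ∧
            ∀ u' : Mono n D → ℝ, l1norm u' ≤ R → empLoss x y u ≤ empLoss x y u' + R / τ) ∧
      -- the statistical guarantees
      ∀ (n D h m : ℕ), 1 ≤ n → 1 ≤ D → 1 ≤ m →
        ∀ {Ω : Type*} [MeasurableSpace Ω] (μ : Measure Ω) [IsProbabilityMeasure μ]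
          (X : Ω → Fin n → ℝ) (Y : Ω → ℝ)
          (b₁ : ℝ) (w : Fin h → ℝ) (β : Fin h → ℝ) (b₂ : Fin h → ℝ) (W : Fin h → Fin n → ℝ),
          Measurable X → Measurable Y →
          (∀ᵐ ω ∂μ, Y ω = 1 ∨ Y ω = -1) →
          (∀ᵐ ω ∂μ, ∀ k, |X ω k| ≤ 1) →
          (∀ j, 0 ≤ β j ∧ β j ≤ 1) →
          (μ[Y | MeasurableSpace.comap X inferInstance]
            =ᵐ[μ] fun ω => Real.tanh (netPre b₁ w β b₂ W (X ω))) →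
          -- `v*(X) = artanh (E[Y | X])` minimizes the expected logistic loss
          ((fun ω => Real.artanh ((μ[Y | MeasurableSpace.comap X inferInstance]) ω))
            =ᵐ[μ] fun ω => netPre b₁ w β b₂ W (X ω)) ∧
          Integrable (fun ω => logisticLoss (netPre b₁ w β b₂ W (X ω)) (Y ω)) μ ∧
          (∀ g : (Fin n → ℝ) → ℝ, Measurable g →
            ∫⁻ ω, ENNReal.ofReal (logisticLoss (netPre b₁ w β b₂ W (X ω)) (Y ω)) ∂μ
              ≤ ∫⁻ ω, ENNReal.ofReal (logisticLoss (g (X ω)) (Y ω)) ∂μ) ∧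
          -- the regression problem has a solution on every sample
          (∀ (x : Fin m → Fin n → ℝ) (y : Fin m → ℝ),
            ∃ u : Mono n D → ℝ, IsL1Regression (l1Radius D b₁ w β b₂ W) x y u) ∧
          ∀ {Ω' : Type*} [MeasurableSpace Ω'] (P : Measure Ω') [IsProbabilityMeasure P]
            (S : Fin m → Ω' → (Fin n → ℝ) × ℝ) (δ : ℝ),
            iIndepFun S P →
            (∀ i, IdentDistrib (S i) (fun ω => (X ω, Y ω)) P μ) →
            0 < δ → δ < 1 →
            -- with probability at least `1 - δ`, every exact solution has small excess loss
            P {ω' | ∃ u : Mono n D → ℝ,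
                IsL1Regression (l1Radius D b₁ w β b₂ W)
                  (fun i => (S i ω').1) (fun i => (S i ω').2) u ∧
                excessBound D m (l1Radius D b₁ w β b₂ W) δ w W
                  < (∫ ω, logisticLoss (predict u (X ω)) (Y ω) ∂μ)
                    - ∫ ω, logisticLoss (netPre b₁ w β b₂ W (X ω)) (Y ω) ∂μ}
              ≤ ENNReal.ofReal δ ∧
            -- and so does the output of the program, for every accuracy `τ ≥ 4 m`
            ∀ τ : ℕ, 4 * m ≤ τ →
              P {ω' | ∃ (t : ℕ) (u : Mono n D → ℝ),
                  RealRAM.Outputs A τ (l1Radius D b₁ w β b₂ W)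
                    (fun i => (S i ω').1) (fun i => (S i ω').2) t u ∧
                  excessBound D m (l1Radius D b₁ w β b₂ W) δ w W
                    < (∫ ω, logisticLoss (predict u (X ω)) (Y ω) ∂μ)
                      - ∫ ω, logisticLoss (netPre b₁ w β b₂ W (X ω)) (Y ω) ∂μ}
                ≤ ENNReal.ofReal δ := by
  -- The same `C` serves as factor and as exponent, where `5` would suffice. It is kept opaque so
  -- that the power is never evaluated.
  obtain ⟨C, hC⟩ : ∃ C : ℕ, C = 64000 := ⟨_, rfl⟩
  have hprog := @RealRAM.exists_outputs_regressionProg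
  refine ⟨RealRAM.regressionProg, C, ?_, ?_⟩
  · intro n D m τ hn hD hm hτ R hR x y hx hy
    obtain ⟨t, u, ho, ht, hu, hmin⟩ := hprog hn hD hm hτ hR hx hy
    refine ⟨t, u, ho, ht.trans ?_, hu, hmin⟩
    rw [← hC]
    refine Nat.mul_le_mul_left _ (Nat.pow_le_pow_right ?_ (by omega))
    have : 0 < max n 2 := by omega
    positivity
  intro n D h m hn hD hm Ω _ μ _ X Y b₁ w β b₂ W hX hY hY1 hX1 hβ hc
  obtain ⟨u₀, hu₀, happ⟩ := exists_predict_approx hD b₁ w β b₂ W hβ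
  have hv := measurable_netPre b₁ w β b₂ W hβ
  set v := netPre b₁ w β b₂ W with hvdef
  set R := l1Radius D b₁ w β b₂ W with hRdef
  set ε := ∑ j, |w j| *
    ((l1norm (W j) + 2 * l1norm (W j) ^ 2) / (1 + 1 / (2 * l1norm (W j))) ^ D) with hε
  have hR : 0 ≤ R := (l1norm_nonneg _).trans hu₀
  -- The network is bounded on the cube because it is uniformly close to the polynomial of `u₀`,
  -- which is bounded by `R`.
  have hB : ∀ᵐ ω ∂μ, |v (X ω)| ≤ R + 4 * ε := by
    filter_upwards [hX1] with ω hω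
    have h1 := abs_le.1 (happ (X ω) hω)
    have h2 := abs_le.1 ((abs_predict_le hω u₀).trans hu₀)
    rw [abs_le]
    constructor <;> linarith
  have hint := integrable_logisticLoss hX hY hY1 hv hB
  refine ⟨?_, hint, fun g hg => lintegral_logisticLoss_le hX hY hY1 hv hB hc hg,
    exists_isL1Regression hR, ?_⟩
  · filter_upwards [hc] with ω hω
    rw [hω, Real.artanh_tanh]
  intro Ω' _ P _ S δ hS hid hδ0 hδ1
  have hpm : Measurable fun x : Fin n → ℝ => predict u₀ x :=
    Finset.measurable_sum _ fun α _ => (measurable_monoFeature α).const_mul _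
  have hint₀ : Integrable (fun ω => logisticLoss (predict u₀ (X ω)) (Y ω)) μ :=
    integrable_logisticLoss hX hY hY1 hpm (B := R) (by
      filter_upwards [hX1] with ω hω using (abs_predict_le hω u₀).trans hu₀)
  -- The `2`-Lipschitz loss doubles the approximation error `4 ε`.
  have hbias : ∫ ω, logisticLoss (predict u₀ (X ω)) (Y ω) ∂μ -
      ∫ ω, logisticLoss (v (X ω)) (Y ω) ∂μ ≤ 8 * ε := by
    rw [← integral_sub hint₀ hint]
    calc ∫ ω, (logisticLoss (predict u₀ (X ω)) (Y ω) - logisticLoss (v (X ω)) (Y ω)) ∂μ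
        ≤ ∫ _, 8 * ε ∂μ := by
          refine integral_mono_ae (hint₀.sub hint) (integrable_const _) ?_
          filter_upwards [hX1, hY1] with ω h1 h2
          have h3 := (le_abs_self _).trans
            (abs_logisticLoss_sub_le h2 (predict u₀ (X ω)) (v (X ω)))
          linarith [happ (X ω) h1]
      _ = 8 * ε := by simp
  have hgood : ∀ᵐ ω' ∂P, ∀ i, (∀ k, |(S i ω').1 k| ≤ 1) ∧
      ((S i ω').2 = 1 ∨ (S i ω').2 = -1) := by
    rw [ae_all_iff]
    intro i
    refine (hid i).symm.ae_snd (p := fun z => (∀ k, |z.1 k| ≤ 1) ∧ (z.2 = 1 ∨ z.2 = -1)) ?_ ?_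
    · refine MeasurableSet.inter ?_ ?_
      · refine MeasurableSet.congr (MeasurableSet.iInter fun k => measurableSet_le
          (f := fun z : (Fin n → ℝ) × ℝ => |z.1 k|)
          (((measurable_pi_apply k).comp measurable_fst).abs) (measurable_const (a := (1 : ℝ)))) ?_
        ext z
        simp only [Set.mem_iInter, Set.mem_ofPred_eq]
        rfl
      · exact (measurableSet_eq_fun measurable_snd measurable_const).union
          (measurableSet_eq_fun measurable_snd measurable_const)
    · filter_upwards [hX1, hY1] with ω h1 h2 using ⟨h1, h2⟩
  have hmain := measure_exists_excess_le hn hD hm hX hY hY1 hX1 hS hid hδ0 hδ1 hu₀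
  have hm0 : (0 : ℝ) < m := by exact_mod_cast hm
  refine ⟨(measure_mono_ae ?_).trans hmain, fun τ hτ => (measure_mono_ae ?_).trans hmain⟩
  · filter_upwards [hgood] with ω' hω'
    rintro ⟨u, ⟨hu, hmin⟩, hexc⟩
    refine ⟨hω', u, hu, (hmin u₀ hu₀).trans ?_, ?_⟩
    · have : 0 ≤ R / (4 * m) := by positivity
      linarith
    · rw [excessBound, ← hε] at hexc
      linarith
  · filter_upwards [hgood] with ω' hω'
    rintro ⟨t, u, ho, hexc⟩
    obtain ⟨t', u', ho', -, hu', hmin⟩ := hprog hn hD hm (by omega : 1 ≤ τ) hR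
      (fun i => (hω' i).1) (fun i => (hω' i).2)
    -- By determinism the given output is the one that carries the guarantee.
    obtain rfl := ho.unique ho'
    refine ⟨hω', u, hu', (hmin u₀ hu₀).trans ?_, ?_⟩
    · have : R / τ ≤ R / (4 * m) :=
        div_le_div_of_nonneg_left hR (by positivity) (by exact_mod_cast hτ)
      linarith
    · rw [excessBound, ← hε] at hexc
      linarith
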